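/- **Setting.** Let $d_x,d_\alpha$ be the dimensions of state and control. $\mathcal P_2=\mathcal P_2(\mathbb R^{d_x})$ is the space of probability measures on $\mathbb R^{d_x}$ with finite second moment, with the metric $W_2$; $\|\mu\|_p=(\int|x|^p\,d\mu)^{1/p}$, and $X\#m$ is the push-forward. Let $f:\mathbb R^{d_x}\times\mathcal P_2\times\mathbb R^{d_\alpha}\to\mathbb R^{d_x}$ and $g:\mathbb R^{d_x}\times\mathcal P_2\times\mathbb R^{d_\alpha}\to\mathbb R$ be continuous and $p:\mathbb R^{d_x}\times\mathcal P_2\to\mathbb R^{d_x}$. A function $h$ on $\mathcal P_2$ is *regularly differentiable* if it has a linear functional derivative $\frac{\delta h}{\delta\mu}$, i.e. a jointly continuous function with $|\frac{\delta h}{\delta\mu}(\mu)(x)|\le c(\mu)(1+|x|^2)$, $\int\frac{\delta h}{\delta\mu}(\mu)\,d\mu=0$ and $h(\nu_1)-h(\nu_2)=\int_0^1\!\int\frac{\delta h}{\delta\mu}(\theta\nu_1+(1-\theta)\nu_2)(x)\,d(\nu_1-\nu_2)(x)\,d\theta$, which is differentiable in $x$ with jointly continuous $\partial_\mu h(\mu)(x):=\partial_x\frac{\delta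 h}{\delta\mu}(\mu)(x)$ satisfying $|\partial_\mu h(\mu)(x)|\le c(\mu)(1+|x|)$; each $c$ is bounded on bounded sets of $\mathcal P_2$. *$L$-differentiability* of $h$ is Fréchet differentiability of the lift $X\mapsto h(\mathrm{Law}(X))$ on the space of square-integrable random vectors, with $Dh(X)Y=E[\partial_\mu h(\mathrm{Law}(X))(X)\,Y]$. **(a1)** $f$ is differentiable in $x$ and $\alpha$; $f,\partial_xf,\partial_\alpha f$ are regularly differentiable in $\mu$; the derivatives $\partial_xf,\partial_\alpha f,\partial_\mu f,\partial_x\partial_xf,\partial_\alpha\partial_xf,\partial_\alpha\partial_\alpha f,\partial_\mu\partial_xf,\partial_\mu\partial_\alpha f$ exist and are jointly continuous; and, for positive constants $\lambda_f,\Lambda_1,\Lambda_2,\Lambda_3,\bar l_f,\mathrm{Lip}_f$: $\big|\sum_i\xi_i\partial_\alpha f_i\big|^2\ge\lambda_f|\xi|^2$ for all $\xi\in\mathbb R^{d_x}$; $\|\partial_\alpha f\|\le\Lambda_1$, $\|\partial_\mu f(\cdot)(\tilde x)\|\le\Lambda_2$, $\|\partial_xf\|\le\Lambda_3$; each of the five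 second-order derivatives has norm at most $\bar l_f/(1+|x|+\|\mu\|_1)$ and is jointly Lipschitz (w.r.t. $W_2$ in $\mu$), in the sense that its difference at two points is at most $\mathrm{Lip}_f/(1+\max\{|x|,|x'|\}+\max\{\|\mu\|_1,\|\mu'\|_1\})$ times the sum of the distances of the arguments. **(a2)** $g$ is differentiable in $x$ and $\alpha$; $g,\partial_xg,\partial_\alpha g$ are regularly differentiable in $\mu$; $\partial_x\partial_xg,\partial_x\partial_\alpha g,\partial_\alpha\partial_\alpha g,\partial_\mu\partial_xg,\partial_\mu\partial_\alpha g$ exist and are jointly Lipschitz; and, for positive constants $\lambda_g,\Lambda_g,\bar l_g$ and a real $l_g<\lambda_g$: $\eta^\top\partial_\alpha\partial_\alpha g\,\eta\ge\lambda_g|\eta|^2$; $\xi^\top\partial_x\partial_xg\,\xi\ge\lambda_g|\xi|^2$; $\int(g(x,\mu',\alpha)-g(x,\mu,\alpha))\,d(\mu'-\mu)(x)\ge-l_g\big|\int y\,d(\mu-\mu')(y)\big|^2$; the norms of $\partial_\alpha\partial_\alpha g,\partial_x\partial_xg,\partial_\mu\partial_xg$ are at most $\Lambda_g$; those of $\partial_x\partial_\alpha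 g,\partial_\mu\partial_\alpha g$ are at most $\bar l_g$. **(P)** $p$ is differentiable in $x$ and $L$-differentiable in $\mu$, $\partial_xp(x,\mu)$ and $\partial_\mu p(x,\mu)(\tilde x)$ are jointly Lipschitz with norms at most $L_p$, and $|p(x,\mu)|\le\bar L_p(1+|x|+\|\mu\|_1)$, where $L_p,\bar L_p>0$. **Notation.** $k_0:=4\bar L_p$ and $c_{k_0}:=\{(x,\mu,z):|z|\le\frac12k_0(1+|x|+\|\mu\|_1)\}$; $\alpha(x,\mu,z)$ is the minimizer of $a\mapsto f(x,\mu,a)\cdot z+g(x,\mu,a)$; $\Lambda_f=\max\{\Lambda_1,\Lambda_2,\Lambda_3\}$, $L_f=\max\{\Lambda_f,|f(0,\delta_0,0)|\}$, $L_g=\max\{|\partial_xg(0,\delta_0,0)|,|\partial_\alpha g(0,\delta_0,0)|,\Lambda_g,\bar l_g\}$, $L_\alpha=\max\{\frac{20\Lambda_f}{19\lambda_g},\frac{20(\bar l_g+\frac12k_0\bar l_f)}{19\lambda_g},|\alpha(0,\delta_0,0)|\}$. Put $F(x,\mu,z)=f(x,\mu,\alpha(x,\mu,z))$ and $B(x,\mu,z)=\partial_xf(x,\mu,\alpha(x,\mu,z))\cdot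 z+\partial_xg(x,\mu,\alpha(x,\mu,z))$, where $\partial_xf\cdot z$ is the gradient in $x$ of $f\cdot z$. The FBODE system on $[t,\widetilde T]$ with initial law $m$ is $$\tfrac{d}{ds}X_s(x)=F(X_s(x),X_s\#m,Z_s(x)),\quad X_t(x)=x,$$ $$\tfrac{d}{ds}Z_s(x)=-B(X_s(x),X_s\#m,Z_s(x)),\quad Z_{\widetilde T}(x)=p(X_{\widetilde T}(x),X_{\widetilde T}\#m).$$ Given $\gamma:[t,\widetilde T]\times\mathbb R^{d_x}\times\mathcal P_2\to\mathbb R^{d_x}$, the forward equation started from $m$ at time $s$ is $$X^{s,m}_\tau(x)=x+\int_s^\tau F\big(X^{s,m}_u(x),X^{s,m}_u\#m,\gamma(u,X^{s,m}_u(x),X^{s,m}_u\#m)\big)\,du,\quad\tau\in[s,\widetilde T]\qquad(\ast)$$ (with $X^{s,m}_\tau\in L^2_m$ measurable, and $X^{s,m}_\tau(x)$ and $X^{s,m}_\tau\#m$ continuous in $\tau$). $\gamma$ is a *decoupling field* on $[t,\widetilde T]$ if for all $s\in[t,\widetilde T]$, $m\in\mathcal P_2$ some solution of $(\ast)$ satisfies,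 for all $x$, $$\gamma(s,x,m)=p(X^{s,m}_{\widetilde T}(x),X^{s,m}_{\widetilde T}\#m)+\int_s^{\widetilde T}B\big(X^{s,m}_\tau(x),X^{s,m}_\tau\#m,\gamma(\tau,X^{s,m}_\tau(x),X^{s,m}_\tau\#m)\big)\,d\tau.$$ Finally $|||\gamma|||_{1,[t,\widetilde T]}=\sup_{s,x,\mu}|\gamma(s,x,\mu)|/(1+|x|+\|\mu\|_1)$. **Theorem (Local-in-time existence).** Assume (a1), (a2), (P), $L_p\le\bar L_p$ and $$\sup_{x,\mu,a}\|\partial_\alpha\partial_\alpha f(x,\mu,a)\|\,(1+|x|+\|\mu\|_1)\le\frac{\lambda_g}{40\bar L_p}.$$ Then for every $(x,\mu,z)\in c_{k_0}$ the minimizer $\alpha(x,\mu,z)$ exists, is unique and satisfies $\partial_\alpha f\cdot z+\partial_\alpha g=0$. There is $\epsilon_1>0$, depending (for given dimensions) only on $\bar L_p,L_f,\Lambda_f,\bar l_f,L_g,\Lambda_g,\bar l_g,L_\alpha$, such that for all $0\le t\le\widetilde T\le T$ with $\widetilde T-t\le\epsilon_1$ there is exactly one continuous decoupling field $\gamma$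 on $[t,\widetilde T]$ with $|||\gamma|||_{1,[t,\widetilde T]}\le2\bar L_p$. Moreover, for all $r\in[t,\widetilde T]$ and $m\in\mathcal P_2$, $(\ast)$ has exactly one solution $X^{r,m}$ started from $m$ at time $r$ and, with $Z^{r,m}_s(x):=\gamma(s,X^{r,m}_s(x),X^{r,m}_s\#m)$: 1. $(X^{r,m},Z^{r,m})$ solves the FBODE system on $[r,\widetilde T]$; 2. for each $s$, $X^{r,m}_s(x)$ and $Z^{r,m}_s(x)$ are continuous in $(r,m,x)\in[t,s]\times\mathcal P_2\times\mathbb R^{d_x}$; they are continuously differentiable in $s\in[r,\widetilde T]$; 3. $|Z^{r,m}_s(x)|\le2\bar L_p\big(1+|X^{r,m}_s(x)|+\int|X^{r,m}_s(y)|\,dm(y)\big)$, that is, $(X^{r,m}_s(x),X^{r,m}_s\#m,Z^{r,m}_s(x))\in c_{k_0}$; 4. $X^{r,m}_\tau(x)=X^{s,\,X^{r,m}_s\#m}_\tau\big(X^{r,m}_s(x)\big)$ for all $t\le r\le s\le\tau\le\widetilde T$. -/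

import Mathlib

open MeasureTheory Set Filter Topology

noncomputable section

/-- `ℝ^d` with its Euclidean norm and inner product. -/
abbrev Euc (d : ℕ) : Type := EuclideanSpace ℝ (Fin d)

/-- The space of Borel probability measures on `ℝ^d` with finite second moment. -/
structure P2 (d : ℕ) where
  toMeasure : Measure (Euc d)
  isProb : IsProbabilityMeasure toMeasure
  memLp : MemLp (fun x : Euc d => x) 2 toMeasure

namespace P2

variable {d : ℕ}

instance (μ : P2 d) : IsProbabilityMeasure μ.toMeasure := μ.isProb

/-- `‖μ‖₁ = ∫ |x| dμ(x)`. -/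
def norm1 (μ : P2 d) : ℝ := ∫ x, ‖x‖ ∂μ.toMeasure

/-- `‖μ‖₂ = (∫ |x|² dμ(x))^(1/2)`. -/
def norm2 (μ : P2 d) : ℝ := Real.sqrt (∫ x, ‖x‖ ^ 2 ∂μ.toMeasure)

/-- `π` is a joint law with marginals `μ` and `ν`. -/
def IsCoupling (μ ν : P2 d) (π : Measure (Euc d × Euc d)) : Prop :=
  π.map Prod.fst = μ.toMeasure ∧ π.map Prod.snd = ν.toMeasure

/-- The Wasserstein distance `W₂`. -/
def W2 (μ ν : P2 d) : ℝ :=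
  Real.sqrt (sInf {c : ℝ | ∃ π : Measure (Euc d × Euc d),
    IsCoupling μ ν π ∧ c = ∫ q, ‖q.1 - q.2‖ ^ 2 ∂π})

/-- The topology of the metric `W₂`: a set is open iff it contains a `W₂`-ball around each of
its points. -/
instance : TopologicalSpace (P2 d) where
  IsOpen U := ∀ μ ∈ U, ∃ ε > 0, ∀ ν, W2 μ ν < ε → ν ∈ U
  isOpen_univ := fun _ _ => ⟨1, one_pos, fun _ _ => mem_univ _⟩
  isOpen_inter := by
    intro U V hU hV μ hμ
    obtain ⟨ε, hε, h⟩ := hU μ hμ.1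
    obtain ⟨ε', hε', h'⟩ := hV μ hμ.2
    exact ⟨min ε ε', lt_min hε hε', fun ν hν =>
      ⟨h ν (hν.trans_le (min_le_left _ _)), h' ν (hν.trans_le (min_le_right _ _))⟩⟩
  isOpen_sUnion := by
    intro S hS μ hμ
    obtain ⟨U, hUS, hμU⟩ := hμ
    obtain ⟨ε, hε, h⟩ := hS U hUS μ hμU
    exact ⟨ε, hε, fun ν hν => ⟨U, hUS, h ν hν⟩⟩

/-- The Dirac measure at `a`. -/
def dirac (a : Euc d) : P2 d where
  toMeasure := Measure.dirac a
  isProb := inferInstance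
  memLp := by
    have h : (fun x : Euc d => x) =ᵐ[Measure.dirac a] fun _ => a := by
      rw [Filter.EventuallyEq, ae_dirac_eq]; simp
    exact (memLp_congr_ae h).2 (memLp_const a)

open Classical in
/-- The push-forward `X # m` of `m` under `X ∈ L²_m` (the value for other `X` plays no role). -/
def map (m : P2 d) (X : Euc d → Euc d) : P2 d :=
  if h : Measurable X ∧ MemLp X 2 m.toMeasure then
    { toMeasure := m.toMeasure.map X
      isProb := Measure.isProbabilityMeasure_map h.1.aemeasurable
      memLp := (memLp_map_measure_iff aestronglyMeasurable_id h.1.aemeasurable).2 h.2 }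
  else dirac 0

/-- The mixture `θ μ + (1 - θ) ν` for `θ ∈ [0,1]`. -/
def mix (θ : unitInterval) (μ ν : P2 d) : P2 d where
  toMeasure := ENNReal.ofReal θ • μ.toMeasure + ENNReal.ofReal (1 - θ) • ν.toMeasure
  isProb := ⟨by
    simp only [Measure.coe_add, Measure.coe_smul, Pi.add_apply, Pi.smul_apply, measure_univ,
      smul_eq_mul, mul_one]
    rw [← ENNReal.ofReal_add θ.2.1 (sub_nonneg.2 θ.2.2)]
    simp⟩
  memLp := by
    have key : ∀ (ρ : P2 d) (c : ℝ), Integrable (fun x : Euc d => ‖x‖ ^ 2)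
        (ENNReal.ofReal c • ρ.toMeasure) := fun ρ c =>
      ((memLp_two_iff_integrable_sq_norm aestronglyMeasurable_id).1 ρ.memLp).smul_measure
        ENNReal.ofReal_ne_top
    exact (memLp_two_iff_integrable_sq_norm aestronglyMeasurable_id).2
      ((key μ θ).add_measure (key ν (1 - θ)))

/-- The law of a square-integrable random vector on `[0,1]` with Lebesgue measure. Every element
of `P2 d` is such a law. -/
def law (X : Lp (Euc d) 2 (volume : Measure unitInterval)) : P2 d where
  toMeasure := (volume : Measure unitInterval).map X
  isProb := Measure.isProbabilityMeasure_map (Lp.aestronglyMeasurable X).aemeasurable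
  memLp := (memLp_map_measure_iff aestronglyMeasurable_id
    (Lp.aestronglyMeasurable X).aemeasurable).2 (Lp.memLp X)

end P2

/-! ### Derivatives in the measure argument -/

section MeasureDerivatives

variable {d : ℕ} {F : Type*} [NormedAddCommGroup F] [NormedSpace ℝ F]

/-- `c` is bounded on the bounded subsets of `P2 d`. -/
def BoundedOnBounded (c : P2 d → ℝ) : Prop :=
  ∀ R : ℝ, ∃ C : ℝ, ∀ μ : P2 d, μ.norm2 ≤ R → c μ ≤ C

/-- `δ` is the (normalized) linear functional derivative of `h`. -/
structure IsLinearFunctionalDeriv (h : P2 d → F) (δ : P2 d → Euc d → F) : Prop where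
  continuous : Continuous fun q : P2 d × Euc d => δ q.1 q.2
  growth : ∃ c : P2 d → ℝ, BoundedOnBounded c ∧ ∀ μ x, ‖δ μ x‖ ≤ c μ * (1 + ‖x‖ ^ 2)
  formula : ∀ ν₁ ν₂ : P2 d, h ν₁ - h ν₂ =
    ∫ θ : unitInterval, ((∫ x, δ (P2.mix θ ν₁ ν₂) x ∂ν₁.toMeasure)
      - ∫ x, δ (P2.mix θ ν₁ ν₂) x ∂ν₂.toMeasure)
  normalized : ∀ μ : P2 d, ∫ x, δ μ x ∂μ.toMeasure = 0

/-- `h` is regularly (linear-functionally) differentiable, with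
`D μ x = ∂_μ h(μ)(x) = ∂_x (δh/δμ)(μ)(x)`. -/
def HasRegularDeriv (h : P2 d → F) (D : P2 d → Euc d → Euc d →L[ℝ] F) : Prop :=
  ∃ δ : P2 d → Euc d → F, IsLinearFunctionalDeriv h δ ∧
    (∀ μ x, HasFDerivAt (δ μ) (D μ x) x) ∧
    (Continuous fun q : P2 d × Euc d => D q.1 q.2) ∧
    ∃ c : P2 d → ℝ, BoundedOnBounded c ∧ ∀ μ x, ‖D μ x‖ ≤ c μ * (1 + ‖x‖)

/-- `h` is `L`-differentiable on `P2 d` with `L`-derivative `D μ x = ∂_μ h(μ)(x)`: the lift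
`X ↦ h(law X)` to the Hilbert space of square-integrable random vectors is Fréchet
differentiable, with derivative `Y ↦ E[∂_μ h(law X)(X) Y]` at `X`. -/
def HasLDeriv (h : P2 d → F) (D : P2 d → Euc d → Euc d →L[ℝ] F) : Prop :=
  ∀ X : Lp (Euc d) 2 (volume : Measure unitInterval),
    ∃ L : Lp (Euc d) 2 (volume : Measure unitInterval) →L[ℝ] F,
      HasFDerivAt (fun Y : Lp (Euc d) 2 (volume : Measure unitInterval) => h (P2.law Y)) L X ∧
      ∀ Y : Lp (Euc d) 2 (volume : Measure unitInterval),
        L Y = ∫ ω, D (P2.law X) (X ω) (Y ω)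

end MeasureDerivatives

/-! ### Partial derivatives in the state and in the control, joint Lipschitz continuity -/

section Partial

variable {n k : ℕ} {F : Type*} [NormedAddCommGroup F] [NormedSpace ℝ F]

/-- `∂_x h(x,μ,α)`. -/
def dX (h : Euc n → P2 n → Euc k → F) (x : Euc n) (μ : P2 n) (a : Euc k) : Euc n →L[ℝ] F :=
  fderiv ℝ (fun y => h y μ a) x

/-- `∂_α h(x,μ,α)`. -/
def dA (h : Euc n → P2 n → Euc k → F) (x : Euc n) (μ : P2 n) (a : Euc k) : Euc k →L[ℝ] F :=
  fderiv ℝ (fun b => h x μ b) a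

/-- `h` is differentiable in the state. -/
def DiffX (h : Euc n → P2 n → Euc k → F) : Prop :=
  ∀ x μ a, DifferentiableAt ℝ (fun y => h y μ a) x

/-- `h` is differentiable in the control. -/
def DiffA (h : Euc n → P2 n → Euc k → F) : Prop :=
  ∀ x μ a, DifferentiableAt ℝ (fun b => h x μ b) a

/-- `h(x,·,α)` is regularly differentiable for all `x`, `α`, with
`D x μ a y = ∂_μ h(x,μ,a)(y)`. -/
def HasRegularMuDeriv (h : Euc n → P2 n → Euc k → F)
    (D : Euc n → P2 n → Euc k → Euc n → Euc n →L[ℝ] F) : Prop :=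
  ∀ x a, HasRegularDeriv (fun μ => h x μ a) (fun μ y => D x μ a y)

/-- Joint continuity in `(x,μ,α)`. -/
def JointCont (h : Euc n → P2 n → Euc k → F) : Prop :=
  Continuous fun q : Euc n × P2 n × Euc k => h q.1 q.2.1 q.2.2

/-- Joint continuity in `(x,μ,α,y)`. -/
def JointContMu (h : Euc n → P2 n → Euc k → Euc n → F) : Prop :=
  Continuous fun q : Euc n × P2 n × Euc k × Euc n => h q.1 q.2.1 q.2.2.1 q.2.2.2

/-- Joint Lipschitz continuity in `(x,μ,α)`. -/
def JointLip (h : Euc n → P2 n → Euc k → F) : Prop :=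
  ∃ C : ℝ, ∀ x x' μ μ' a a',
    ‖h x μ a - h x' μ' a'‖ ≤ C * (‖x - x'‖ + P2.W2 μ μ' + ‖a - a'‖)

/-- Joint Lipschitz continuity in `(x,μ,α,y)`. -/
def JointLipMu (h : Euc n → P2 n → Euc k → Euc n → F) : Prop :=
  ∃ C : ℝ, ∀ x x' μ μ' a a' y y',
    ‖h x μ a y - h x' μ' a' y'‖ ≤ C * (‖x - x'‖ + P2.W2 μ μ' + ‖a - a'‖ + ‖y - y'‖)

/-- Joint Lipschitz continuity in `(x,μ,α)` with a constant that decays at infinity. -/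
def DecayLip (C : ℝ) (h : Euc n → P2 n → Euc k → F) : Prop :=
  ∀ x x' μ μ' a a', ‖h x μ a - h x' μ' a'‖ ≤
    C / (1 + max ‖x‖ ‖x'‖ + max μ.norm1 μ'.norm1) *
      (‖x - x'‖ + P2.W2 μ μ' + ‖a - a'‖)

/-- Joint Lipschitz continuity in `(x,μ,α,y)` with a constant that decays at infinity. -/
def DecayLipMu (C : ℝ) (h : Euc n → P2 n → Euc k → Euc n → F) : Prop :=
  ∀ x x' μ μ' a a' y y', ‖h x μ a y - h x' μ' a' y'‖ ≤
    C / (1 + max ‖x‖ ‖x'‖ + max μ.norm1 μ'.norm1) *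
      (‖x - x'‖ + P2.W2 μ μ' + ‖a - a'‖ + ‖y - y'‖)

end Partial

/-! ### Assumptions on the coefficients -/

section Assumptions

variable {n k : ℕ}

/-- The standing assumption on the drift `f`, with given measure derivatives
`fm = ∂_μ f`, `fmx = ∂_μ ∂_x f`, `fma = ∂_μ ∂_α f`. -/
structure DriftAssumptionWith (f : Euc n → P2 n → Euc k → Euc n)
    (lamf Lam1 Lam2 Lam3 lbf Lipf : ℝ)
    (fm : Euc n → P2 n → Euc k → Euc n → Euc n →L[ℝ] Euc n)
    (fmx : Euc n → P2 n → Euc k → Euc n → Euc n →L[ℝ] Euc n →L[ℝ] Euc n)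
    (fma : Euc n → P2 n → Euc k → Euc n → Euc n →L[ℝ] Euc k →L[ℝ] Euc n) : Prop where
  pos_lamf : 0 < lamf
  pos_Lam1 : 0 < Lam1
  pos_Lam2 : 0 < Lam2
  pos_Lam3 : 0 < Lam3
  pos_lbf : 0 < lbf
  pos_Lipf : 0 < Lipf
  -- existence and joint continuity of the derivatives
  cont : JointCont f
  diff_x : DiffX f
  diff_a : DiffA f
  diff_m : HasRegularMuDeriv f fm
  diff_mx : HasRegularMuDeriv (dX f) fmx
  diff_ma : HasRegularMuDeriv (dA f) fma
  diff_xx : DiffX (dX f)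
  diff_ax : DiffA (dX f)
  diff_aa : DiffA (dA f)
  cont_x : JointCont (dX f)
  cont_a : JointCont (dA f)
  cont_m : JointContMu fm
  cont_xx : JointCont (dX (dX f))
  cont_ax : JointCont (dA (dX f))
  cont_aa : JointCont (dA (dA f))
  cont_mx : JointContMu fmx
  cont_ma : JointContMu fma
  -- nondegeneracy; note `∑ᵢⱼ ξᵢ ∂_α fᵢ · ξⱼ ∂_α fⱼ = |∑ᵢ ξᵢ ∂_α fᵢ|² = |(∂_α f)ᵀ ξ|²`
  nondegenerate : ∀ x μ a (ξ : Euc n),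
    lamf * ‖ξ‖ ^ 2 ≤ ‖ContinuousLinearMap.adjoint (dA f x μ a) ξ‖ ^ 2
  -- bounds on the first-order derivatives
  bound_a : ∀ x μ a, ‖dA f x μ a‖ ≤ Lam1
  bound_m : ∀ x μ a y, ‖fm x μ a y‖ ≤ Lam2
  bound_x : ∀ x μ a, ‖dX f x μ a‖ ≤ Lam3
  -- bounds on the second-order derivatives
  bound_aa : ∀ x μ a, ‖dA (dA f) x μ a‖ * (1 + ‖x‖ + μ.norm1) ≤ lbf
  bound_ax : ∀ x μ a, ‖dA (dX f) x μ a‖ * (1 + ‖x‖ + μ.norm1) ≤ lbf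
  bound_xx : ∀ x μ a, ‖dX (dX f) x μ a‖ * (1 + ‖x‖ + μ.norm1) ≤ lbf
  bound_ma : ∀ x μ a y, ‖fma x μ a y‖ * (1 + ‖x‖ + μ.norm1) ≤ lbf
  bound_mx : ∀ x μ a y, ‖fmx x μ a y‖ * (1 + ‖x‖ + μ.norm1) ≤ lbf
  -- Lipschitz continuity of the second-order derivatives
  lip_aa : DecayLip Lipf (dA (dA f))
  lip_ax : DecayLip Lipf (dA (dX f))
  lip_xx : DecayLip Lipf (dX (dX f))
  lip_ma : DecayLipMu Lipf fma
  lip_mx : DecayLipMu Lipf fmx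

/-- The standing assumption on the drift `f`. -/
def DriftAssumption (f : Euc n → P2 n → Euc k → Euc n)
    (lamf Lam1 Lam2 Lam3 lbf Lipf : ℝ) : Prop :=
  ∃ fm fmx fma, DriftAssumptionWith f lamf Lam1 Lam2 Lam3 lbf Lipf fm fmx fma

/-- The standing assumption on the running cost `g`, with given measure derivatives
`gm = ∂_μ g`, `gmx = ∂_μ ∂_x g`, `gma = ∂_μ ∂_α g`. -/
structure CostAssumptionWith (g : Euc n → P2 n → Euc k → ℝ)
    (lamg lg Lamg lbg : ℝ)
    (gm : Euc n → P2 n → Euc k → Euc n → Euc n →L[ℝ] ℝ)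
    (gmx : Euc n → P2 n → Euc k → Euc n → Euc n →L[ℝ] Euc n →L[ℝ] ℝ)
    (gma : Euc n → P2 n → Euc k → Euc n → Euc n →L[ℝ] Euc k →L[ℝ] ℝ) : Prop where
  pos_lamg : 0 < lamg
  pos_Lamg : 0 < Lamg
  pos_lbg : 0 < lbg
  lg_lt : lg < lamg
  -- existence of the derivatives, Lipschitz continuity of those of second order
  cont : JointCont g
  diff_x : DiffX g
  diff_a : DiffA g
  diff_m : HasRegularMuDeriv g gm
  diff_mx : HasRegularMuDeriv (dX g) gmx
  diff_ma : HasRegularMuDeriv (dA g) gma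
  diff_xx : DiffX (dX g)
  diff_xa : DiffX (dA g)
  diff_aa : DiffA (dA g)
  lip_xx : JointLip (dX (dX g))
  lip_xa : JointLip (dX (dA g))
  lip_aa : JointLip (dA (dA g))
  lip_mx : JointLipMu gmx
  lip_ma : JointLipMu gma
  -- convexity in the control
  convex_a : ∀ x μ a (η : Euc k), lamg * ‖η‖ ^ 2 ≤ dA (dA g) x μ a η η
  -- convexity in the state and monotonicity
  convex_x : ∀ x μ a (ξ : Euc n), lamg * ‖ξ‖ ^ 2 ≤ dX (dX g) x μ a ξ ξ
  monotone : ∀ (μ μ' : P2 n) (a : Euc k),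
    -lg * ‖(∫ y, y ∂μ.toMeasure) - ∫ y, y ∂μ'.toMeasure‖ ^ 2 ≤
      (∫ x, (g x μ' a - g x μ a) ∂μ'.toMeasure) - ∫ x, (g x μ' a - g x μ a) ∂μ.toMeasure
  -- bounds on the second-order derivatives
  bound_aa : ∀ x μ a, ‖dA (dA g) x μ a‖ ≤ Lamg
  bound_mx : ∀ x μ a y, ‖gmx x μ a y‖ ≤ Lamg
  bound_xx : ∀ x μ a, ‖dX (dX g) x μ a‖ ≤ Lamg
  bound_xa : ∀ x μ a, ‖dX (dA g) x μ a‖ ≤ lbg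
  bound_ma : ∀ x μ a y, ‖gma x μ a y‖ ≤ lbg

/-- The standing assumption on the running cost `g`. -/
def CostAssumption (g : Euc n → P2 n → Euc k → ℝ) (lamg lg Lamg lbg : ℝ) : Prop :=
  ∃ gm gmx gma, CostAssumptionWith g lamg lg Lamg lbg gm gmx gma

/-- The standing assumption on the terminal function `p`, with given `L`-derivative `pm = ∂_μ p`. -/
structure TerminalAssumptionWith (p : Euc n → P2 n → Euc n) (Lp Lbar : ℝ)
    (pm : Euc n → P2 n → Euc n → Euc n →L[ℝ] Euc n) : Prop where
  pos_Lp : 0 < Lp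
  pos_Lbar : 0 < Lbar
  diff_x : ∀ x μ, DifferentiableAt ℝ (fun y => p y μ) x
  diff_m : ∀ x, HasLDeriv (fun μ => p x μ) (pm x)
  lip_x : ∃ C : ℝ, ∀ x x' μ μ', ‖fderiv ℝ (fun y => p y μ) x - fderiv ℝ (fun y => p y μ') x'‖ ≤
    C * (‖x - x'‖ + P2.W2 μ μ')
  lip_m : ∃ C : ℝ, ∀ x x' μ μ' y y', ‖pm x μ y - pm x' μ' y'‖ ≤
    C * (‖x - x'‖ + P2.W2 μ μ' + ‖y - y'‖)
  bound_x : ∀ x μ, ‖fderiv ℝ (fun y => p y μ) x‖ ≤ Lp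
  bound_m : ∀ x μ y, ‖pm x μ y‖ ≤ Lp
  growth : ∀ x μ, ‖p x μ‖ ≤ Lbar * (1 + ‖x‖ + μ.norm1)

/-- The standing assumption on the terminal function `p`. -/
def TerminalAssumption (p : Euc n → P2 n → Euc n) (Lp Lbar : ℝ) : Prop :=
  ∃ pm, TerminalAssumptionWith p Lp Lbar pm

end Assumptions

/-! ### The optimal control, the forward-backward system and decoupling fields -/

section System

variable {n k : ℕ}

/-- The function `α ↦ f(x,μ,α)·z + g(x,μ,α)` to be minimized. -/
def lagrangian (f : Euc n → P2 n → Euc k → Euc n) (g : Euc n → P2 n → Euc k → ℝ)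
    (x : Euc n) (μ : P2 n) (z : Euc n) (a : Euc k) : ℝ :=
  inner ℝ (f x μ a) z + g x μ a

/-- The optimal control `α(x,μ,z)`: a minimizer of `α ↦ f(x,μ,α)·z + g(x,μ,α)` (an arbitrary
point where there is none). -/
def optControl (f : Euc n → P2 n → Euc k → Euc n) (g : Euc n → P2 n → Euc k → ℝ)
    (x : Euc n) (μ : P2 n) (z : Euc n) : Euc k :=
  Classical.epsilon fun a => ∀ b, lagrangian f g x μ z a ≤ lagrangian f g x μ z b

/-- The first-order condition `∂_α f(x,μ,α)·z + ∂_α g(x,μ,α) = 0`. -/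
def FirstOrderCondition (f : Euc n → P2 n → Euc k → Euc n) (g : Euc n → P2 n → Euc k → ℝ)
    (x : Euc n) (μ : P2 n) (z : Euc n) (a : Euc k) : Prop :=
  ContinuousLinearMap.adjoint (dA f x μ a) z + gradient (fun b => g x μ b) a = 0

/-- The cone `c_{k₀}`. -/
def cone (k₀ : ℝ) : Set (Euc n × P2 n × Euc n) :=
  {q | ‖q.2.2‖ ≤ 1 / 2 * k₀ * (1 + ‖q.1‖ + q.2.1.norm1)}

/-- The velocity `f(x,μ,α(x,μ,z))` of the forward equation. -/
def fwdRHS (f : Euc n → P2 n → Euc k → Euc n) (g : Euc n → P2 n → Euc k → ℝ)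
    (x : Euc n) (μ : P2 n) (z : Euc n) : Euc n :=
  f x μ (optControl f g x μ z)

/-- `∂_x f(x,μ,α(x,μ,z))·z + ∂_x g(x,μ,α(x,μ,z))`, that is, the gradient in `x` of
`f(x,μ,α)·z + g(x,μ,α)` at `α = α(x,μ,z)`. -/
def bwdRHS (f : Euc n → P2 n → Euc k → Euc n) (g : Euc n → P2 n → Euc k → ℝ)
    (x : Euc n) (μ : P2 n) (z : Euc n) : Euc n :=
  ContinuousLinearMap.adjoint (dX f x μ (optControl f g x μ z)) z +
    gradient (fun y => g y μ (optControl f g x μ z)) x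

/-- `X τ x = X^{s,m}_τ(x)`, `τ ∈ [s,T]`, solves the forward equation driven by `γ` and started
from the law `m` at time `s`. -/
structure IsForwardFlow (f : Euc n → P2 n → Euc k → Euc n) (g : Euc n → P2 n → Euc k → ℝ)
    (γ : ℝ → Euc n → P2 n → Euc n) (T s : ℝ) (m : P2 n) (X : ℝ → Euc n → Euc n) : Prop where
  measurable : ∀ τ ∈ Icc s T, Measurable (X τ)
  memLp : ∀ τ ∈ Icc s T, MemLp (X τ) 2 m.toMeasure
  cont_path : ∀ x, ContinuousOn (fun τ => X τ x) (Icc s T)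
  cont_law : ContinuousOn (fun τ => m.map (X τ)) (Icc s T)
  equation : ∀ x, ∀ τ ∈ Icc s T, X τ x = x + ∫ u in s..τ,
    fwdRHS f g (X u x) (m.map (X u)) (γ u (X u x) (m.map (X u)))

/-- `γ` is a decoupling field on `[t,T]` for the system with terminal function `p`. -/
def IsDecouplingField (f : Euc n → P2 n → Euc k → Euc n) (g : Euc n → P2 n → Euc k → ℝ)
    (p : Euc n → P2 n → Euc n) (t T : ℝ) (γ : ℝ → Euc n → P2 n → Euc n) : Prop :=
  ∀ s ∈ Icc t T, ∀ m : P2 n, ∃ X : ℝ → Euc n → Euc n, IsForwardFlow f g γ T s m X ∧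
    ∀ x, γ s x m = p (X T x) (m.map (X T)) + ∫ τ in s..T,
      bwdRHS f g (X τ x) (m.map (X τ)) (γ τ (X τ x) (m.map (X τ)))

/-- Joint continuity of a field on `[t,T] × ℝⁿ × P2 n`. -/
def FieldContinuous (t T : ℝ) (γ : ℝ → Euc n → P2 n → Euc n) : Prop :=
  ContinuousOn (fun q : ℝ × Euc n × P2 n => γ q.1 q.2.1 q.2.2) (Icc t T ×ˢ univ)

/-- `|||γ|||_{1,[t,T]} = sup |γ(s,x,μ)| / (1 + |x| + ‖μ‖₁)`. -/
def growthNorm (t T : ℝ) (γ : ℝ → Euc n → P2 n → Euc n) : ENNReal :=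
  ⨆ s ∈ Icc t T, ⨆ (x : Euc n) (μ : P2 n),
    ENNReal.ofReal (‖γ s x μ‖ / (1 + ‖x‖ + μ.norm1))

/-- `X s x = X^{t,m}_s(x)` and `Z s x = Z^{t,m}_s(x)`, `s ∈ [t,T]`, solve the forward-backward
system started from the law `m` at time `t`. -/
structure IsFBODESolution (f : Euc n → P2 n → Euc k → Euc n) (g : Euc n → P2 n → Euc k → ℝ)
    (p : Euc n → P2 n → Euc n) (t T : ℝ) (m : P2 n) (X Z : ℝ → Euc n → Euc n) : Prop where
  measurable : ∀ s ∈ Icc t T, Measurable (X s)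
  memLp : ∀ s ∈ Icc t T, MemLp (X s) 2 m.toMeasure
  forward : ∀ x, ∀ s ∈ Icc t T, HasDerivWithinAt (fun u => X u x)
    (fwdRHS f g (X s x) (m.map (X s)) (Z s x)) (Icc t T) s
  initial : ∀ x, X t x = x
  backward : ∀ x, ∀ s ∈ Icc t T, HasDerivWithinAt (fun u => Z u x)
    (-bwdRHS f g (X s x) (m.map (X s)) (Z s x)) (Icc t T) s
  terminal : ∀ x, Z T x = p (X T x) (m.map (X T))

end System

end

/-! ### Couplings and the topology of `P2 d` -/

namespace P2

variable {d : ℕ}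

/-! The theorem is a short-time contraction argument for a forward-backward system whose
coefficients become globally Lipschitz after truncation.

Bounded measure derivatives give more than `W2` continuity: the coefficients are Lipschitz in the
law with respect to the mean transport cost of an arbitrary coupling (`HasRegularDeriv.norm_sub_le`,
`HasLDeriv.norm_sub_le`). All estimates are therefore made along couplings, and neither optimal
couplings nor the triangle inequality for `W2` is needed.

On the cone the Lagrangian is strongly convex in the control, because the curvature of `f`,
multiplied by the size of `z`, uses up only a twentieth of that of `g`. The minimizer is thus unique
and Lipschitz (`ControlBounds.norm_optControl_sub_le`). The growing factor `z` is always paired with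
a difference of derivatives of `f`, whose Lipschitz constant decays at the rate at which `z` may
grow. Hence velocity and backward right-hand side are Lipschitz on the cone, and after radial
truncation of `z` everywhere (`lipField_truncField`, `systemBounds`).

For the truncated system, a Picard step contracts by 1/2 in a sup norm weighted by `1 + ‖x‖ + ‖m‖₁`,
since the mean of this weight is at most twice any of its values, so that mean-field terms obey
pointwise bounds (`IsPicardStep.norm_sub_le`). This yields existence for every initial time and law,
and stability over any probability space (`IsSystemSolution.norm_sub_le`). Stability over a common
space gives uniqueness, hence the flow property, and, over a coupling, Lipschitz dependence on the
initial law.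

The field is `γ s x m = Z s m s x`. The flow property says that `Z` is `γ` along the flow, and a
short time keeps the growth of `γ` below `2 * Lbar`, so that the truncation is inactive and the
original system is solved (`IsSolutionFamily.norm_field_le`). Any competing field of that growth is
also invisible to the truncation; comparing the two flows halves the weighted distance of the
fields, so they agree (`IsSolutionFamily.field_unique`). -/

theorem ext_toMeasure {μ ν : P2 d} (h : μ.toMeasure = ν.toMeasure) : μ = ν := by
  cases μ; cases ν; simp_all

theorem integrable_norm (μ : P2 d) : Integrable (fun x : Euc d => ‖x‖) μ.toMeasure :=
  (μ.memLp.integrable one_le_two).norm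

theorem norm1_nonneg (μ : P2 d) : 0 ≤ μ.norm1 := integral_nonneg fun _ => norm_nonneg _

/-- The mean transport distance `∫ |x - y| dπ` of a joint law. -/
noncomputable def cost (π : Measure (Euc d × Euc d)) : ℝ := ∫ q, ‖q.1 - q.2‖ ∂π

theorem cost_nonneg (π : Measure (Euc d × Euc d)) : 0 ≤ cost π :=
  integral_nonneg fun _ => norm_nonneg _

namespace IsCoupling

variable {μ ν : P2 d} {π : Measure (Euc d × Euc d)}

theorem isProbabilityMeasure (h : IsCoupling μ ν π) : IsProbabilityMeasure π := by
  have h1 : IsProbabilityMeasure (π.map Prod.fst) := by rw [h.1]; infer_instance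
  exact (Measure.isProbabilityMeasure_map_iff measurable_fst.aemeasurable).1 h1

theorem memLp_fst (h : IsCoupling μ ν π) : MemLp (fun q : Euc d × Euc d => q.1) 2 π := by
  have := μ.memLp
  rw [← h.1] at this
  exact (memLp_map_measure_iff aestronglyMeasurable_id measurable_fst.aemeasurable).1 this

theorem memLp_snd (h : IsCoupling μ ν π) : MemLp (fun q : Euc d × Euc d => q.2) 2 π := by
  have := ν.memLp
  rw [← h.2] at this
  exact (memLp_map_measure_iff aestronglyMeasurable_id measurable_snd.aemeasurable).1 this

theorem memLp_sub (h : IsCoupling μ ν π) : MemLp (fun q : Euc d × Euc d => q.1 - q.2) 2 π :=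
  h.memLp_fst.sub h.memLp_snd

theorem integrable_norm_sub (h : IsCoupling μ ν π) :
    Integrable (fun q : Euc d × Euc d => ‖q.1 - q.2‖) π :=
  have := h.isProbabilityMeasure
  (h.memLp_sub.integrable one_le_two).norm

theorem integral_fst {G : Type*} [NormedAddCommGroup G] [NormedSpace ℝ G] (h : IsCoupling μ ν π)
    {u : Euc d → G} (hu : Continuous u) : ∫ x, u x ∂μ.toMeasure = ∫ q, u q.1 ∂π := by
  rw [← h.1, integral_map measurable_fst.aemeasurable hu.aestronglyMeasurable]

theorem integral_snd {G : Type*} [NormedAddCommGroup G] [NormedSpace ℝ G] (h : IsCoupling μ ν π)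
    {u : Euc d → G} (hu : Continuous u) : ∫ x, u x ∂ν.toMeasure = ∫ q, u q.2 ∂π := by
  rw [← h.2, integral_map measurable_snd.aemeasurable hu.aestronglyMeasurable]

theorem integrable_fst {G : Type*} [NormedAddCommGroup G] (h : IsCoupling μ ν π)
    {u : Euc d → G} (hu : Continuous u) (hi : Integrable u μ.toMeasure) :
    Integrable (fun q : Euc d × Euc d => u q.1) π := by
  rw [← h.1] at hi
  exact (integrable_map_measure hu.aestronglyMeasurable measurable_fst.aemeasurable).1 hi

theorem integrable_snd {G : Type*} [NormedAddCommGroup G] (h : IsCoupling μ ν π)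
    {u : Euc d → G} (hu : Continuous u) (hi : Integrable u ν.toMeasure) :
    Integrable (fun q : Euc d × Euc d => u q.2) π := by
  rw [← h.2] at hi
  exact (integrable_map_measure hu.aestronglyMeasurable measurable_snd.aemeasurable).1 hi

/-- Jensen's inequality, obtained from the nonnegativity of a variance. It is the passage from the
quadratic cost in `W2` to the mean cost used everywhere below. -/
theorem cost_le_sqrt (h : IsCoupling μ ν π) :
    cost π ≤ Real.sqrt (∫ q, ‖q.1 - q.2‖ ^ 2 ∂π) := by
  have := h.isProbabilityMeasure
  refine Real.le_sqrt_of_sq_le ?_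
  have h1 := ProbabilityTheory.variance_nonneg (fun q : Euc d × Euc d => ‖q.1 - q.2‖) π
  rw [ProbabilityTheory.variance_eq_sub h.memLp_sub.norm] at h1
  have h2 : (∫ q, ‖q.1 - q.2‖ ∂π) ^ 2 ≤ ∫ q, ‖q.1 - q.2‖ ^ 2 ∂π := by
    simpa using h1
  exact h2

theorem norm1_le (h : IsCoupling μ ν π) : μ.norm1 ≤ ν.norm1 + cost π := by
  have h1 := h.integrable_snd continuous_norm ν.integrable_norm
  unfold norm1 cost
  rw [h.integral_fst continuous_norm, h.integral_snd continuous_norm,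
    ← integral_add h1 h.integrable_norm_sub]
  refine integral_mono (h.integrable_fst continuous_norm μ.integrable_norm)
    (h1.add h.integrable_norm_sub) fun q => ?_
  have := norm_add_le q.2 (q.1 - q.2)
  simpa using this

theorem swap (h : IsCoupling μ ν π) : IsCoupling ν μ (π.map Prod.swap) := by
  constructor
  · rw [Measure.map_map measurable_fst measurable_swap]; exact h.2
  · rw [Measure.map_map measurable_snd measurable_swap]; exact h.1

theorem cost_swap (π : Measure (Euc d × Euc d)) : cost (π.map Prod.swap) = cost π := by
  unfold cost
  rw [integral_map measurable_swap.aemeasurable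
    (by fun_prop : Continuous fun q : Euc d × Euc d => ‖q.1 - q.2‖).aestronglyMeasurable]
  simp [norm_sub_rev]

theorem abs_norm1_sub_le (h : IsCoupling μ ν π) : |μ.norm1 - ν.norm1| ≤ cost π := by
  have h1 := h.norm1_le
  have h2 := h.swap.norm1_le
  rw [cost_swap] at h2
  rw [abs_le]
  constructor <;> linarith

end IsCoupling

/-! ### Couplings from random vectors on a common space -/

section JointLaw

variable {Ω : Type*} [MeasurableSpace Ω] {P : Measure Ω} {μ ν : P2 d} {X Y : Ω → Euc d}

theorem isCoupling_map (hX : Measurable X) (hY : Measurable Y) (hμ : μ.toMeasure = P.map X)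
    (hν : ν.toMeasure = P.map Y) : IsCoupling μ ν (P.map fun ω => (X ω, Y ω)) := by
  constructor
  · rw [Measure.map_map measurable_fst (hX.prodMk hY), hμ]; rfl
  · rw [Measure.map_map measurable_snd (hX.prodMk hY), hν]; rfl

theorem cost_map (hX : Measurable X) (hY : Measurable Y) :
    cost (P.map fun ω => (X ω, Y ω)) = ∫ ω, ‖X ω - Y ω‖ ∂P := by
  unfold cost
  rw [integral_map (hX.prodMk hY).aemeasurable
    (by fun_prop : Continuous fun q : Euc d × Euc d => ‖q.1 - q.2‖).aestronglyMeasurable]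

theorem norm1_eq_of_map (hX : Measurable X) (hμ : μ.toMeasure = P.map X) :
    μ.norm1 = ∫ ω, ‖X ω‖ ∂P := by
  unfold norm1
  rw [hμ, integral_map hX.aemeasurable continuous_norm.aestronglyMeasurable]

theorem W2_le_of_map (hX : Measurable X) (hY : Measurable Y) (hμ : μ.toMeasure = P.map X)
    (hν : ν.toMeasure = P.map Y) : W2 μ ν ≤ Real.sqrt (∫ ω, ‖X ω - Y ω‖ ^ 2 ∂P) := by
  refine Real.sqrt_le_sqrt (csInf_le ⟨0, ?_⟩ ⟨_, isCoupling_map hX hY hμ hν, ?_⟩)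
  · rintro c ⟨π, -, rfl⟩
    exact integral_nonneg fun _ => sq_nonneg _
  · rw [integral_map (hX.prodMk hY).aemeasurable
      (by fun_prop : Continuous fun q : Euc d × Euc d => ‖q.1 - q.2‖ ^ 2).aestronglyMeasurable]

end JointLaw

theorem toMeasure_map (m : P2 d) {X : Euc d → Euc d} (h1 : Measurable X)
    (h2 : MemLp X 2 m.toMeasure) : (m.map X).toMeasure = m.toMeasure.map X := by
  rw [map, dif_pos ⟨h1, h2⟩]

theorem isCoupling_self (μ : P2 d) :
    IsCoupling μ μ (μ.toMeasure.map fun x => (x, x)) :=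
  isCoupling_map measurable_id measurable_id (by simp) (by simp)

theorem cost_self (μ : P2 d) : cost (μ.toMeasure.map fun x : Euc d => (x, x)) = 0 := by
  rw [cost_map (X := fun x => x) (Y := fun x => x) measurable_id measurable_id]
  simp

theorem isCoupling_dirac (μ : P2 d) (a : Euc d) :
    IsCoupling μ (dirac a) (μ.toMeasure.map fun x => (x, a)) :=
  isCoupling_map measurable_id measurable_const (by simp)
    (by simp [dirac])

theorem cost_dirac (μ : P2 d) : cost (μ.toMeasure.map fun x : Euc d => (x, 0)) = μ.norm1 := by
  rw [cost_map (X := fun x => x) (Y := fun _ => 0) measurable_id measurable_const]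
  simp [norm1]

/-- An almost optimal coupling suffices, so attainment of the infimum plays no role. The product
measure shows that the infimum is over a nonempty set. -/
theorem exists_coupling_cost_lt {μ ν : P2 d} {r : ℝ} (h : W2 μ ν < r) :
    ∃ π, IsCoupling μ ν π ∧ cost π < r := by
  have hr : 0 < r := (Real.sqrt_nonneg _).trans_lt h
  unfold W2 at h
  rw [Real.sqrt_lt' hr] at h
  have hne : {c : ℝ | ∃ π : Measure (Euc d × Euc d),
      IsCoupling μ ν π ∧ c = ∫ q, ‖q.1 - q.2‖ ^ 2 ∂π}.Nonempty := by
    refine ⟨_, μ.toMeasure.prod ν.toMeasure, ⟨?_, ?_⟩, rfl⟩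
    · simp
    · simp
  obtain ⟨c, ⟨π, hπ, rfl⟩, hc⟩ := exists_lt_of_csInf_lt hne h
  exact ⟨π, hπ, hπ.cost_le_sqrt.trans_lt ((Real.sqrt_lt' hr).2 hc)⟩

/-- Only this half of the description of neighbourhoods by balls is immediate from the definition of
open sets; the other half would rest on the triangle inequality for `W2`. -/
theorem mem_nhds_of_W2_lt {μ : P2 d} {U : Set (P2 d)} (hU : U ∈ 𝓝 μ) :
    ∃ ε > 0, ∀ ν, W2 μ ν < ε → ν ∈ U := by
  obtain ⟨V, hVU, hV, hμ⟩ := mem_nhds_iff.1 hU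
  obtain ⟨ε, hε, h⟩ := hV μ hμ
  exact ⟨ε, hε, fun ν hν => hVU (h ν hν)⟩

/-- A function that is Lipschitz in the measure, uniformly in a parameter, and continuous in the
parameter is jointly continuous. -/
theorem continuous_of_coupling_lipschitz {α G : Type*} [TopologicalSpace α]
    [NormedAddCommGroup G] {Φ : α → P2 d → G} {c : ℝ}
    (hμ : ∀ a μ ν π, IsCoupling μ ν π → ‖Φ a μ - Φ a ν‖ ≤ c * cost π)
    (ha : ∀ μ, Continuous fun a => Φ a μ) : Continuous fun q : α × P2 d => Φ q.1 q.2 := by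
  wlog hc : 0 < c generalizing c
  · refine this (c := |c| + 1) (fun a μ ν π h => (hμ a μ ν π h).trans ?_) (by positivity)
    exact mul_le_mul_of_nonneg_right (by linarith [le_abs_self c]) (cost_nonneg _)
  rw [continuous_iff_continuousAt]
  rintro ⟨a₀, μ₀⟩
  rw [ContinuousAt, Metric.tendsto_nhds]
  intro ε hε
  -- Since balls are not known to be neighbourhoods, an open set around `μ₀` is exhibited directly.
  -- The room between `η` and `ε / 2` lets a small ball around each of its points stay inside.
  have hopen : IsOpen {μ : P2 d | ∃ η < ε / 2, ∀ a, ‖Φ a μ - Φ a μ₀‖ ≤ η} := by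
    rintro μ ⟨η, hη, h⟩
    refine ⟨(ε / 2 - η) / (2 * c), by apply div_pos <;> linarith, fun ν hν => ?_⟩
    obtain ⟨π, hπ, hlt⟩ := exists_coupling_cost_lt hν
    refine ⟨η + (ε / 2 - η) / 2, by linarith, fun a => ?_⟩
    have h1 := hμ a μ ν π hπ
    have h2 : c * cost π ≤ (ε / 2 - η) / 2 := by
      rw [lt_div_iff₀ (by positivity)] at hlt
      nlinarith
    calc ‖Φ a ν - Φ a μ₀‖ = ‖(Φ a μ - Φ a μ₀) - (Φ a μ - Φ a ν)‖ := by congr 1; abel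
      _ ≤ ‖Φ a μ - Φ a μ₀‖ + ‖Φ a μ - Φ a ν‖ := norm_sub_le _ _
      _ ≤ _ := by linarith [h a]
  have hmem : ∀ᶠ μ in 𝓝 μ₀, ∃ η < ε / 2, ∀ a, ‖Φ a μ - Φ a μ₀‖ ≤ η :=
    hopen.mem_nhds ⟨0, by linarith, fun a => by simp⟩
  have hcont : ∀ᶠ a in 𝓝 a₀, dist (Φ a μ₀) (Φ a₀ μ₀) < ε / 2 :=
    Metric.tendsto_nhds.1 ((ha μ₀).tendsto a₀) _ (by linarith)
  have hfst : ∀ᶠ q : α × P2 d in 𝓝 (a₀, μ₀), dist (Φ q.1 μ₀) (Φ a₀ μ₀) < ε / 2 :=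
    (continuous_fst.tendsto (a₀, μ₀)).eventually hcont
  have hsnd : ∀ᶠ q : α × P2 d in 𝓝 (a₀, μ₀), ∃ η < ε / 2, ∀ a, ‖Φ a q.2 - Φ a μ₀‖ ≤ η :=
    (continuous_snd.tendsto (a₀, μ₀)).eventually hmem
  filter_upwards [hfst, hsnd] with q h1 hq
  obtain ⟨η, hη, h2⟩ := hq
  have h3 := h2 q.1
  rw [← dist_eq_norm] at h3
  linarith [dist_triangle (Φ q.1 q.2) (Φ q.1 μ₀) (Φ a₀ μ₀)]

theorem continuous_norm1 : Continuous (norm1 : P2 d → ℝ) := by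
  have := continuous_of_coupling_lipschitz (α := Unit) (Φ := fun _ (μ : P2 d) => μ.norm1) (c := 1)
    (fun _ μ ν π h => by rw [Real.norm_eq_abs, one_mul]; exact h.abs_norm1_sub_le)
    (fun _ => continuous_const)
  exact this.comp (continuous_const (y := ()) |>.prodMk continuous_id)

theorem mean_weight (m : P2 d) : ∫ x, (1 + ‖x‖ + m.norm1) ∂m.toMeasure = 1 + 2 * m.norm1 := by
  have h : ∀ x : Euc d, 1 + ‖x‖ + m.norm1 = ‖x‖ + (1 + m.norm1) := fun x => by ring
  simp_rw [h]
  rw [integral_add m.integrable_norm (integrable_const _)]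
  simp [norm1]; ring

theorem memLp_two_of_linear_growth (m : P2 d) {X : Euc d → Euc d} (hX : Measurable X) {c : ℝ}
    (h : ∀ x, ‖X x‖ ≤ c * (1 + ‖x‖)) : MemLp X 2 m.toMeasure := by
  have h0 : MemLp (fun _ : Euc d => (1 : ℝ)) 2 m.toMeasure := memLp_const 1
  have h2 : MemLp (fun x : Euc d => ‖x‖) 2 m.toMeasure := m.memLp.norm
  have h1 : MemLp (fun x : Euc d => c * (1 + ‖x‖)) 2 m.toMeasure := (h0.add h2).const_mul c
  exact h1.mono' hX.aestronglyMeasurable (Eventually.of_forall h)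

end P2

/-! ### Lipschitz estimates from bounds on derivatives -/

section MeasureLipschitz

variable {d : ℕ} {G : Type*} [NormedAddCommGroup G] [NormedSpace ℝ G]

theorem P2.norm1_mix (θ : unitInterval) (μ ν : P2 d) :
    (P2.mix θ μ ν).norm1 = θ * μ.norm1 + (1 - θ) * ν.norm1 := by
  unfold P2.norm1 P2.mix
  rw [integral_add_measure (μ.integrable_norm.smul_measure ENNReal.ofReal_ne_top)
    (ν.integrable_norm.smul_measure ENNReal.ofReal_ne_top), integral_smul_measure,
    integral_smul_measure, ENNReal.toReal_ofReal θ.2.1, ENNReal.toReal_ofReal (sub_nonneg.2 θ.2.2)]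
  simp

theorem P2.integrable_of_quadratic_growth {G : Type*} [NormedAddCommGroup G] (μ : P2 d) {u : Euc d → G} (hu : Continuous u) {c : ℝ}
    (h : ∀ x, ‖u x‖ ≤ c * (1 + ‖x‖ ^ 2)) : Integrable u μ.toMeasure := by
  have h1 : Integrable (fun x : Euc d => c * (1 + ‖x‖ ^ 2)) μ.toMeasure :=
    ((integrable_const 1).add
      ((memLp_two_iff_integrable_sq_norm aestronglyMeasurable_id).1 μ.memLp)).const_mul c
  exact h1.mono' hu.aestronglyMeasurable (Eventually.of_forall h)

/-- A regularly differentiable function is Lipschitz along couplings with the bound of its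
derivative on the mixtures. -/
theorem HasRegularDeriv.norm_sub_le {h : P2 d → G} {D : P2 d → Euc d → Euc d →L[ℝ] G}
    (hD : HasRegularDeriv h D) {μ ν : P2 d} {π : Measure (Euc d × Euc d)}
    (hπ : P2.IsCoupling μ ν π) {c : ℝ} (hc : ∀ θ y, ‖D (P2.mix θ μ ν) y‖ ≤ c) :
    ‖h μ - h ν‖ ≤ c * P2.cost π := by
  obtain ⟨δ, hδ, hder, -, -⟩ := hD
  have hcont : ∀ ρ, Continuous (δ ρ) := fun ρ =>
    hδ.continuous.comp (continuous_const.prodMk continuous_id)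
  obtain ⟨C, -, hC⟩ := hδ.growth
  rw [hδ.formula]
  have hθ : ∀ θ : unitInterval, ‖(∫ x, δ (P2.mix θ μ ν) x ∂μ.toMeasure)
      - ∫ x, δ (P2.mix θ μ ν) x ∂ν.toMeasure‖ ≤ c * P2.cost π := fun θ => by
    have hint : ∀ ρ : P2 d, Integrable (δ (P2.mix θ μ ν)) ρ.toMeasure := fun ρ =>
      ρ.integrable_of_quadratic_growth (hcont _) (hC _)
    -- Both integrals are lifted to the coupling, where they become one integral of a difference of
    -- values of `δ`; the mean value inequality bounds the integrand.
    rw [hπ.integral_fst (hcont _), hπ.integral_snd (hcont _),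
      ← integral_sub (hπ.integrable_fst (hcont _) (hint μ))
        (hπ.integrable_snd (hcont _) (hint ν))]
    unfold P2.cost
    rw [← integral_const_mul]
    refine norm_integral_le_of_norm_le (hπ.integrable_norm_sub.const_mul c)
      (Eventually.of_forall fun q => ?_)
    exact convex_univ.norm_image_sub_le_of_norm_hasFDerivWithin_le
      (fun x _ => (hder _ x).hasFDerivWithinAt) (fun x _ => hc θ x) (mem_univ _) (mem_univ _)
  simpa using norm_integral_le_of_norm_le_const (Eventually.of_forall hθ)
    (μ := (volume : Measure unitInterval))

/-- An `L`-differentiable function with bounded derivative is Lipschitz along couplings. -/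
theorem HasLDeriv.norm_sub_le {h : P2 d → G} {D : P2 d → Euc d → Euc d →L[ℝ] G}
    (hD : HasLDeriv h D) {c : ℝ} (hc : ∀ μ y, ‖D μ y‖ ≤ c) {μ ν : P2 d}
    {π : Measure (Euc d × Euc d)} (hπ : P2.IsCoupling μ ν π) :
    ‖h μ - h ν‖ ≤ c * P2.cost π := by
  have := hπ.isProbabilityMeasure
  -- Any coupling is the image of Lebesgue measure on the unit interval, so its coordinates become
  -- two random vectors on the space that carries the lift.
  obtain ⟨τ, hτ, hmap⟩ := π.exists_measurable_map_eq
  have h1 : MemLp (fun t => (τ t).1) 2 (volume : Measure unitInterval) := by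
    have := hπ.memLp_fst
    rw [← hmap] at this
    exact (memLp_map_measure_iff measurable_fst.aestronglyMeasurable hτ.aemeasurable).1 this
  have h2 : MemLp (fun t => (τ t).2) 2 (volume : Measure unitInterval) := by
    have := hπ.memLp_snd
    rw [← hmap] at this
    exact (memLp_map_measure_iff measurable_snd.aestronglyMeasurable hτ.aemeasurable).1 this
  set X := h1.toLp
  set Y := h2.toLp
  have hX : P2.law X = μ := by
    refine P2.ext_toMeasure ?_
    change (volume : Measure unitInterval).map X = _
    rw [Measure.map_congr h1.coeFn_toLp, ← hπ.1, ← hmap, Measure.map_map measurable_fst hτ]; rfl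
  have hY : P2.law Y = ν := by
    refine P2.ext_toMeasure ?_
    change (volume : Measure unitInterval).map Y = _
    rw [Measure.map_congr h2.coeFn_toLp, ← hπ.2, ← hmap, Measure.map_map measurable_snd hτ]; rfl
  have hcost : ∫ ω, ‖(X - Y : Lp (Euc d) 2 (volume : Measure unitInterval)) ω‖ = P2.cost π := by
    unfold P2.cost
    rw [← hmap, integral_map hτ.aemeasurable
      (by fun_prop : Continuous fun q : Euc d × Euc d => ‖q.1 - q.2‖).aestronglyMeasurable]
    refine integral_congr_ae ?_
    filter_upwards [Lp.coeFn_sub X Y, h1.coeFn_toLp, h2.coeFn_toLp] with ω e1 e2 e3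
    rw [e1, Pi.sub_apply, e2, e3]
  have hLp : ∀ Z : Lp (Euc d) 2 (volume : Measure unitInterval), Integrable (fun ω => ‖Z ω‖) :=
    fun Z => ((Lp.memLp Z).integrable one_le_two).norm
  choose L hL hLY using hD
  let line : ℝ → Lp (Euc d) 2 (volume : Measure unitInterval) := fun t => Y + t • (X - Y)
  have hline : ∀ t, HasDerivAt line (X - Y) t := fun t => by
    have := ((hasDerivAt_id t).smul_const (X - Y)).const_add Y
    rwa [one_smul] at this
  have hder : ∀ t ∈ Icc (0 : ℝ) 1, HasDerivWithinAt (fun t => h (P2.law (line t)))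
      (L (line t) (X - Y)) (Icc 0 1) t := fun t _ =>
    ((hL (line t)).comp_hasDerivAt t (hline t)).hasDerivWithinAt
  -- The derivative of the lift is an expectation against a bounded kernel, hence controlled by the
  -- mean of `‖X - Y‖` and not merely by its `L²` norm.
  have hbound : ∀ t ∈ Ico (0 : ℝ) 1, ‖L (line t) (X - Y)‖ ≤ c * P2.cost π := fun t _ => by
    rw [hLY, ← hcost, ← integral_const_mul]
    refine norm_integral_le_of_norm_le ((hLp _).const_mul c) (Eventually.of_forall fun ω => ?_)
    exact (ContinuousLinearMap.le_opNorm _ _).trans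
      (mul_le_mul_of_nonneg_right (hc _ _) (norm_nonneg _))
  have := norm_image_sub_le_of_norm_deriv_le_segment_01' hder hbound
  simpa [line, hX, hY] using this

end MeasureLipschitz

/-! ### Exchanging the order of a mixed derivative -/

section MixedDerivative

variable {E₁ E₂ G : Type*} [NormedAddCommGroup E₁] [NormedSpace ℝ E₁] [NormedAddCommGroup E₂]
  [NormedSpace ℝ E₂] [NormedAddCommGroup G] [NormedSpace ℝ G]

/-- If the derivative in the first variable is Lipschitz in the second variable, then the derivative
in the second variable is Lipschitz in the first one, with the same constant. -/
theorem norm_fderiv_sub_le_of_mixed {h : E₁ → E₂ → G} {x₀ x₁ : E₁} {c : ℝ} (hc₀ : 0 ≤ c)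
    (h₁ : ∀ x a, DifferentiableAt ℝ (fun y => h y a) x)
    (h₂ : ∀ x a, DifferentiableAt ℝ (fun b => h x b) a)
    (hc : ∀ x ∈ segment ℝ x₀ x₁, ∀ a b,
      ‖fderiv ℝ (fun y => h y a) x - fderiv ℝ (fun y => h y b) x‖ ≤ c * ‖a - b‖) (a : E₂) :
    ‖fderiv ℝ (fun b => h x₀ b) a - fderiv ℝ (fun b => h x₁ b) a‖ ≤ c * ‖x₀ - x₁‖ := by
  -- The double difference does not distinguish the two variables: it is estimated by the derivative
  -- in the first one and then read as a Lipschitz bound in the second.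
  have hdd : ∀ b, ‖(h x₀ b - h x₁ b) - (h x₀ a - h x₁ a)‖ ≤ c * ‖x₀ - x₁‖ * ‖b - a‖ := by
    intro b
    have := (convex_segment x₀ x₁).norm_image_sub_le_of_norm_hasFDerivWithin_le
      (f := fun y => h y b - h y a)
      (fun x _ => ((h₁ x b).hasFDerivAt.sub (h₁ x a).hasFDerivAt).hasFDerivWithinAt)
      (fun x hx => hc x hx b a) (right_mem_segment ℝ x₀ x₁) (left_mem_segment ℝ x₀ x₁)
    calc _ = ‖(h x₀ b - h x₀ a) - (h x₁ b - h x₁ a)‖ := by congr 1; abel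
      _ ≤ _ := this
      _ = _ := by ring
  exact ((h₂ x₀ a).hasFDerivAt.sub (h₂ x₁ a).hasFDerivAt).le_of_lip'
    (mul_nonneg hc₀ (norm_nonneg _)) (Eventually.of_forall hdd)

end MixedDerivative

/-- Here `D` stands for the difference of two values, `W` for the weight at one of the points and
`δ` for their distance. Over a distance of at most `W / 2` the weight stays above `W / 2` and the
decay can be used; over a larger one `W < 2 * δ`, and the uniform bound `2 * Λ` is enough. -/
theorem mul_weight_le_of_local {δ W l Λ D : ℝ} (hW : 0 < W) (hδ : 0 ≤ δ) (hl : 0 ≤ l)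
    (hΛ : 0 ≤ Λ) (h₁ : δ ≤ W / 2 → D ≤ l / (W / 2) * δ) (h₂ : D ≤ 2 * Λ) :
    D * W ≤ (2 * l + 4 * Λ) * δ := by
  rcases le_or_gt δ (W / 2) with h | h
  · have := mul_le_mul_of_nonneg_right (h₁ h) hW.le
    have e : l / (W / 2) * δ * W = 2 * l * δ := by field_simp
    nlinarith [mul_nonneg hΛ hδ]
  · nlinarith [mul_nonneg hl hδ, mul_nonneg hΛ hδ, mul_le_mul_of_nonneg_right h₂ hW.le]

/-! ### Joint Lipschitz estimates for the coefficients -/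

section JointLipschitz

variable {n k : ℕ} {G : Type*} [NormedAddCommGroup G]

/-- Joint Lipschitz continuity, along couplings in the measure argument. -/
def CouplingLip (c : ℝ) (T : Euc n → P2 n → Euc k → G) : Prop :=
  ∀ x x' μ μ' a a' π, P2.IsCoupling μ μ' π →
    ‖T x μ a - T x' μ' a'‖ ≤ c * (‖x - x'‖ + P2.cost π + ‖a - a'‖)

/-- Joint Lipschitz continuity with a constant that decays at infinity, along couplings in the
measure argument. -/
def WeightedCouplingLip (c : ℝ) (T : Euc n → P2 n → Euc k → G) : Prop :=
  ∀ x x' μ μ' a a' π, P2.IsCoupling μ μ' π →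
    ‖T x μ a - T x' μ' a'‖ * (1 + ‖x'‖ + μ'.norm1) ≤ c * (‖x - x'‖ + P2.cost π + ‖a - a'‖)

theorem norm_sub_le_three_steps (T : Euc n → P2 n → Euc k → G) (x x' : Euc n) (μ μ' : P2 n)
    (a a' : Euc k) : ‖T x μ a - T x' μ' a'‖ ≤ ‖T x μ a - T x' μ a‖ + ‖T x' μ a - T x' μ' a‖ +
      ‖T x' μ' a - T x' μ' a'‖ := by
  refine le_trans (le_of_eq ?_) (norm_add₃_le ..)
  congr 1; abel

theorem CouplingLip.of_steps {c : ℝ} {T : Euc n → P2 n → Euc k → G}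
    (hx : ∀ x x' μ a, ‖T x μ a - T x' μ a‖ ≤ c * ‖x - x'‖)
    (hm : ∀ x μ μ' a π, P2.IsCoupling μ μ' π → ‖T x μ a - T x μ' a‖ ≤ c * P2.cost π)
    (ha : ∀ x μ a a', ‖T x μ a - T x μ a'‖ ≤ c * ‖a - a'‖) : CouplingLip c T := by
  intro x x' μ μ' a a' π hπ
  have h0 := norm_sub_le_three_steps T x x' μ μ' a a'
  linarith [hx x x' μ a, hm x' μ μ' a π hπ, ha x' μ' a a']

theorem CouplingLip.mono {c c' : ℝ} {T : Euc n → P2 n → Euc k → G} (h : CouplingLip c T)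
    (hc : c ≤ c') : CouplingLip c' T := fun x x' μ μ' a a' π hπ =>
  (h x x' μ μ' a a' π hπ).trans (mul_le_mul_of_nonneg_right hc
    (by have := P2.cost_nonneg π; positivity))

theorem WeightedCouplingLip.mono {c c' : ℝ} {T : Euc n → P2 n → Euc k → G}
    (h : WeightedCouplingLip c T) (hc : c ≤ c') : WeightedCouplingLip c' T :=
  fun x x' μ μ' a a' π hπ => (h x x' μ μ' a a' π hπ).trans (mul_le_mul_of_nonneg_right hc
    (by have := P2.cost_nonneg π; positivity))

theorem WeightedCouplingLip.of_steps {l Λ : ℝ} (hl : 0 ≤ l) (hΛ : 0 ≤ Λ)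
    {T : Euc n → P2 n → Euc k → G}
    (hx : ∀ x x' μ a ρ, 0 < ρ → (∀ y ∈ segment ℝ x x', ρ ≤ 1 + ‖y‖ + μ.norm1) →
      ‖T x μ a - T x' μ a‖ ≤ l / ρ * ‖x - x'‖)
    (hm : ∀ x μ μ' a π ρ, 0 < ρ → P2.IsCoupling μ μ' π →
      (∀ θ, ρ ≤ 1 + ‖x‖ + (P2.mix θ μ μ').norm1) →
      ‖T x μ a - T x μ' a‖ ≤ l / ρ * P2.cost π)
    (ha : ∀ x μ a a' ρ, 0 < ρ → ρ ≤ 1 + ‖x‖ + μ.norm1 →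
      ‖T x μ a - T x μ a'‖ ≤ l / ρ * ‖a - a'‖)
    (hb : ∀ x μ a, ‖T x μ a‖ ≤ Λ) : WeightedCouplingLip (2 * l + 4 * Λ) T := by
  intro x x' μ μ' a a' π hπ
  have hc := P2.cost_nonneg π
  have hμ := μ'.norm1_nonneg
  have hW : 0 < 1 + ‖x'‖ + μ'.norm1 := by positivity
  have hcx := norm_nonneg (x - x')
  have hca := norm_nonneg (a - a')
  have hn := (abs_le.1 hπ.abs_norm1_sub_le).1
  refine mul_weight_le_of_local hW (by positivity) hl hΛ (fun hδ => ?_) ?_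
  · have h1 := hx x x' μ a ((1 + ‖x'‖ + μ'.norm1) / 2) (by positivity) fun y hy => by
      have h2 : ‖x' - y‖ ≤ ‖x - x'‖ := by
        have := norm_sub_le_of_mem_segment (segment_symm ℝ x x' ▸ hy)
        rw [norm_sub_rev x' y, norm_sub_rev x x'] at *
        linarith
      have h3 := norm_sub_norm_le x' y
      linarith
    -- First moments are affine along mixtures, so they fall below that of `μ'` by at most the
    -- transport cost.
    have h2 := hm x' μ μ' a π ((1 + ‖x'‖ + μ'.norm1) / 2) (by positivity) hπ fun θ => by
      rw [P2.norm1_mix]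
      nlinarith [θ.2.1, θ.2.2]
    have h3 := ha x' μ' a a' ((1 + ‖x'‖ + μ'.norm1) / 2) (by positivity) (by linarith)
    have h0 := norm_sub_le_three_steps T x x' μ μ' a a'
    linarith
  · linarith [norm_sub_le (T x μ a) (T x' μ' a'), hb x μ a, hb x' μ' a']

variable [NormedSpace ℝ G]

theorem norm_dX_step {T : Euc n → P2 n → Euc k → G} (hT : DiffX T) {x x' : Euc n} {μ : P2 n}
    {a : Euc k} {c : ℝ} (hc : ∀ y ∈ segment ℝ x x', ‖dX T y μ a‖ ≤ c) :
    ‖T x μ a - T x' μ a‖ ≤ c * ‖x - x'‖ :=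
  (convex_segment x x').norm_image_sub_le_of_norm_fderiv_le (fun y _ => hT y μ a) hc
    (right_mem_segment ℝ x x') (left_mem_segment ℝ x x')

theorem norm_dA_step {T : Euc n → P2 n → Euc k → G} (hT : DiffA T) {x : Euc n} {μ : P2 n}
    {a a' : Euc k} {c : ℝ} (hc : ∀ b, ‖dA T x μ b‖ ≤ c) :
    ‖T x μ a - T x μ a'‖ ≤ c * ‖a - a'‖ :=
  convex_univ.norm_image_sub_le_of_norm_fderiv_le (fun b _ => hT x μ b) (fun b _ => hc b)
    (mem_univ _) (mem_univ _)

theorem le_div_of_mul_weight_le {D w l ρ : ℝ} (hρ : 0 < ρ) (hD : 0 ≤ D) (hw : ρ ≤ w)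
    (h : D * w ≤ l) : D ≤ l / ρ := by
  rw [le_div_iff₀ hρ]
  exact (mul_le_mul_of_nonneg_left hw hD).trans h

end JointLipschitz

/-- The Lipschitz and boundedness properties of the coefficients that enter the local existence
theory. -/
structure CoefficientBounds {n k : ℕ} (f : Euc n → P2 n → Euc k → Euc n)
    (g : Euc n → P2 n → Euc k → ℝ) (c : ℝ) : Prop where
  nonneg : 0 ≤ c
  f_lip : CouplingLip c f
  fX_lip : WeightedCouplingLip c (dX f)
  fA_lip : WeightedCouplingLip c (dA f)
  gX_lip : CouplingLip c (dX g)
  gA_lip : CouplingLip c (dA g)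
  fX_le : ∀ x μ a, ‖dX f x μ a‖ ≤ c
  fA_le : ∀ x μ a, ‖dA f x μ a‖ ≤ c

/-- Each increment is a mean value inequality for the corresponding second derivative. The
exceptions are the state increment of `dA f` and the control increment of `dX g`: the mixed
derivatives are given in the other order only, and `norm_fderiv_sub_le_of_mixed` transfers the
bound. -/
theorem coefficientBounds {n k : ℕ} {f : Euc n → P2 n → Euc k → Euc n}
    {g : Euc n → P2 n → Euc k → ℝ} {lamf Lam1 Lam2 Lam3 lbf Lipf lamg lg Lamg lbg : ℝ}
    (hf : DriftAssumption f lamf Lam1 Lam2 Lam3 lbf Lipf) (hg : CostAssumption g lamg lg Lamg lbg) :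
    CoefficientBounds f g (2 * lbf + 4 * max Lam1 (max Lam2 Lam3) + Lamg + lbg) := by
  obtain ⟨fm, fmx, fma, hf⟩ := hf
  obtain ⟨gm, gmx, gma, hg⟩ := hg
  set Λ := max Lam1 (max Lam2 Lam3)
  have h1 : Lam1 ≤ Λ := le_max_left _ _
  have h2 : Lam2 ≤ Λ := (le_max_left _ _).trans (le_max_right _ _)
  have h3 : Lam3 ≤ Λ := (le_max_right _ _).trans (le_max_right _ _)
  have hΛ : 0 ≤ Λ := hf.pos_Lam1.le.trans h1
  have := hf.pos_lbf
  have := hg.pos_Lamg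
  have := hg.pos_lbg
  have hax : ∀ x μ a a' ρ, 0 < ρ → ρ ≤ 1 + ‖x‖ + μ.norm1 →
      ‖dX f x μ a - dX f x μ a'‖ ≤ lbf / ρ * ‖a - a'‖ := fun x μ a a' ρ hρ hw =>
    norm_dA_step hf.diff_ax fun b =>
      le_div_of_mul_weight_le hρ (norm_nonneg _) (by linarith) (hf.bound_ax x μ b)
  have hxa : ∀ x x' μ a, ‖dA g x μ a - dA g x' μ a‖ ≤ lbg * ‖x - x'‖ := fun x x' μ a =>
    norm_dX_step hg.diff_xa fun y _ => hg.bound_xa y μ a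
  refine ⟨by positivity, ?_, ?_, ?_, ?_, ?_, fun x μ a => ?_, fun x μ a => ?_⟩
  · refine CouplingLip.mono (c := Λ) (CouplingLip.of_steps (fun x x' μ a => ?_)
      (fun x μ μ' a π hπ => ?_) fun x μ a a' => ?_) (by linarith)
    · exact norm_dX_step hf.diff_x fun y _ => (hf.bound_x y μ a).trans h3
    · exact (hf.diff_m x a).norm_sub_le hπ fun θ y => (hf.bound_m x _ a y).trans h2
    · exact norm_dA_step hf.diff_a fun b => (hf.bound_a x μ b).trans h1
  · refine WeightedCouplingLip.mono (WeightedCouplingLip.of_steps (l := lbf) (Λ := Λ)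
      (by positivity) hΛ (fun x x' μ a ρ hρ hw => ?_) (fun x μ μ' a π ρ hρ hπ hw => ?_) hax
      fun x μ a => (hf.bound_x x μ a).trans h3) (by linarith)
    · exact norm_dX_step hf.diff_xx fun y hy =>
        le_div_of_mul_weight_le hρ (norm_nonneg _) (hw y hy) (hf.bound_xx y μ a)
    · exact (hf.diff_mx x a).norm_sub_le hπ fun θ y =>
        le_div_of_mul_weight_le hρ (norm_nonneg _) (hw θ) (hf.bound_mx x _ a y)
  · refine WeightedCouplingLip.mono (WeightedCouplingLip.of_steps (l := lbf) (Λ := Λ)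
      (by positivity) hΛ (fun x x' μ a ρ hρ hw => ?_) (fun x μ μ' a π ρ hρ hπ hw => ?_)
      (fun x μ a a' ρ hρ hw => ?_) fun x μ a => (hf.bound_a x μ a).trans h1) (by linarith)
    · exact norm_fderiv_sub_le_of_mixed (h := fun y b => f y μ b) (by positivity)
        (fun y b => hf.diff_x y μ b) (fun y b => hf.diff_a y μ b)
        (fun y hy b b' => hax y μ b b' ρ hρ (hw y hy)) a
    · exact (hf.diff_ma x a).norm_sub_le hπ fun θ y =>
        le_div_of_mul_weight_le hρ (norm_nonneg _) (hw θ) (hf.bound_ma x _ a y)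
    · exact norm_dA_step hf.diff_aa fun b =>
        le_div_of_mul_weight_le hρ (norm_nonneg _) hw (hf.bound_aa x μ b)
  · refine CouplingLip.mono (c := Lamg + lbg) (CouplingLip.of_steps (fun x x' μ a => ?_)
      (fun x μ μ' a π hπ => ?_) fun x μ a a' => ?_) (by linarith)
    · exact norm_dX_step hg.diff_xx fun y _ => (hg.bound_xx y μ a).trans (by linarith)
    · exact (hg.diff_mx x a).norm_sub_le hπ fun θ y => (hg.bound_mx x _ a y).trans (by linarith)
    · refine (norm_fderiv_sub_le_of_mixed (h := fun b y => g y μ b) hg.pos_lbg.le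
        (fun b y => hg.diff_a y μ b) (fun b y => hg.diff_x y μ b)
        (fun b _ y y' => hxa y y' μ b) x).trans ?_
      exact mul_le_mul_of_nonneg_right (by linarith) (norm_nonneg _)
  · refine CouplingLip.mono (c := Lamg + lbg) (CouplingLip.of_steps (fun x x' μ a => ?_)
      (fun x μ μ' a π hπ => ?_) fun x μ a a' => ?_) (by linarith)
    · exact (hxa x x' μ a).trans (mul_le_mul_of_nonneg_right (by linarith) (norm_nonneg _))
    · exact (hg.diff_ma x a).norm_sub_le hπ fun θ y => (hg.bound_ma x _ a y).trans (by linarith)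
    · exact norm_dA_step hg.diff_aa fun b => (hg.bound_aa x μ b).trans (by linarith)
  · exact (hf.bound_x x μ a).trans (by linarith)
  · exact (hf.bound_a x μ a).trans (by linarith)

/-! ### Strongly convex functions -/

section StronglyConvex

variable {E : Type*} [NormedAddCommGroup E] [NormedSpace ℝ E] {h : E → ℝ} {h' : E → E →L[ℝ] ℝ}
  {c : ℝ}

/-- On the segment from `a` to `b`, `h` minus its tangent minus the quadratic term is monotone,
because strong monotonicity makes its derivative nonnegative. -/
theorem quadratic_lower_bound_of_strongly_monotone (hd : ∀ a, HasFDerivAt h (h' a) a)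
    (hm : ∀ a b, c * ‖a - b‖ ^ 2 ≤ h' a (a - b) - h' b (a - b)) (a b : E) :
    h a + h' a (b - a) + c / 2 * ‖b - a‖ ^ 2 ≤ h b := by
  set v := b - a
  have hder : ∀ t : ℝ, HasDerivAt (fun t => h (a + t • v) - t * h' a v - c / 2 * ‖v‖ ^ 2 * t ^ 2)
      (h' (a + t • v) v - h' a v - c / 2 * ‖v‖ ^ 2 * (2 * t)) t := fun t => by
    have h1 : HasDerivAt (fun t : ℝ => a + t • v) v t := by
      have := ((hasDerivAt_id t).smul_const v).const_add a
      rwa [one_smul] at this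
    have h2 := (hd (a + t • v)).comp_hasDerivAt t h1
    have h3 := (hasDerivAt_id t).mul_const (h' a v)
    have h4 := (hasDerivAt_pow 2 t).const_mul (c / 2 * ‖v‖ ^ 2)
    refine HasDerivAt.congr_deriv ((h2.sub h3).sub h4) ?_
    simp
  have hmono : MonotoneOn (fun t => h (a + t • v) - t * h' a v - c / 2 * ‖v‖ ^ 2 * t ^ 2)
      (Icc (0 : ℝ) 1) := by
    refine monotoneOn_of_deriv_nonneg (convex_Icc 0 1)
      (fun t _ => (hder t).continuousAt.continuousWithinAt)
      (fun t _ => (hder t).differentiableAt.differentiableWithinAt) fun t ht => ?_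
    rw [interior_Icc] at ht
    rw [(hder t).deriv]
    have := hm (a + t • v) a
    rw [add_sub_cancel_left, map_smul, map_smul, norm_smul, Real.norm_of_nonneg ht.1.le,
      smul_eq_mul, smul_eq_mul] at this
    have h5 : 0 ≤ t * (h' (a + t • v) v - h' a v - c / 2 * ‖v‖ ^ 2 * (2 * t)) := by
      linarith
    exact nonneg_of_mul_nonneg_right h5 ht.1
  have := hmono (left_mem_Icc.2 zero_le_one) (right_mem_Icc.2 zero_le_one) zero_le_one
  have e : a + v = b := add_sub_cancel a b
  simp only [zero_smul, add_zero, zero_mul, sub_zero, one_smul, one_mul, one_pow, mul_one, e,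
    ne_eq, OfNat.ofNat_ne_zero, not_false_eq_true, zero_pow, mul_zero] at this
  linarith

/-- The quadratic lower bound at the origin makes `h` coercive, and bounded closed sets are compact
in finite dimension. -/
theorem exists_minimizer_of_strongly_monotone [FiniteDimensional ℝ E] (hc : 0 < c)
    (hd : ∀ a, HasFDerivAt h (h' a) a)
    (hm : ∀ a b, c * ‖a - b‖ ^ 2 ≤ h' a (a - b) - h' b (a - b)) : ∃ a, ∀ b, h a ≤ h b := by
  have := FiniteDimensional.proper ℝ E
  refine Continuous.exists_forall_le
    (continuous_iff_continuousAt.2 fun a => (hd a).continuousAt) ?_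
  have h1 : Tendsto (fun t : ℝ => t * (c / 2 * t + -‖h' 0‖) + h 0) atTop atTop :=
    tendsto_atTop_add_const_right _ _ (tendsto_id.atTop_mul_atTop₀
      (tendsto_atTop_add_const_right _ _ (tendsto_id.const_mul_atTop (by positivity))))
  refine tendsto_atTop_mono (fun b => ?_) (h1.comp (tendsto_norm_cocompact_atTop (E := E)))
  have h2 := quadratic_lower_bound_of_strongly_monotone hd hm 0 b
  have h3 := (abs_le.1 ((h' 0).le_opNorm b)).1
  simp only [sub_zero, Function.comp_apply] at *
  nlinarith

end StronglyConvex

/-! ### The optimal control -/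

section OptimalControl

variable {n k : ℕ} {f : Euc n → P2 n → Euc k → Euc n} {g : Euc n → P2 n → Euc k → ℝ}

/-- The derivative of the Lagrangian in the control. -/
noncomputable def lagrangianDeriv (f : Euc n → P2 n → Euc k → Euc n) (g : Euc n → P2 n → Euc k → ℝ)
    (x : Euc n) (μ : P2 n) (z : Euc n) (a : Euc k) : Euc k →L[ℝ] ℝ :=
  (innerSL ℝ z).comp (dA f x μ a) + dA g x μ a

theorem hasFDerivAt_lagrangian (hf : DiffA f) (hg : DiffA g) (x : Euc n) (μ : P2 n) (z : Euc n)
    (a : Euc k) : HasFDerivAt (lagrangian f g x μ z) (lagrangianDeriv f g x μ z a) a := by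
  have h1 := (innerSL ℝ z).hasFDerivAt.comp a (hf x μ a).hasFDerivAt
  have h2 := h1.add (hg x μ a).hasFDerivAt
  refine h2.congr_of_eventuallyEq (Eventually.of_forall fun b => ?_)
  simp [lagrangian, real_inner_comm]

/-- The hypotheses under which the optimal control is well behaved on the cone. -/
structure ControlBounds (f : Euc n → P2 n → Euc k → Euc n) (g : Euc n → P2 n → Euc k → ℝ)
    (c l κ : ℝ) : Prop extends CoefficientBounds f g c where
  l_pos : 0 < l
  κ_nonneg : 0 ≤ κ
  diff_f : DiffA f
  diff_g : DiffA g
  diff_fA : DiffA (dA f)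
  diff_gA : DiffA (dA g)
  convex : ∀ x μ z a η, ‖z‖ ≤ κ * (1 + ‖x‖ + μ.norm1) →
    l * ‖η‖ ^ 2 ≤ inner ℝ z (dA (dA f) x μ a η η) + dA (dA g) x μ a η η

namespace ControlBounds

variable {c l κ : ℝ} (H : ControlBounds f g c l κ)
include H

theorem strongly_monotone {x : Euc n} {μ : P2 n} {z : Euc n}
    (hz : ‖z‖ ≤ κ * (1 + ‖x‖ + μ.norm1)) (a b : Euc k) :
    l * ‖a - b‖ ^ 2 ≤
      lagrangianDeriv f g x μ z a (a - b) - lagrangianDeriv f g x μ z b (a - b) := by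
  set v := a - b
  have hder : ∀ t : ℝ, HasDerivAt (fun t : ℝ => lagrangianDeriv f g x μ z (b + t • v) v)
      (inner ℝ z (dA (dA f) x μ (b + t • v) v v) + dA (dA g) x μ (b + t • v) v v) t := fun t => by
    have h1 : HasDerivAt (fun t : ℝ => b + t • v) v t := by
      have := ((hasDerivAt_id t).smul_const v).const_add b
      rwa [one_smul] at this
    have h2 := (H.diff_fA x μ (b + t • v)).hasFDerivAt.comp_hasDerivAt t h1
    have h3 := (H.diff_gA x μ (b + t • v)).hasFDerivAt.comp_hasDerivAt t h1
    have h4 := (h2.clm_apply (hasDerivAt_const t v))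
    have h5 := (h3.clm_apply (hasDerivAt_const t v))
    have h6 := (innerSL ℝ z).hasFDerivAt.comp_hasDerivAt t h4
    have h7 := h6.add h5
    simp only [map_zero, add_zero, Function.comp_def, innerSL_apply_apply] at h7
    exact h7
  have := mul_sub_le_image_sub_of_le_deriv (fun t => (hder t).differentiableAt)
    (C := l * ‖v‖ ^ 2) (fun t => by rw [(hder t).deriv]; exact H.convex x μ z _ v hz)
    (x := 0) (y := 1) zero_le_one
  simpa [v] using this

theorem optControl_le {x : Euc n} {μ : P2 n} {z : Euc n}
    (hz : ‖z‖ ≤ κ * (1 + ‖x‖ + μ.norm1)) (b : Euc k) :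
    lagrangian f g x μ z (optControl f g x μ z) ≤ lagrangian f g x μ z b :=
  Classical.epsilon_spec (exists_minimizer_of_strongly_monotone H.l_pos
    (hasFDerivAt_lagrangian H.diff_f H.diff_g x μ z) (H.strongly_monotone hz)) b

theorem lagrangianDeriv_optControl {x : Euc n} {μ : P2 n} {z : Euc n}
    (hz : ‖z‖ ≤ κ * (1 + ‖x‖ + μ.norm1)) :
    lagrangianDeriv f g x μ z (optControl f g x μ z) = 0 := by
  have : IsLocalMin (lagrangian f g x μ z) (optControl f g x μ z) :=
    Eventually.of_forall (H.optControl_le hz)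
  exact this.hasFDerivAt_eq_zero (hasFDerivAt_lagrangian H.diff_f H.diff_g x μ z _)

theorem optControl_lt {x : Euc n} {μ : P2 n} {z : Euc n}
    (hz : ‖z‖ ≤ κ * (1 + ‖x‖ + μ.norm1)) {b : Euc k} (hb : b ≠ optControl f g x μ z) :
    lagrangian f g x μ z (optControl f g x μ z) < lagrangian f g x μ z b := by
  have h1 := quadratic_lower_bound_of_strongly_monotone
    (hasFDerivAt_lagrangian H.diff_f H.diff_g x μ z) (H.strongly_monotone hz)
    (optControl f g x μ z) b
  rw [H.lagrangianDeriv_optControl hz] at h1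
  have h2 : 0 < ‖b - optControl f g x μ z‖ := norm_pos_iff.2 (sub_ne_zero.2 hb)
  have h3 : 0 < l / 2 * ‖b - optControl f g x μ z‖ ^ 2 := by
    have := H.l_pos
    positivity
  simp only [_root_.zero_apply] at h1
  linarith

theorem firstOrderCondition {x : Euc n} {μ : P2 n} {z : Euc n}
    (hz : ‖z‖ ≤ κ * (1 + ‖x‖ + μ.norm1)) :
    FirstOrderCondition f g x μ z (optControl f g x μ z) := by
  have h := H.lagrangianDeriv_optControl hz
  refine ext_inner_right ℝ fun v => ?_
  have h1 := DFunLike.congr_fun h v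
  simp only [lagrangianDeriv, _root_.add_apply, ContinuousLinearMap.comp_apply,
    innerSL_apply_apply, _root_.zero_apply] at h1
  rw [inner_add_left, ContinuousLinearMap.adjoint_inner_left, gradient,
    InnerProductSpace.toDual_symm_apply, inner_zero_left]
  exact h1

/-- Stability of critical points: both first-order conditions vanish, so strong monotonicity between
the two minimizers is bounded by the change of the derivative in its parameters at the fixed control
`a'`. In that change the large factor `z'` meets only a difference of `dA f`, where the weighted
Lipschitz bound absorbs it. -/
theorem norm_optControl_sub_le {x x' : Euc n} {μ μ' : P2 n} {z z' : Euc n}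
    {π : Measure (Euc n × Euc n)} (hπ : P2.IsCoupling μ μ' π)
    (hz : ‖z‖ ≤ κ * (1 + ‖x‖ + μ.norm1)) (hz' : ‖z'‖ ≤ κ * (1 + ‖x'‖ + μ'.norm1)) :
    ‖optControl f g x μ z - optControl f g x' μ' z'‖ ≤
      (2 + κ) * c / l * (‖x - x'‖ + P2.cost π + ‖z - z'‖) := by
  set a := optControl f g x μ z
  set a' := optControl f g x' μ' z'
  set δ := ‖x - x'‖ + P2.cost π + ‖z - z'‖
  have hl := H.l_pos
  have hc := H.nonneg
  have hκ := H.κ_nonneg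
  have hcost := P2.cost_nonneg π
  have hδ : ‖x - x'‖ + P2.cost π ≤ δ := by simp [δ]
  have hδz : ‖z - z'‖ ≤ δ := by simp only [δ]; linarith [norm_nonneg (x - x')]
  have h1 := H.strongly_monotone hz a a'
  have hA : ‖dA f x μ a' - dA f x' μ' a'‖ * ‖z'‖ ≤ κ * c * δ := by
    have h2 := H.fA_lip x x' μ μ' a' a' π hπ
    rw [sub_self, norm_zero, add_zero] at h2
    calc _ ≤ ‖dA f x μ a' - dA f x' μ' a'‖ * (κ * (1 + ‖x'‖ + μ'.norm1)) :=
          mul_le_mul_of_nonneg_left hz' (norm_nonneg _)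
      _ = κ * (‖dA f x μ a' - dA f x' μ' a'‖ * (1 + ‖x'‖ + μ'.norm1)) := by ring
      _ ≤ κ * (c * δ) :=
          mul_le_mul_of_nonneg_left (h2.trans (mul_le_mul_of_nonneg_left hδ hc)) hκ
      _ = _ := by ring
  have hG : ‖dA g x μ a' - dA g x' μ' a'‖ ≤ c * δ := by
    have h2 := H.gA_lip x x' μ μ' a' a' π hπ
    rw [sub_self, norm_zero, add_zero] at h2
    exact h2.trans (mul_le_mul_of_nonneg_left hδ hc)
  have hD : ‖lagrangianDeriv f g x μ z a' - lagrangianDeriv f g x' μ' z' a'‖ ≤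
      (2 + κ) * c * δ := by
    have e : lagrangianDeriv f g x μ z a' - lagrangianDeriv f g x' μ' z' a' =
        (innerSL ℝ (z - z')).comp (dA f x μ a') +
          (innerSL ℝ z').comp (dA f x μ a' - dA f x' μ' a') +
          (dA g x μ a' - dA g x' μ' a') := by
      ext v
      simp [lagrangianDeriv]
      ring
    rw [e]
    refine (norm_add₃_le ..).trans ?_
    have h3 := (innerSL ℝ (z - z')).opNorm_comp_le (dA f x μ a')
    have h4 := (innerSL ℝ z').opNorm_comp_le (dA f x μ a' - dA f x' μ' a')
    rw [innerSL_apply_norm] at h3 h4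
    have h5 : ‖z - z'‖ * ‖dA f x μ a'‖ ≤ δ * c :=
      mul_le_mul hδz (H.fA_le x μ a') (norm_nonneg _) (by positivity)
    linarith
  have h2 : l * ‖a - a'‖ ^ 2 ≤ (2 + κ) * c * δ * ‖a - a'‖ := by
    have e : lagrangianDeriv f g x μ z a (a - a') - lagrangianDeriv f g x μ z a' (a - a') =
        -((lagrangianDeriv f g x μ z a' - lagrangianDeriv f g x' μ' z' a') (a - a')) := by
      rw [H.lagrangianDeriv_optControl hz, H.lagrangianDeriv_optControl hz']
      simp
    rw [e] at h1
    refine h1.trans ((neg_le_abs _).trans ?_)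
    exact (ContinuousLinearMap.le_opNorm _ _).trans
      (mul_le_mul_of_nonneg_right hD (norm_nonneg _))
  rcases (norm_nonneg (a - a')).eq_or_lt with h0 | h0
  · rw [← h0]; positivity
  · rw [div_mul_eq_mul_div, le_div_iff₀ hl]
    have : (‖a - a'‖ * l) * ‖a - a'‖ ≤ ((2 + κ) * c * δ) * ‖a - a'‖ := by linarith
    exact le_of_mul_le_mul_right this h0

theorem norm_fwdRHS_sub_le {x x' : Euc n} {μ μ' : P2 n} {z z' : Euc n}
    {π : Measure (Euc n × Euc n)} (hπ : P2.IsCoupling μ μ' π)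
    (hz : ‖z‖ ≤ κ * (1 + ‖x‖ + μ.norm1)) (hz' : ‖z'‖ ≤ κ * (1 + ‖x'‖ + μ'.norm1)) :
    ‖fwdRHS f g x μ z - fwdRHS f g x' μ' z'‖ ≤
      c * (1 + (2 + κ) * c / l) * (2 + κ) * (‖x - x'‖ + P2.cost π + ‖z - z'‖) := by
  have h1 := H.norm_optControl_sub_le hπ hz hz'
  have h2 := H.f_lip x x' μ μ' (optControl f g x μ z) (optControl f g x' μ' z') π hπ
  have hl := H.l_pos
  have hc := H.nonneg
  have hκ := H.κ_nonneg
  have hcost := P2.cost_nonneg π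
  set δ := ‖x - x'‖ + P2.cost π + ‖z - z'‖
  have hδ0 : 0 ≤ δ := by positivity
  have hδ : ‖x - x'‖ + P2.cost π ≤ δ := by simp [δ]
  set A := (2 + κ) * c / l
  have hA : 0 ≤ A := by positivity
  refine h2.trans ?_
  calc _ ≤ c * (δ + A * δ) := mul_le_mul_of_nonneg_left (add_le_add hδ h1) hc
    _ = c * (1 + A) * 1 * δ := by ring
    -- The factor `2 + κ` is slack; it gives the forward and backward right-hand sides the same
    -- constant.
    _ ≤ _ := by gcongr; linarith

/-- The product is split so that `z - z'` meets the bounded `dX f`, while `z'` meets a difference of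
`dX f` and is absorbed by the decay of its Lipschitz constant. -/
theorem norm_bwdRHS_sub_le {x x' : Euc n} {μ μ' : P2 n} {z z' : Euc n}
    {π : Measure (Euc n × Euc n)} (hπ : P2.IsCoupling μ μ' π)
    (hz : ‖z‖ ≤ κ * (1 + ‖x‖ + μ.norm1)) (hz' : ‖z'‖ ≤ κ * (1 + ‖x'‖ + μ'.norm1)) :
    ‖bwdRHS f g x μ z - bwdRHS f g x' μ' z'‖ ≤
      c * (1 + (2 + κ) * c / l) * (2 + κ) * (‖x - x'‖ + P2.cost π + ‖z - z'‖) := by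
  have h1 := H.norm_optControl_sub_le hπ hz hz'
  have h2 := H.fX_lip x x' μ μ' (optControl f g x μ z) (optControl f g x' μ' z') π hπ
  have h3 := H.gX_lip x x' μ μ' (optControl f g x μ z) (optControl f g x' μ' z') π hπ
  have h4 := H.fX_le x μ (optControl f g x μ z)
  have hl := H.l_pos
  have hc := H.nonneg
  have hκ := H.κ_nonneg
  have hcost := P2.cost_nonneg π
  unfold bwdRHS
  set a := optControl f g x μ z
  set a' := optControl f g x' μ' z'
  set δ := ‖x - x'‖ + P2.cost π + ‖z - z'‖
  have hδ0 : 0 ≤ δ := by positivity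
  have hδ : ‖x - x'‖ + P2.cost π ≤ δ := by simp [δ]
  have hδz : ‖z - z'‖ ≤ δ := by simp only [δ]; linarith [norm_nonneg (x - x')]
  set A := (2 + κ) * c / l
  have hA : 0 ≤ A := by positivity
  have h5 : c * (‖x - x'‖ + P2.cost π + ‖a - a'‖) ≤ c * ((1 + A) * δ) :=
    mul_le_mul_of_nonneg_left (by linarith) hc
  have e : ContinuousLinearMap.adjoint (dX f x μ a) z + gradient (fun y => g y μ a) x -
      (ContinuousLinearMap.adjoint (dX f x' μ' a') z' + gradient (fun y => g y μ' a') x') =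
      ContinuousLinearMap.adjoint (dX f x μ a) (z - z') +
        ContinuousLinearMap.adjoint (dX f x μ a - dX f x' μ' a') z' +
        (InnerProductSpace.toDual ℝ (Euc n)).symm (dX g x μ a - dX g x' μ' a') := by
    rw [map_sub, map_sub, map_sub, _root_.sub_apply]
    unfold gradient dX
    abel
  rw [e]
  refine (norm_add₃_le ..).trans ?_
  rw [LinearIsometryEquiv.norm_map]
  have h6 : ‖ContinuousLinearMap.adjoint (dX f x μ a) (z - z')‖ ≤ c * δ := by
    refine (ContinuousLinearMap.le_opNorm _ _).trans ?_
    rw [LinearIsometryEquiv.norm_map]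
    exact mul_le_mul h4 hδz (norm_nonneg _) hc
  have h7 : ‖ContinuousLinearMap.adjoint (dX f x μ a - dX f x' μ' a') z'‖ ≤
      κ * (c * ((1 + A) * δ)) := by
    refine (ContinuousLinearMap.le_opNorm _ _).trans ?_
    rw [LinearIsometryEquiv.norm_map]
    calc _ ≤ ‖dX f x μ a - dX f x' μ' a'‖ * (κ * (1 + ‖x'‖ + μ'.norm1)) :=
          mul_le_mul_of_nonneg_left hz' (norm_nonneg _)
      _ = κ * (‖dX f x μ a - dX f x' μ' a'‖ * (1 + ‖x'‖ + μ'.norm1)) := by ring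
      _ ≤ _ := mul_le_mul_of_nonneg_left (h2.trans h5) hκ
  have h8 := h3.trans h5
  have h9 : 0 ≤ c * A * δ := by positivity
  have e2 : c * (1 + A) * (2 + κ) * δ = c * δ + κ * (c * ((1 + A) * δ)) + c * ((1 + A) * δ)
      + c * A * δ := by ring
  linarith

end ControlBounds

end OptimalControl

/-! ### Radial truncation -/

section Truncation

variable {E : Type*} [NormedAddCommGroup E] [NormedSpace ℝ E]

/-- The radial projection onto the ball of radius `R > 0`. -/
noncomputable def truncate (R : ℝ) (z : E) : E := (R / max R ‖z‖) • z

theorem truncate_of_norm_le {R : ℝ} (hR : 0 < R) {z : E} (hz : ‖z‖ ≤ R) : truncate R z = z := by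
  rw [truncate, max_eq_left hz, div_self hR.ne', one_smul]

theorem norm_truncate {R : ℝ} (hR : 0 < R) (z : E) : ‖truncate R z‖ = min R ‖z‖ := by
  rw [truncate, norm_smul, Real.norm_of_nonneg (by positivity), div_mul_eq_mul_div,
    div_eq_iff (by positivity), ← min_mul_max R ‖z‖]

theorem norm_truncate_le {R : ℝ} (hR : 0 < R) (z : E) : ‖truncate R z‖ ≤ R :=
  (norm_truncate hR z).trans_le (min_le_left _ _)

/-- The point and the radius are moved one after the other. The constant 2 comes from moving the
point and its scaling factor separately, without an inner product; in the radius, only `min R ‖z'‖`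
changes. -/
theorem norm_truncate_sub_le {R R' : ℝ} (hR : 0 < R) (hR' : 0 < R') (z z' : E) :
    ‖truncate R z - truncate R' z'‖ ≤ 2 * ‖z - z'‖ + |R - R'| := by
  have h1 : ‖truncate R z - truncate R z'‖ ≤ 2 * ‖z - z'‖ := by
    have e : truncate R z - truncate R z' = (R / max R ‖z‖) • (z - z') +
        (R / max R ‖z‖ - R / max R ‖z'‖) • z' := by
      simp only [truncate]; module
    have hM : 0 < max R ‖z‖ := by positivity
    have hM' : 0 < max R ‖z'‖ := by positivity
    have hr : R / max R ‖z‖ ≤ 1 := (div_le_one hM).2 (le_max_left _ _)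
    have h2 : |max R ‖z'‖ - max R ‖z‖| ≤ ‖z - z'‖ := by
      refine (abs_max_sub_max_le_max ..).trans ?_
      rw [sub_self, abs_zero, max_eq_right (abs_nonneg _), abs_sub_comm]
      exact abs_norm_sub_norm_le z z'
    have h3 : |R / max R ‖z‖ - R / max R ‖z'‖| * ‖z'‖ ≤ ‖z - z'‖ := by
      have e2 : R / max R ‖z‖ - R / max R ‖z'‖ =
          (R / max R ‖z‖) * ((max R ‖z'‖ - max R ‖z‖) / max R ‖z'‖) := by
        field_simp
      rw [e2, abs_mul, abs_of_pos (div_pos hR hM), abs_div, abs_of_pos hM', mul_assoc]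
      have h4 : |max R ‖z'‖ - max R ‖z‖| / max R ‖z'‖ * ‖z'‖ ≤ ‖z - z'‖ := by
        rw [div_mul_eq_mul_div, div_le_iff₀ hM']
        exact mul_le_mul h2 (le_max_right _ _) (norm_nonneg _) (norm_nonneg _)
      exact (mul_le_of_le_one_left (by positivity) hr).trans h4
    rw [e]
    refine (norm_add_le _ _).trans ?_
    rw [norm_smul, norm_smul, Real.norm_of_nonneg (div_pos hR hM).le, Real.norm_eq_abs]
    linarith [mul_le_of_le_one_left (norm_nonneg (z - z')) hr]
  have h2 : ‖truncate R z' - truncate R' z'‖ ≤ |R - R'| := by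
    have e : ‖truncate R z' - truncate R' z'‖ = |min R ‖z'‖ - min R' ‖z'‖| := by
      rw [truncate, truncate, ← sub_smul, norm_smul, Real.norm_eq_abs, ← abs_norm z', ← abs_mul,
        abs_norm, sub_mul, div_mul_eq_mul_div, div_mul_eq_mul_div, ← min_mul_max R ‖z'‖,
        ← min_mul_max R' ‖z'‖, mul_div_cancel_right₀ _ (by positivity),
        mul_div_cancel_right₀ _ (by positivity)]
    rw [e]
    refine (abs_min_sub_min_le_max ..).trans ?_
    simp
  have h3 := norm_add_le (truncate R z - truncate R z') (truncate R z' - truncate R' z')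
  rw [sub_add_sub_cancel] at h3
  linarith

end Truncation

/-! ### Lipschitz vector fields -/

section LipField

variable {n : ℕ}

/-- A vector field that is Lipschitz along couplings and has linear growth, uniformly in the last
variable. -/
structure LipField (K : ℝ) (H : Euc n → P2 n → Euc n → Euc n) : Prop where
  nonneg : 0 ≤ K
  lip : ∀ x x' μ μ' z z' π, P2.IsCoupling μ μ' π →
    ‖H x μ z - H x' μ' z'‖ ≤ K * (‖x - x'‖ + P2.cost π + ‖z - z'‖)
  growth : ∀ x μ z, ‖H x μ z‖ ≤ K * (1 + ‖x‖ + μ.norm1)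

/-- The truncation in the last variable to `|z| ≤ κ (1 + |x| + ‖μ‖₁)`. -/
noncomputable def truncField (κ : ℝ) (H : Euc n → P2 n → Euc n → Euc n) (x : Euc n) (μ : P2 n)
    (z : Euc n) : Euc n :=
  H x μ (truncate (κ * (1 + ‖x‖ + μ.norm1)) z)

theorem weight_pos (x : Euc n) (μ : P2 n) : 0 < 1 + ‖x‖ + μ.norm1 := by
  have := μ.norm1_nonneg
  positivity

theorem truncField_eq {κ : ℝ} (hκ : 0 < κ) {H : Euc n → P2 n → Euc n → Euc n} {x : Euc n}
    {μ : P2 n} {z : Euc n} (hz : ‖z‖ ≤ κ * (1 + ‖x‖ + μ.norm1)) :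
    truncField κ H x μ z = H x μ z := by
  rw [truncField, truncate_of_norm_le (mul_pos hκ (weight_pos x μ)) hz]

/-- Truncation lands in the cone, where the Lipschitz bound holds, and its radius is Lipschitz in
state and law; the price is the factor `2 + κ`. Comparison with the point at the origin gives growth
uniformly in `z`, since a truncated `z` is controlled by the weight. -/
theorem lipField_truncField {κ K₀ K₁ : ℝ} (hκ : 0 < κ) (hK₀ : 0 ≤ K₀) (hK₁ : 0 ≤ K₁)
    {H : Euc n → P2 n → Euc n → Euc n}
    (hlip : ∀ x x' μ μ' z z' π, P2.IsCoupling μ μ' π → ‖z‖ ≤ κ * (1 + ‖x‖ + μ.norm1) →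
      ‖z'‖ ≤ κ * (1 + ‖x'‖ + μ'.norm1) →
      ‖H x μ z - H x' μ' z'‖ ≤ K₁ * (‖x - x'‖ + P2.cost π + ‖z - z'‖))
    (h0 : ‖H 0 (P2.dirac 0) 0‖ ≤ K₀) :
    LipField (K₀ + K₁ * (2 + κ)) (truncField κ H) := by
  refine ⟨by positivity, fun x x' μ μ' z z' π hπ => ?_, fun x μ z => ?_⟩
  · have hR := mul_pos hκ (weight_pos x μ)
    have hR' := mul_pos hκ (weight_pos x' μ')
    refine (hlip x x' μ μ' _ _ π hπ (norm_truncate_le hR z) (norm_truncate_le hR' z')).trans ?_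
    have h1 := norm_truncate_sub_le hR hR' z z'
    have h2 : |κ * (1 + ‖x‖ + μ.norm1) - κ * (1 + ‖x'‖ + μ'.norm1)| ≤
        κ * (‖x - x'‖ + P2.cost π) := by
      rw [← mul_sub, abs_mul, abs_of_pos hκ]
      refine mul_le_mul_of_nonneg_left ?_ hκ.le
      have e : 1 + ‖x‖ + μ.norm1 - (1 + ‖x'‖ + μ'.norm1) =
        (‖x‖ - ‖x'‖) + (μ.norm1 - μ'.norm1) := by ring
      rw [e]
      exact (abs_add_le _ _).trans (add_le_add (abs_norm_sub_norm_le x x') hπ.abs_norm1_sub_le)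
    have hc := P2.cost_nonneg π
    have h3 : 0 ≤ ‖x - x'‖ + P2.cost π := by positivity
    have h4 : ‖x - x'‖ + P2.cost π + ‖truncate (κ * (1 + ‖x‖ + μ.norm1)) z -
        truncate (κ * (1 + ‖x'‖ + μ'.norm1)) z'‖ ≤
        (2 + κ) * (‖x - x'‖ + P2.cost π + ‖z - z'‖) := by
      nlinarith [mul_nonneg hκ.le (norm_nonneg (z - z'))]
    calc _ ≤ K₁ * ((2 + κ) * (‖x - x'‖ + P2.cost π + ‖z - z'‖)) :=
          mul_le_mul_of_nonneg_left h4 hK₁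
      _ = K₁ * (2 + κ) * (‖x - x'‖ + P2.cost π + ‖z - z'‖) := by ring
      _ ≤ _ := mul_le_mul_of_nonneg_right (by linarith) (by positivity)
  · have hw := weight_pos x μ
    have hR := mul_pos hκ hw
    have hz := norm_truncate_le hR z
    have h1 := hlip x 0 μ (P2.dirac 0) (truncate (κ * (1 + ‖x‖ + μ.norm1)) z) 0 _
      (μ.isCoupling_dirac 0) hz
      (norm_zero.trans_le (mul_pos hκ (weight_pos 0 (P2.dirac 0))).le)
    rw [μ.cost_dirac, sub_zero, sub_zero] at h1
    have h2 := norm_add_le (H x μ (truncate (κ * (1 + ‖x‖ + μ.norm1)) z) - H 0 (P2.dirac 0) 0)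
      (H 0 (P2.dirac 0) 0)
    rw [sub_add_cancel] at h2
    have hm := μ.norm1_nonneg
    have h3 : K₀ * 1 ≤ K₀ * (1 + ‖x‖ + μ.norm1) :=
      mul_le_mul_of_nonneg_left (by linarith [norm_nonneg x]) hK₀
    have h4 : K₁ * (‖x‖ + μ.norm1 + ‖truncate (κ * (1 + ‖x‖ + μ.norm1)) z‖) ≤
        K₁ * ((2 + κ) * (1 + ‖x‖ + μ.norm1)) :=
      mul_le_mul_of_nonneg_left (by nlinarith) hK₁
    unfold truncField
    linarith

end LipField

/-! ### The forward-backward system over a probability space -/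

section ForwardBackward

variable {n : ℕ}

/-- The standing hypotheses on the abstract forward-backward system. -/
structure SystemBounds (F B : Euc n → P2 n → Euc n → Euc n) (p : Euc n → P2 n → Euc n)
    (K Λ : ℝ) : Prop where
  F_lip : LipField K F
  B_lip : LipField K B
  Λ_pos : 0 < Λ
  p_lip : ∀ x x' μ μ' π, P2.IsCoupling μ μ' π → ‖p x μ - p x' μ'‖ ≤ Λ * (‖x - x'‖ + P2.cost π)
  p_growth : ∀ x μ, ‖p x μ‖ ≤ Λ * (1 + ‖x‖ + μ.norm1)

variable {Ω : Type*} [MeasurableSpace Ω]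

/-- A nonnegative weight whose mean is at most twice any of its values. -/
structure IsWeight (P : Measure Ω) (W : Ω → ℝ) : Prop where
  integrable : Integrable W P
  nonneg : ∀ ω, 0 ≤ W ω
  mean_le : ∀ ω, ∫ ω', W ω' ∂P ≤ 2 * W ω

theorem isWeight_add_mean {P : Measure Ω} [IsProbabilityMeasure P] {h : Ω → ℝ}
    (hi : Integrable h P) (h0 : ∀ ω, 0 ≤ h ω) : IsWeight P fun ω => h ω + ∫ ω', h ω' ∂P := by
  have hm : 0 ≤ ∫ ω', h ω' ∂P := integral_nonneg h0
  refine ⟨hi.add (integrable_const _), fun ω => add_nonneg (h0 ω) hm, fun ω => ?_⟩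
  rw [integral_add hi (integrable_const _)]
  simp only [integral_const, probReal_univ, one_smul]
  linarith [h0 ω]

namespace IsWeight

variable {P : Measure Ω} {W W' : Ω → ℝ}

theorem add (h : IsWeight P W) (h' : IsWeight P W') : IsWeight P fun ω => W ω + W' ω := by
  refine ⟨h.integrable.add h'.integrable, fun ω => add_nonneg (h.nonneg ω) (h'.nonneg ω),
    fun ω => ?_⟩
  rw [integral_add h.integrable h'.integrable]
  linarith [h.mean_le ω, h'.mean_le ω]

theorem const_mul (h : IsWeight P W) {c : ℝ} (hc : 0 ≤ c) : IsWeight P fun ω => c * W ω := by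
  refine ⟨h.integrable.const_mul c, fun ω => mul_nonneg hc (h.nonneg ω), fun ω => ?_⟩
  rw [integral_const_mul]
  linarith [mul_le_mul_of_nonneg_left (h.mean_le ω) hc]

/-- This is the purpose of weights: a pointwise bound controls the mean by the same weight at every
point, so mean-field terms fit into pointwise estimates. -/
theorem integral_norm_le (h : IsWeight P W) {V : Ω → Euc n} (hV : ∀ ω, ‖V ω‖ ≤ W ω) (ω : Ω) :
    ∫ ω', ‖V ω'‖ ∂P ≤ 2 * W ω :=
  (integral_mono_of_nonneg (Eventually.of_forall fun _ => norm_nonneg _) h.integrable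
    (Eventually.of_forall hV)).trans (h.mean_le ω)

end IsWeight

theorem isWeight_one_add_norm (m : P2 n) :
    IsWeight m.toMeasure fun x => 1 + ‖x‖ + m.norm1 := by
  refine ⟨((integrable_const 1).add m.integrable_norm).add (integrable_const _),
    fun x => (weight_pos x m).le, fun x => ?_⟩
  rw [P2.mean_weight]
  linarith [norm_nonneg x]

/-- The joint law of the two states couples their laws. The factor 3 is one for the state and two
for the mean distance. -/
theorem LipField.norm_sub_le_of_weight {K : ℝ} {F : Euc n → P2 n → Euc n → Euc n}
    (hF : LipField K F) {P : Measure Ω} {X X' : Ω → Euc n} {μ μ' : P2 n} (hX : Measurable X)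
    (hX' : Measurable X') (hμ : μ.toMeasure = P.map X) (hμ' : μ'.toMeasure = P.map X') {W : Ω → ℝ}
    (hW : IsWeight P W) (hXW : ∀ ω, ‖X ω - X' ω‖ ≤ W ω) (z z' : Euc n) (ω : Ω) :
    ‖F (X ω) μ z - F (X' ω) μ' z'‖ ≤ K * (3 * W ω + ‖z - z'‖) := by
  have h1 := hF.lip (X ω) (X' ω) μ μ' z z' _ (P2.isCoupling_map hX hX' hμ hμ')
  rw [P2.cost_map hX hX'] at h1
  refine h1.trans (mul_le_mul_of_nonneg_left ?_ hF.nonneg)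
  linarith [hW.integral_norm_le hXW ω, hXW ω]

/-- One step of the Picard iteration: `(Y, V)` is computed from `(X, Z)`. -/
structure IsPicardStep (F B : Euc n → P2 n → Euc n → Euc n) (p : Euc n → P2 n → Euc n) (s T : ℝ)
    (P : Measure Ω) (ξ : Ω → Euc n) (X Z : ℝ → Ω → Euc n) (μ : ℝ → P2 n) (Y V : ℝ → Ω → Euc n)
    (ν : P2 n) : Prop where
  measurable : ∀ u ∈ Icc s T, Measurable (X u)
  law : ∀ u ∈ Icc s T, (μ u).toMeasure = P.map (X u)
  contF : ∀ ω, ContinuousOn (fun u => F (X u ω) (μ u) (Z u ω)) (Icc s T)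
  contB : ∀ ω, ContinuousOn (fun u => B (X u ω) (μ u) (Z u ω)) (Icc s T)
  measurable_end : Measurable (Y T)
  law_end : ν.toMeasure = P.map (Y T)
  fwd : ∀ ω, ∀ τ ∈ Icc s T, Y τ ω = ξ ω + ∫ u in s..τ, F (X u ω) (μ u) (Z u ω)
  bwd : ∀ ω, ∀ τ ∈ Icc s T, V τ ω = p (Y T ω) ν + ∫ u in τ..T, B (X u ω) (μ u) (Z u ω)

theorem norm_integral_sub_le {s T a b c : ℝ} {u v : ℝ → Euc n} (ha : a ∈ Icc s T) (hb : b ∈ Icc s T)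
    (hab : a ≤ b) (hu : ContinuousOn u (Icc s T)) (hv : ContinuousOn v (Icc s T))
    (h : ∀ t ∈ Icc s T, ‖u t - v t‖ ≤ c) :
    ‖(∫ t in a..b, u t) - ∫ t in a..b, v t‖ ≤ (T - s) * c := by
  have hsub : uIcc a b ⊆ Icc s T := by
    rw [uIcc_of_le hab]; exact Icc_subset_Icc ha.1 hb.2
  have hc : 0 ≤ c := (norm_nonneg _).trans (h a ha)
  rw [← intervalIntegral.integral_sub (hu.mono hsub).intervalIntegrable
    (hv.mono hsub).intervalIntegrable]
  refine (intervalIntegral.norm_integral_le_of_norm_le_const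
    fun t ht => h t (hsub (uIoc_subset_uIcc ht))).trans ?_
  rw [abs_of_nonneg (sub_nonneg.2 hab), mul_comm]
  exact mul_le_mul_of_nonneg_right (by linarith [ha.1, hb.2]) hc

/-- The Picard step contracts distances on short time intervals. -/
theorem IsPicardStep.norm_sub_le {F B : Euc n → P2 n → Euc n → Euc n} {p : Euc n → P2 n → Euc n}
    {K Λ s T : ℝ} (D : SystemBounds F B p K Λ) (hsT : s ≤ T)
    (hsmall : (T - s) * (K * (4 + 12 * Λ)) ≤ 1 / 2) {P : Measure Ω}
    [IsProbabilityMeasure P] {ξ ξ' : Ω → Euc n} {X X' Z Z' Y Y' V V' : ℝ → Ω → Euc n}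
    {μ μ' : ℝ → P2 n} {ν ν' : P2 n} (h : IsPicardStep F B p s T P ξ X Z μ Y V ν)
    (h' : IsPicardStep F B p s T P ξ' X' Z' μ' Y' V' ν')
    (hξ : Integrable (fun ω => ‖ξ ω - ξ' ω‖) P) {W : Ω → ℝ} (hW : IsWeight P W)
    (hX : ∀ u ∈ Icc s T, ∀ ω, ‖X u ω - X' u ω‖ ≤ W ω)
    (hZ : ∀ u ∈ Icc s T, ∀ ω, ‖Z u ω - Z' u ω‖ ≤ W ω) (τ : ℝ) (hτ : τ ∈ Icc s T) (ω : Ω) :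
    ‖Y τ ω - Y' τ ω‖ ≤
      (1 + Λ) * (‖ξ ω - ξ' ω‖ + ∫ ω', ‖ξ ω' - ξ' ω'‖ ∂P) + 1 / 2 * W ω ∧
    ‖V τ ω - V' τ ω‖ ≤
      (1 + Λ) * (‖ξ ω - ξ' ω‖ + ∫ ω', ‖ξ ω' - ξ' ω'‖ ∂P) + 1 / 2 * W ω := by
  have hK := D.F_lip.nonneg
  have hΛ := D.Λ_pos
  have hs : s ∈ Icc s T := left_mem_Icc.2 hsT
  have hT : T ∈ Icc s T := right_mem_Icc.2 hsT
  have hTs : 0 ≤ T - s := sub_nonneg.2 hsT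
  have hrhs : ∀ {H : Euc n → P2 n → Euc n → Euc n}, LipField K H → ∀ ω, ∀ t ∈ Icc s T,
      ‖H (X t ω) (μ t) (Z t ω) - H (X' t ω) (μ' t) (Z' t ω)‖ ≤ 4 * K * W ω := by
    intro H hH ω t ht
    have h1 := hH.norm_sub_le_of_weight (h.measurable t ht) (h'.measurable t ht) (h.law t ht)
      (h'.law t ht) hW (hX t ht) (Z t ω) (Z' t ω) ω
    linarith [mul_le_mul_of_nonneg_left (hZ t ht ω) hK]
  have hY : ∀ τ ∈ Icc s T, ∀ ω, ‖Y τ ω - Y' τ ω‖ ≤ ‖ξ ω - ξ' ω‖ + (T - s) * (4 * K * W ω) := by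
    intro τ hτ ω
    rw [h.fwd ω τ hτ, h'.fwd ω τ hτ, add_sub_add_comm]
    exact (norm_add_le _ _).trans (add_le_add_right (norm_integral_sub_le hs hτ hτ.1 (h.contF ω)
      (h'.contF ω) (hrhs D.F_lip ω)) _)
  have hmean : ∫ ω', ‖Y T ω' - Y' T ω'‖ ∂P ≤
      (∫ ω', ‖ξ ω' - ξ' ω'‖ ∂P) + (T - s) * (4 * K * (2 * W ω)) := by
    have hi : Integrable (fun ω' => (T - s) * (4 * K * W ω')) P :=
      (hW.integrable.const_mul _).const_mul _
    have h1 := integral_mono_of_nonneg (μ := P)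
      (Eventually.of_forall fun ω' => norm_nonneg (Y T ω' - Y' T ω')) (hξ.add hi)
      (Eventually.of_forall (hY T hT))
    simp only [Pi.add_apply] at h1
    rw [integral_add hξ hi, integral_const_mul, integral_const_mul] at h1
    refine h1.trans (add_le_add_right ?_ _)
    gcongr
    exact hW.mean_le ω
  have hV : ‖V τ ω - V' τ ω‖ ≤
      Λ * (‖Y T ω - Y' T ω‖ + ∫ ω', ‖Y T ω' - Y' T ω'‖ ∂P) + (T - s) * (4 * K * W ω) := by
    rw [h.bwd ω τ hτ, h'.bwd ω τ hτ, add_sub_add_comm]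
    refine (norm_add_le _ _).trans (add_le_add ?_ (norm_integral_sub_le hτ hT hτ.2 (h.contB ω)
      (h'.contB ω) (hrhs D.B_lip ω)))
    have h1 := D.p_lip (Y T ω) (Y' T ω) ν ν' _ (P2.isCoupling_map h.measurable_end
      h'.measurable_end h.law_end h'.law_end)
    rwa [P2.cost_map h.measurable_end h'.measurable_end] at h1
  -- The weight collects `4 * K * (T - s)` from the running integral and three times `Λ` times that
  -- from the terminal function, which sees both the end state and its mean; hence the constant `4 +
  -- 12 * Λ`.
  have hm : 0 ≤ ∫ ω', ‖ξ ω' - ξ' ω'‖ ∂P := integral_nonneg fun _ => norm_nonneg _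
  have hn := norm_nonneg (ξ ω - ξ' ω)
  have hWω := hW.nonneg ω
  have h1 := mul_le_mul_of_nonneg_right hsmall hWω
  have h2 : 0 ≤ (T - s) * K * Λ * W ω := by positivity
  constructor
  · nlinarith [hY τ hτ ω, mul_nonneg hΛ.le hn, mul_nonneg hΛ.le hm]
  · have h3 := mul_le_mul_of_nonneg_left (add_le_add (hY T hT ω) hmean) hΛ.le
    nlinarith [mul_nonneg hΛ.le hn, mul_nonneg hΛ.le hm]

/-- A solution of the forward-backward system on `[s,T]` over a probability space, with initial
value `ξ` and with `μ u` the law of `X u`. -/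
structure IsSystemSolution (F B : Euc n → P2 n → Euc n → Euc n) (p : Euc n → P2 n → Euc n)
    (s T : ℝ) (P : Measure Ω) (ξ : Ω → Euc n) (X Z : ℝ → Ω → Euc n) (μ : ℝ → P2 n) : Prop where
  step : IsPicardStep F B p s T P ξ X Z μ X Z (μ T)
  dominated : ∃ v : Ω → ℝ, Integrable v P ∧ ∀ u ∈ Icc s T, ∀ ω, ‖X u ω‖ ≤ v ω ∧ ‖Z u ω‖ ≤ v ω

namespace IsSystemSolution

variable {F B : Euc n → P2 n → Euc n → Euc n} {p : Euc n → P2 n → Euc n} {K Λ s T : ℝ}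
  {P : Measure Ω} {ξ ξ' : Ω → Euc n} {X X' Z Z' : ℝ → Ω → Euc n} {μ μ' : ℝ → P2 n}

theorem initial (h : IsSystemSolution F B p s T P ξ X Z μ) (hsT : s ≤ T) : X s = ξ := by
  ext1 ω
  simpa using h.step.fwd ω s (left_mem_Icc.2 hsT)

/-- Stability of solutions with respect to the initial value. -/
theorem norm_sub_le [IsProbabilityMeasure P] (D : SystemBounds F B p K Λ)
    (h : IsSystemSolution F B p s T P ξ X Z μ) (h' : IsSystemSolution F B p s T P ξ' X' Z' μ')
    (hsT : s ≤ T) (hsmall : (T - s) * (K * (4 + 12 * Λ)) ≤ 1 / 2) (τ : ℝ) (hτ : τ ∈ Icc s T)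
    (ω : Ω) :
    ‖X τ ω - X' τ ω‖ ≤ 2 * (1 + Λ) * (‖ξ ω - ξ' ω‖ + ∫ ω', ‖ξ ω' - ξ' ω'‖ ∂P) ∧
    ‖Z τ ω - Z' τ ω‖ ≤ 2 * (1 + Λ) * (‖ξ ω - ξ' ω‖ + ∫ ω', ‖ξ ω' - ξ' ω'‖ ∂P) := by
  obtain ⟨v, hv, hvb⟩ := h.dominated
  obtain ⟨v', hv', hvb'⟩ := h'.dominated
  have hs : s ∈ Icc s T := left_mem_Icc.2 hsT
  have hξ : Integrable (fun ω => ‖ξ ω - ξ' ω‖) P := by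
    rw [← h.initial hsT, ← h'.initial hsT]
    refine (hv.add hv').mono' ((h.step.measurable s hs).sub
      (h'.step.measurable s hs)).norm.aestronglyMeasurable (Eventually.of_forall fun ω => ?_)
    rw [norm_norm]
    exact (_root_.norm_sub_le _ _).trans (add_le_add (hvb s hs ω).1 (hvb' s hs ω).1)
  have hv0 : ∀ ω, 0 ≤ v ω + v' ω := fun ω =>
    add_nonneg ((norm_nonneg _).trans (hvb s hs ω).1) ((norm_nonneg _).trans (hvb' s hs ω).1)
  have hW₁ := isWeight_add_mean hξ fun ω => norm_nonneg _
  have hW₂ := isWeight_add_mean (hv.add hv') hv0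
  simp only [Pi.add_apply] at hW₂
  set W₁ := fun ω => ‖ξ ω - ξ' ω‖ + ∫ ω', ‖ξ ω' - ξ' ω'‖ ∂P
  set W₂ := fun ω => v ω + v' ω + ∫ ω', (v ω' + v' ω') ∂P
  have hΛ := D.Λ_pos
  -- Domination provides a finite first bound. Since `2 * (1 + Λ) * W₁` is the fixed point of `c ↦
  -- (1 + Λ) * W₁ + c / 2`, each Picard estimate halves the excess over it.
  have key : ∀ j : ℕ, ∀ u ∈ Icc s T, ∀ ω,
      ‖X u ω - X' u ω‖ ≤ 2 * (1 + Λ) * W₁ ω + (1 / 2) ^ j * W₂ ω ∧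
      ‖Z u ω - Z' u ω‖ ≤ 2 * (1 + Λ) * W₁ ω + (1 / 2) ^ j * W₂ ω := by
    intro j
    induction j with
    | zero =>
      intro u hu ω
      have h1 := mul_nonneg (by positivity : 0 ≤ 2 * (1 + Λ)) (hW₁.nonneg ω)
      have h2 : 0 ≤ ∫ ω', (v ω' + v' ω') ∂P := integral_nonneg hv0
      have h3 := hvb u hu ω
      have h4 := hvb' u hu ω
      simp only [pow_zero, one_mul]
      constructor
      · refine (_root_.norm_sub_le _ _).trans ?_
        simp only [W₂]; linarith
      · refine (_root_.norm_sub_le _ _).trans ?_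
        simp only [W₂]; linarith
    | succ j ih =>
      intro u hu ω
      have h1 := h.step.norm_sub_le D hsT hsmall h'.step hξ
        ((hW₁.const_mul (by positivity : 0 ≤ 2 * (1 + Λ))).add
          (hW₂.const_mul (by positivity : (0 : ℝ) ≤ (1 / 2) ^ j)))
        (fun u hu ω => (ih u hu ω).1) (fun u hu ω => (ih u hu ω).2) u hu ω
      have e : (1 + Λ) * W₁ ω + 1 / 2 * (2 * (1 + Λ) * W₁ ω + (1 / 2) ^ j * W₂ ω) =
          2 * (1 + Λ) * W₁ ω + (1 / 2) ^ (j + 1) * W₂ ω := by ring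
      rw [← e]
      exact h1
  have hlim : Tendsto (fun j : ℕ => 2 * (1 + Λ) * W₁ ω + (1 / 2) ^ j * W₂ ω) atTop
      (𝓝 (2 * (1 + Λ) * W₁ ω)) := by
    have := ((tendsto_pow_atTop_nhds_zero_of_lt_one (r := (1 / 2 : ℝ)) (by norm_num)
      (by norm_num)).mul_const (W₂ ω)).const_add (2 * (1 + Λ) * W₁ ω)
    simpa using this
  exact ⟨ge_of_tendsto' hlim fun j => (key j τ hτ ω).1,
    ge_of_tendsto' hlim fun j => (key j τ hτ ω).2⟩

/-- The restriction of a solution to a later time interval. -/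
theorem restrict (h : IsSystemSolution F B p s T P ξ X Z μ) {r : ℝ} (hr : r ∈ Icc s T) :
    IsSystemSolution F B p r T P (X r) X Z μ := by
  have hsub : Icc r T ⊆ Icc s T := Icc_subset_Icc_left hr.1
  obtain ⟨v, hv, hvb⟩ := h.dominated
  refine ⟨⟨fun u hu => h.step.measurable u (hsub hu), fun u hu => h.step.law u (hsub hu),
    fun ω => (h.step.contF ω).mono hsub, fun ω => (h.step.contB ω).mono hsub,
    h.step.measurable_end, h.step.law_end, fun ω τ hτ => ?_,
    fun ω τ hτ => h.step.bwd ω τ (hsub hτ)⟩, v, hv, fun u hu ω => hvb u (hsub hu) ω⟩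
  have hI : ∀ a ∈ Icc s T, ∀ b ∈ Icc s T,
      IntervalIntegrable (fun u => F (X u ω) (μ u) (Z u ω)) volume a b := fun a ha b hb =>
    ((h.step.contF ω).mono (uIcc_subset_Icc ha hb)).intervalIntegrable
  have hs : s ∈ Icc s T := left_mem_Icc.2 (hr.1.trans hr.2)
  rw [h.step.fwd ω τ (hsub hτ), h.step.fwd ω r hr, add_assoc,
    intervalIntegral.integral_add_adjacent_intervals (hI s hs r hr) (hI r hr τ (hsub hτ))]

/-- The composition of a solution with a measure-preserving map. -/
theorem comp {Ω' : Type*} [MeasurableSpace Ω'] {Q : Measure Ω'} {φ : Ω' → Ω} (hφ : Measurable φ)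
    (hQ : Q.map φ = P) (h : IsSystemSolution F B p s T P ξ X Z μ) (hsT : s ≤ T) :
    IsSystemSolution F B p s T Q (fun ω => ξ (φ ω)) (fun u ω => X u (φ ω))
      (fun u ω => Z u (φ ω)) μ := by
  subst hQ
  obtain ⟨v, hv, hvb⟩ := h.dominated
  have hlaw : ∀ u ∈ Icc s T, (μ u).toMeasure = Q.map fun ω => X u (φ ω) := fun u hu => by
    rw [h.step.law u hu, Measure.map_map (h.step.measurable u hu) hφ]; rfl
  exact ⟨⟨fun u hu => (h.step.measurable u hu).comp hφ, hlaw, fun ω => h.step.contF (φ ω),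
    fun ω => h.step.contB (φ ω), h.step.measurable_end.comp hφ,
    hlaw T (right_mem_Icc.2 hsT), fun ω => h.step.fwd (φ ω), fun ω => h.step.bwd (φ ω)⟩,
    fun ω => v (φ ω), hv.comp_measurable hφ, fun u hu ω => hvb u hu (φ ω)⟩

end IsSystemSolution

end ForwardBackward

/-! ### Existence for the forward-backward system -/

section Existence

variable {n : ℕ}

/-- A jointly continuous flow of linear growth. -/
structure IsRegularFlow (X : ℝ → Euc n → Euc n) : Prop where
  cont : Continuous fun q : ℝ × Euc n => X q.1 q.2
  growth : ∃ c : ℝ, ∀ u x, ‖X u x‖ ≤ c * (1 + ‖x‖)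

namespace IsRegularFlow

variable {X : ℝ → Euc n → Euc n} (h : IsRegularFlow X)
include h

theorem measurable (u : ℝ) : Measurable (X u) :=
  (h.cont.comp (continuous_const.prodMk continuous_id)).measurable

theorem memLp (m : P2 n) (u : ℝ) : MemLp (X u) 2 m.toMeasure := by
  obtain ⟨c, hc⟩ := h.growth
  exact m.memLp_two_of_linear_growth (h.measurable u) (hc u)

theorem toMeasure_map (m : P2 n) (u : ℝ) : (m.map (X u)).toMeasure = m.toMeasure.map (X u) :=
  m.toMeasure_map (h.measurable u) (h.memLp m u)

theorem exists_norm1_map_le (m : P2 n) : ∃ c, ∀ u, (m.map (X u)).norm1 ≤ c := by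
  obtain ⟨c, hc⟩ := h.growth
  refine ⟨∫ x, c * (1 + ‖x‖) ∂m.toMeasure, fun u => ?_⟩
  rw [P2.norm1_eq_of_map (h.measurable u) (h.toMeasure_map m u)]
  exact integral_mono_of_nonneg (Eventually.of_forall fun _ => norm_nonneg _)
    (((integrable_const _).add m.integrable_norm).const_mul _) (Eventually.of_forall (hc u))

theorem continuous_mean_dist (m : P2 n) (u₀ : ℝ) :
    Continuous fun u => ∫ x, ‖X u x - X u₀ x‖ ∂m.toMeasure := by
  obtain ⟨c, hc⟩ := h.growth
  refine continuous_of_dominated (bound := fun x => 2 * (c * (1 + ‖x‖))) (fun u =>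
    ((h.measurable u).sub (h.measurable u₀)).norm.aestronglyMeasurable) (fun u =>
    Eventually.of_forall fun x => ?_)
    ((((integrable_const _).add m.integrable_norm).const_mul _).const_mul _)
    (Eventually.of_forall fun x => ?_)
  · rw [norm_norm]
    linarith [norm_sub_le (X u x) (X u₀ x), hc u x, hc u₀ x]
  · exact ((h.cont.comp (continuous_id.prodMk continuous_const)).sub continuous_const).norm

/-- The law enters only through the mean distance of the flow at two times, which is continuous by
dominated convergence. -/
theorem continuous_field {K : ℝ} {F : Euc n → P2 n → Euc n → Euc n} (hF : LipField K F)
    {Z : ℝ → Euc n → Euc n} (hZ : Continuous fun q : ℝ × Euc n => Z q.1 q.2) (m : P2 n) :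
    Continuous fun q : ℝ × Euc n => F (X q.1 q.2) (m.map (X q.1)) (Z q.1 q.2) := by
  rw [continuous_iff_continuousAt]
  intro q₀
  have hb : ∀ q : ℝ × Euc n, ‖F (X q.1 q.2) (m.map (X q.1)) (Z q.1 q.2) -
      F (X q₀.1 q₀.2) (m.map (X q₀.1)) (Z q₀.1 q₀.2)‖ ≤ K * (‖X q.1 q.2 - X q₀.1 q₀.2‖ +
        (∫ x, ‖X q.1 x - X q₀.1 x‖ ∂m.toMeasure) + ‖Z q.1 q.2 - Z q₀.1 q₀.2‖) := by
    intro q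
    have h1 := hF.lip (X q.1 q.2) (X q₀.1 q₀.2) _ _ (Z q.1 q.2) (Z q₀.1 q₀.2) _
      (P2.isCoupling_map (h.measurable q.1) (h.measurable q₀.1) (h.toMeasure_map m q.1)
        (h.toMeasure_map m q₀.1))
    rwa [P2.cost_map (h.measurable q.1) (h.measurable q₀.1)] at h1
  have hc : Continuous fun q : ℝ × Euc n => K * (‖X q.1 q.2 - X q₀.1 q₀.2‖ +
        (∫ x, ‖X q.1 x - X q₀.1 x‖ ∂m.toMeasure) + ‖Z q.1 q.2 - Z q₀.1 q₀.2‖) :=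
    continuous_const.mul ((((h.cont.sub continuous_const).norm).add
      ((h.continuous_mean_dist m q₀.1).comp continuous_fst)).add (hZ.sub continuous_const).norm)
  rw [ContinuousAt, tendsto_iff_norm_sub_tendsto_zero]
  refine squeeze_zero (fun _ => norm_nonneg _) hb ?_
  have := hc.tendsto q₀
  simpa using this

theorem exists_norm_field_le {K : ℝ} {F : Euc n → P2 n → Euc n → Euc n} (hF : LipField K F)
    (Z : ℝ → Euc n → Euc n) (m : P2 n) : ∃ c, 0 ≤ c ∧ ∀ u x,
      ‖F (X u x) (m.map (X u)) (Z u x)‖ ≤ c * (1 + ‖x‖) := by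
  obtain ⟨c, hc⟩ := h.growth
  obtain ⟨c', hc'⟩ := h.exists_norm1_map_le m
  have h0 : 0 ≤ c := by
    have := (norm_nonneg _).trans (hc 0 0)
    simpa using this
  have h0' : 0 ≤ c' := (P2.norm1_nonneg _).trans (hc' 0)
  have hK := hF.nonneg
  refine ⟨K * (1 + c + c'), by positivity, fun u x => (hF.growth _ _ _).trans ?_⟩
  rw [mul_assoc]
  refine mul_le_mul_of_nonneg_left ?_ hF.nonneg
  nlinarith [hc u x, hc' u, norm_nonneg x, mul_nonneg h0' (norm_nonneg x)]

end IsRegularFlow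

variable {F B : Euc n → P2 n → Euc n → Euc n} {p : Euc n → P2 n → Euc n} {K Λ s T : ℝ}

/-- The projection of a time to `[s,T]`. -/
noncomputable def clampTime (s T τ : ℝ) : ℝ := max s (min T τ)

theorem clampTime_mem (hsT : s ≤ T) (τ : ℝ) : clampTime s T τ ∈ Icc s T :=
  ⟨le_max_left _ _, max_le hsT (min_le_left _ _)⟩

theorem clampTime_of_mem {τ : ℝ} (hτ : τ ∈ Icc s T) : clampTime s T τ = τ := by
  rw [clampTime, min_eq_right hτ.2, max_eq_right hτ.1]

theorem continuous_clampTime : Continuous (clampTime s T) :=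
  continuous_const.max (continuous_const.min continuous_id)

/-- The forward component of the Picard map. -/
noncomputable def picardFwd (F : Euc n → P2 n → Euc n → Euc n) (s T : ℝ) (m : P2 n)
    (X Z : ℝ → Euc n → Euc n) (τ : ℝ) (x : Euc n) : Euc n :=
  x + ∫ u in s..clampTime s T τ, F (X u x) (m.map (X u)) (Z u x)

/-- The backward component of the Picard map. -/
noncomputable def picardBwd (F B : Euc n → P2 n → Euc n → Euc n) (p : Euc n → P2 n → Euc n)
    (s T : ℝ) (m : P2 n) (X Z : ℝ → Euc n → Euc n) (τ : ℝ) (x : Euc n) : Euc n :=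
  p (picardFwd F s T m X Z T x) (m.map (picardFwd F s T m X Z T)) +
    ∫ u in clampTime s T τ..T, B (X u x) (m.map (X u)) (Z u x)

theorem norm_integral_clamp_le {u : ℝ → Euc n} {c : ℝ} (hc : ∀ t, ‖u t‖ ≤ c)
    {a b : ℝ} (ha : a ∈ Icc s T) (hb : b ∈ Icc s T) : ‖∫ t in a..b, u t‖ ≤ (T - s) * c := by
  refine (intervalIntegral.norm_integral_le_of_norm_le_const fun t _ => hc t).trans ?_
  rw [mul_comm]
  refine mul_le_mul_of_nonneg_right ?_ ((norm_nonneg _).trans (hc s))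
  rw [abs_le]
  constructor <;> linarith [ha.1, ha.2, hb.1, hb.2]

variable {X Z : ℝ → Euc n → Euc n}

theorem isRegularFlow_picardFwd (hF : LipField K F) (hsT : s ≤ T) (m : P2 n)
    (hX : IsRegularFlow X) (hZ : Continuous fun q : ℝ × Euc n => Z q.1 q.2) :
    IsRegularFlow (picardFwd F s T m X Z) := by
  constructor
  · have h1 := hX.continuous_field hF hZ m
    have h2 : Continuous fun q : ℝ × Euc n =>
        ∫ u in s..clampTime s T q.1, F (X u q.2) (m.map (X u)) (Z u q.2) :=
      intervalIntegral.continuous_parametric_intervalIntegral_of_continuous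
        (f := fun (q : ℝ × Euc n) u => F (X u q.2) (m.map (X u)) (Z u q.2))
        (h1.comp (continuous_snd.prodMk (continuous_snd.comp continuous_fst)))
        (continuous_clampTime.comp continuous_fst)
    exact continuous_snd.add h2
  · obtain ⟨c, -, hc⟩ := hX.exists_norm_field_le hF Z m
    refine ⟨1 + (T - s) * c, fun τ x => ?_⟩
    have h1 := norm_integral_clamp_le (fun t => hc t x) (left_mem_Icc.2 hsT)
      (clampTime_mem hsT τ)
    refine (norm_add_le _ _).trans ?_
    linarith

theorem continuous_picardBwd (D : SystemBounds F B p K Λ) (hsT : s ≤ T) (m : P2 n)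
    (hX : IsRegularFlow X) (hZ : Continuous fun q : ℝ × Euc n => Z q.1 q.2) :
    Continuous fun q : ℝ × Euc n => picardBwd F B p s T m X Z q.1 q.2 := by
  have hY := isRegularFlow_picardFwd D.F_lip hsT m hX hZ
  have h1 := hX.continuous_field D.B_lip hZ m
  have h2 : Continuous fun q : ℝ × Euc n =>
      ∫ u in T..clampTime s T q.1, B (X u q.2) (m.map (X u)) (Z u q.2) :=
    intervalIntegral.continuous_parametric_intervalIntegral_of_continuous
      (f := fun (q : ℝ × Euc n) u => B (X u q.2) (m.map (X u)) (Z u q.2))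
      (h1.comp (continuous_snd.prodMk (continuous_snd.comp continuous_fst)))
      (continuous_clampTime.comp continuous_fst)
  have hp : ∀ ν : P2 n, Continuous fun x => p x ν := fun ν => by
    refine (LipschitzWith.of_dist_le_mul (K := ⟨Λ, D.Λ_pos.le⟩) fun x y => ?_).continuous
    have := D.p_lip x y ν ν _ ν.isCoupling_self
    rwa [P2.cost_self, add_zero, ← dist_eq_norm, ← dist_eq_norm] at this
  have h3 : Continuous fun q : ℝ × Euc n => picardFwd F s T m X Z T q.2 :=
    hY.cont.comp (continuous_const.prodMk continuous_snd)
  refine (((hp (m.map (picardFwd F s T m X Z T))).comp h3).sub h2).congr fun q => ?_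
  rw [picardBwd, intervalIntegral.integral_symm T, ← sub_eq_add_neg]
  rfl

theorem exists_norm_picardBwd_le (D : SystemBounds F B p K Λ) (hsT : s ≤ T) (m : P2 n)
    (hX : IsRegularFlow X) (hZ : Continuous fun q : ℝ × Euc n => Z q.1 q.2) :
    ∃ c, ∀ τ x, ‖picardBwd F B p s T m X Z τ x‖ ≤ c * (1 + ‖x‖) := by
  have hY := isRegularFlow_picardFwd D.F_lip hsT m hX hZ
  obtain ⟨c, -, hc⟩ := hX.exists_norm_field_le D.B_lip Z m
  obtain ⟨c₁, hc₁⟩ := hY.growth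
  obtain ⟨c₂, hc₂⟩ := hY.exists_norm1_map_le m
  have h0 : 0 ≤ c₂ := (P2.norm1_nonneg _).trans (hc₂ 0)
  refine ⟨Λ * (1 + c₁ + c₂) + (T - s) * c, fun τ x => (norm_add_le _ _).trans ?_⟩
  have h1 := norm_integral_clamp_le (fun t => hc t x) (clampTime_mem hsT τ)
    (right_mem_Icc.2 hsT)
  have h2 := D.p_growth (picardFwd F s T m X Z T x) (m.map (picardFwd F s T m X Z T))
  have h3 : Λ * (1 + ‖picardFwd F s T m X Z T x‖ + (m.map (picardFwd F s T m X Z T)).norm1) ≤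
      Λ * ((1 + c₁ + c₂) * (1 + ‖x‖)) := by
    refine mul_le_mul_of_nonneg_left ?_ D.Λ_pos.le
    nlinarith [hc₁ T x, hc₂ T, norm_nonneg x, mul_nonneg h0 (norm_nonneg x)]
  linarith

theorem isPicardStep_picard (D : SystemBounds F B p K Λ) (hsT : s ≤ T) (m : P2 n)
    (hX : IsRegularFlow X) (hZ : Continuous fun q : ℝ × Euc n => Z q.1 q.2) :
    IsPicardStep F B p s T m.toMeasure (fun x => x) X Z (fun u => m.map (X u))
      (picardFwd F s T m X Z) (picardBwd F B p s T m X Z)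
      (m.map (picardFwd F s T m X Z T)) := by
  have hY := isRegularFlow_picardFwd D.F_lip hsT m hX hZ
  have hc : ∀ x : Euc n, Continuous fun u : ℝ => (u, x) := fun x =>
    continuous_id.prodMk continuous_const
  exact {
    measurable := fun u _ => hX.measurable u
    law := fun u _ => hX.toMeasure_map m u
    contF := fun x => ((hX.continuous_field D.F_lip hZ m).comp (hc x)).continuousOn
    contB := fun x => ((hX.continuous_field D.B_lip hZ m).comp (hc x)).continuousOn
    measurable_end := hY.measurable T
    law_end := hY.toMeasure_map m T
    fwd := fun x τ hτ => by rw [picardFwd, clampTime_of_mem hτ]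
    bwd := fun x τ hτ => by rw [picardBwd, clampTime_of_mem hτ] }

open scoped BoundedContinuousFunction in
/-- Short-time existence for the forward-backward system started from the law `m`. -/
theorem exists_isSystemSolution (D : SystemBounds F B p K Λ) (hsT : s ≤ T)
    (hsmall : (T - s) * (K * (4 + 12 * Λ)) ≤ 1 / 2) (m : P2 n) :
    ∃ X Z : ℝ → Euc n → Euc n, IsRegularFlow X ∧
      (Continuous fun q : ℝ × Euc n => Z q.1 q.2) ∧
      IsSystemSolution F B p s T m.toMeasure (fun x => x) X Z fun u => m.map (X u) := by
  -- The unknowns are `(X - x) / w` and `Z / w`, bounded continuous functions on a complete space.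
  -- Their sup distance times `w` is exactly a weight in the sense of `IsWeight`.
  let w : Euc n → ℝ := fun x => 1 + ‖x‖ + m.norm1
  have hw : ∀ x, 0 < w x := fun x => weight_pos x m
  have hwc : Continuous w := by fun_prop
  have hwi : Continuous fun q : ℝ × Euc n => (w q.2)⁻¹ :=
    (hwc.comp continuous_snd).inv₀ fun q => (hw q.2).ne'
  have hw1 : ∀ x, 1 + ‖x‖ ≤ w x := fun x => by simpa [w] using m.norm1_nonneg
  have hw2 : ∀ x, w x ≤ (1 + m.norm1) * (1 + ‖x‖) := fun x => by
    simp only [w]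
    nlinarith [m.norm1_nonneg, norm_nonneg x, mul_nonneg m.norm1_nonneg (norm_nonneg x)]
  let X : ((ℝ × Euc n) →ᵇ (Euc n × Euc n)) → ℝ → Euc n → Euc n :=
    fun φ u x => x + w x • (φ (u, x)).1
  let Z : ((ℝ × Euc n) →ᵇ (Euc n × Euc n)) → ℝ → Euc n → Euc n :=
    fun φ u x => w x • (φ (u, x)).2
  have hX : ∀ φ, IsRegularFlow (X φ) := fun φ => by
    refine ⟨continuous_snd.add ((hwc.comp continuous_snd).smul (continuous_fst.comp φ.continuous)),
      1 + (1 + m.norm1) * ‖φ‖, fun u x => (norm_add_le _ _).trans ?_⟩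
    rw [norm_smul, Real.norm_of_nonneg (hw x).le]
    have h1 : w x * ‖(φ (u, x)).1‖ ≤ (1 + m.norm1) * (1 + ‖x‖) * ‖φ‖ :=
      mul_le_mul (hw2 x) ((norm_fst_le _).trans (φ.norm_coe_le_norm _)) (norm_nonneg _)
        ((hw x).le.trans (hw2 x))
    linarith
  have hZ : ∀ φ, Continuous fun q : ℝ × Euc n => Z φ q.1 q.2 := fun φ =>
    (hwc.comp continuous_snd).smul (continuous_snd.comp φ.continuous)
  have hΓ : ∀ φ, ∃ ψ : (ℝ × Euc n) →ᵇ (Euc n × Euc n), ∀ q, ψ q =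
      ((w q.2)⁻¹ • (picardFwd F s T m (X φ) (Z φ) q.1 q.2 - q.2),
        (w q.2)⁻¹ • picardBwd F B p s T m (X φ) (Z φ) q.1 q.2) := fun φ => by
    have hY := isRegularFlow_picardFwd D.F_lip hsT m (hX φ) (hZ φ)
    have hV := continuous_picardBwd D hsT m (hX φ) (hZ φ)
    obtain ⟨c₁, hc₁⟩ := hY.growth
    obtain ⟨c₂, hc₂⟩ := exists_norm_picardBwd_le D hsT m (hX φ) (hZ φ)
    have hsc : ∀ (c : ℝ) (x v : Euc n), ‖v‖ ≤ c * (1 + ‖x‖) → ‖(w x)⁻¹ • v‖ ≤ c := by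
      intro c x v hv
      have h0 : 0 ≤ c := nonneg_of_mul_nonneg_left ((norm_nonneg v).trans hv) (by positivity)
      rw [norm_smul, norm_inv, Real.norm_of_nonneg (hw x).le, inv_mul_le_iff₀ (hw x), mul_comm]
      exact hv.trans (mul_le_mul_of_nonneg_left (hw1 x) h0)
    refine ⟨BoundedContinuousFunction.ofNormedAddCommGroup _
      ((hwi.smul (hY.cont.sub continuous_snd)).prodMk (hwi.smul hV)) (max (c₁ + 1) c₂)
      fun q => ?_, fun q => rfl⟩
    refine max_le_max (hsc _ _ _ ?_) (hsc _ _ _ (hc₂ q.1 q.2))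
    refine (norm_sub_le (picardFwd F s T m (X φ) (Z φ) q.1 q.2) q.2).trans ?_
    linarith [hc₁ q.1 q.2]
  choose Γ hΓ using hΓ
  have hcontr : ContractingWith (1 / 2) Γ := by
    refine ⟨by rw [← NNReal.coe_lt_coe]; norm_num, LipschitzWith.of_dist_le_mul fun φ φ' => ?_⟩
    -- Both iterates start at the identity, so only the term with half of the weight survives.
    have hstep := (isPicardStep_picard D hsT m (hX φ) (hZ φ)).norm_sub_le D hsT hsmall
      (isPicardStep_picard D hsT m (hX φ') (hZ φ')) (by simp)
      ((isWeight_one_add_norm m).const_mul (dist_nonneg (x := φ) (y := φ')))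
      (fun u _ x => by
        simp only [X]
        rw [add_sub_add_left_eq_sub, ← smul_sub, norm_smul, Real.norm_of_nonneg (hw x).le, mul_comm]
        refine mul_le_mul_of_nonneg_right (le_trans ?_ (φ.dist_coe_le_dist (g := φ') (u, x)))
          (hw x).le
        rw [dist_eq_norm]; exact norm_fst_le (φ (u, x) - φ' (u, x)))
      (fun u _ x => by
        simp only [Z]
        rw [← smul_sub, norm_smul, Real.norm_of_nonneg (hw x).le, mul_comm]
        refine mul_le_mul_of_nonneg_right (le_trans ?_ (φ.dist_coe_le_dist (g := φ') (u, x)))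
          (hw x).le
        rw [dist_eq_norm]; exact norm_snd_le (φ (u, x) - φ' (u, x)))
    simp only [sub_self, norm_zero, integral_zero, add_zero, mul_zero, zero_add] at hstep
    refine (BoundedContinuousFunction.dist_le (by positivity)).2 fun q => ?_
    -- The Picard map sees time only through `clampTime`, so the estimate on `[s,T]` covers all real
    -- times.
    obtain ⟨h1, h2⟩ := hstep (clampTime s T q.1) (clampTime_mem hsT q.1) q.2
    have hcc : clampTime s T (clampTime s T q.1) = clampTime s T q.1 :=
      clampTime_of_mem (clampTime_mem hsT q.1)
    have hsc : ∀ v : Euc n, ‖v‖ ≤ 1 / 2 * (dist φ φ' * w q.2) →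
        ‖(w q.2)⁻¹ • v‖ ≤ 1 / 2 * dist φ φ' := fun v hv => by
      rw [norm_smul, norm_inv, Real.norm_of_nonneg (hw q.2).le, inv_mul_le_iff₀ (hw q.2)]
      linarith
    rw [hΓ, hΓ, dist_eq_norm]
    simp only [picardFwd, picardBwd, hcc] at h1 h2
    refine max_le ?_ ?_
    · simp only [Prod.fst_sub, ← smul_sub, sub_sub_sub_cancel_right]
      exact hsc _ h1
    · simp only [Prod.snd_sub, ← smul_sub]
      exact hsc _ h2
  obtain ⟨φ, hφ⟩ : ∃ φ, Γ φ = φ := ⟨_, hcontr.fixedPoint_isFixedPt⟩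
  have hfix : ∀ q, φ q = ((w q.2)⁻¹ • (picardFwd F s T m (X φ) (Z φ) q.1 q.2 - q.2),
        (w q.2)⁻¹ • picardBwd F B p s T m (X φ) (Z φ) q.1 q.2) := fun q => by
    rw [← hΓ, hφ]
  have hXY : X φ = picardFwd F s T m (X φ) (Z φ) := by
    funext u x
    change x + w x • (φ (u, x)).1 = _
    rw [hfix (u, x), smul_inv_smul₀ (hw x).ne', add_sub_cancel]
  have hZV : Z φ = picardBwd F B p s T m (X φ) (Z φ) := by
    funext u x
    change w x • (φ (u, x)).2 = _
    rw [hfix (u, x), smul_inv_smul₀ (hw x).ne']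
  refine ⟨X φ, Z φ, hX φ, hZ φ, ?_, ?_⟩
  · have h1 := isPicardStep_picard D hsT m (hX φ) (hZ φ)
    rwa [← hXY, ← hZV] at h1
  · obtain ⟨c₁, hc₁⟩ := (hX φ).growth
    obtain ⟨c₂, hc₂⟩ := exists_norm_picardBwd_le D hsT m (hX φ) (hZ φ)
    rw [← hZV] at hc₂
    refine ⟨fun x => max c₁ c₂ * (1 + ‖x‖),
      ((integrable_const _).add m.integrable_norm).const_mul _, fun u _ x =>
        ⟨(hc₁ u x).trans ?_, (hc₂ u x).trans ?_⟩⟩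
    · exact mul_le_mul_of_nonneg_right (le_max_left _ _) (by positivity)
    · exact mul_le_mul_of_nonneg_right (le_max_right _ _) (by positivity)

end Existence

/-! ### Flows driven by a field -/

section FieldFlow

variable {n : ℕ}

/-- The joint law of the flow at two times bounds `W2` by an `L²` distance, which tends to zero by
dominated convergence thanks to the linear growth. -/
theorem IsRegularFlow.continuous_law {X : ℝ → Euc n → Euc n} (h : IsRegularFlow X) (m : P2 n) :
    Continuous fun u => m.map (X u) := by
  obtain ⟨c, hc⟩ := h.growth
  rw [continuous_iff_continuousAt]
  intro u₀
  have h1 : Continuous fun u => Real.sqrt (∫ x, ‖X u x - X u₀ x‖ ^ 2 ∂m.toMeasure) := by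
    refine Real.continuous_sqrt.comp (continuous_of_dominated
      (bound := fun x => 8 * c ^ 2 * (1 + ‖x‖ ^ 2)) (fun u =>
      (((h.measurable u).sub (h.measurable u₀)).norm.pow_const 2).aestronglyMeasurable) (fun u =>
      Eventually.of_forall fun x => ?_)
      (((integrable_const _).add
        ((memLp_two_iff_integrable_sq_norm aestronglyMeasurable_id).1 m.memLp)).const_mul _)
      (Eventually.of_forall fun x => ?_))
    · rw [norm_pow, norm_norm]
      have h2 : ‖X u x - X u₀ x‖ ≤ 2 * c * (1 + ‖x‖) := by
        linarith [norm_sub_le (X u x) (X u₀ x), hc u x, hc u₀ x]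
      calc _ ≤ (2 * c * (1 + ‖x‖)) ^ 2 := pow_le_pow_left₀ (norm_nonneg _) h2 2
        _ ≤ _ := by nlinarith [mul_nonneg (sq_nonneg c) (sq_nonneg (1 - ‖x‖))]
    · exact ((h.cont.comp (continuous_id.prodMk continuous_const)).sub continuous_const).norm.pow 2
  intro U hU
  obtain ⟨ε, hε, hb⟩ := P2.mem_nhds_of_W2_lt hU
  have h2 := (h1.tendsto u₀).eventually_lt_const (u := ε) (by simpa using hε)
  rw [mem_map]
  filter_upwards [h2] with u hu
  refine hb _ (lt_of_le_of_lt ?_ hu)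
  refine (P2.W2_le_of_map (h.measurable u₀) (h.measurable u) (h.toMeasure_map m u₀)
    (h.toMeasure_map m u)).trans (le_of_eq ?_)
  simp_rw [norm_sub_rev]

theorem LipField.continuous {K : ℝ} {F : Euc n → P2 n → Euc n → Euc n} (hF : LipField K F) :
    Continuous fun q : Euc n × P2 n × Euc n => F q.1 q.2.1 q.2.2 := by
  have h := P2.continuous_of_coupling_lipschitz (Φ := fun (a : Euc n × Euc n) μ => F a.1 μ a.2)
    (c := K) (fun a μ ν π hπ => by simpa using hF.lip a.1 a.1 μ ν a.2 a.2 π hπ) fun μ => by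
      rw [continuous_iff_continuousAt]
      intro a₀
      rw [ContinuousAt, tendsto_iff_norm_sub_tendsto_zero]
      refine squeeze_zero (fun _ => norm_nonneg _) (fun a => ?_)
        (g := fun a : Euc n × Euc n => K * (‖a.1 - a₀.1‖ + 0 + ‖a.2 - a₀.2‖)) ?_
      · have := hF.lip a.1 a₀.1 μ μ a.2 a₀.2 _ μ.isCoupling_self
        rwa [P2.cost_self] at this
      · have : Continuous fun a : Euc n × Euc n => K * (‖a.1 - a₀.1‖ + 0 + ‖a.2 - a₀.2‖) := by
          fun_prop
        simpa using this.tendsto a₀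
  exact h.comp ((continuous_fst.prodMk (continuous_snd.comp continuous_snd)).prodMk
    (continuous_fst.comp continuous_snd))

/-- `Y` is a flow on `[s,T]` with velocity `F(x, μ, γ(u,x,μ))` started from the law `m`. -/
structure IsFieldFlow (F : Euc n → P2 n → Euc n → Euc n) (γ : ℝ → Euc n → P2 n → Euc n) (T s : ℝ)
    (m : P2 n) (Y : ℝ → Euc n → Euc n) : Prop where
  measurable : ∀ τ ∈ Icc s T, Measurable (Y τ)
  memLp : ∀ τ ∈ Icc s T, MemLp (Y τ) 2 m.toMeasure
  cont_path : ∀ x, ContinuousOn (fun τ => Y τ x) (Icc s T)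
  cont_law : ContinuousOn (fun τ => m.map (Y τ)) (Icc s T)
  equation : ∀ x, ∀ τ ∈ Icc s T, Y τ x = x + ∫ u in s..τ,
    F (Y u x) (m.map (Y u)) (γ u (Y u x) (m.map (Y u)))

namespace IsFieldFlow

variable {F B : Euc n → P2 n → Euc n → Euc n} {K s t T : ℝ} {γ : ℝ → Euc n → P2 n → Euc n}
  {m : P2 n} {Y : ℝ → Euc n → Euc n}

theorem toMeasure_map (h : IsFieldFlow F γ T s m Y) {u : ℝ} (hu : u ∈ Icc s T) :
    (m.map (Y u)).toMeasure = m.toMeasure.map (Y u) :=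
  m.toMeasure_map (h.measurable u hu) (h.memLp u hu)

theorem norm_integral_field_le (hF : LipField K F) {x : Euc n} {c a b : ℝ} (hab : a ≤ b)
    (hc : ∀ u ∈ Icc a b, 1 + ‖Y u x‖ + (m.map (Y u)).norm1 ≤ c) {z : ℝ → Euc n} :
    ‖∫ u in a..b, F (Y u x) (m.map (Y u)) (z u)‖ ≤ (b - a) * (K * c) := by
  refine (intervalIntegral.norm_integral_le_of_norm_le_const (C := K * c) fun u hu => ?_).trans ?_
  · rw [uIoc_of_le hab] at hu
    exact (hF.growth _ _ _).trans (mul_le_mul_of_nonneg_left (hc u ⟨hu.1.le, hu.2⟩) hF.nonneg)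
  · rw [abs_of_nonneg (sub_nonneg.2 hab), mul_comm]

theorem norm1_map_le (h : IsFieldFlow F γ T s m Y) {c : ℝ} (hc : 0 ≤ c) {u : ℝ}
    (hu : u ∈ Icc s T) (hb : ∀ x, ‖Y u x - x‖ ≤ c * (1 + ‖x‖ + m.norm1)) (x : Euc n) :
    (m.map (Y u)).norm1 ≤ m.norm1 + 2 * (c * (1 + ‖x‖ + m.norm1)) := by
  have h1 := (P2.isCoupling_map (h.measurable u hu) measurable_id (h.toMeasure_map hu)
    (Measure.map_id (μ := m.toMeasure)).symm).norm1_le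
  rw [P2.cost_map (h.measurable u hu) measurable_id] at h1
  exact h1.trans (add_le_add_right
    (((isWeight_one_add_norm m).const_mul hc).integral_norm_le hb x) _)

theorem weight_le (h : IsFieldFlow F γ T s m Y) {c : ℝ} (hc : 0 ≤ c) {u : ℝ} (hu : u ∈ Icc s T)
    (hb : ∀ x, ‖Y u x - x‖ ≤ c * (1 + ‖x‖ + m.norm1)) (x : Euc n) :
    1 + ‖Y u x‖ + (m.map (Y u)).norm1 ≤ (1 + 3 * c) * (1 + ‖x‖ + m.norm1) := by
  have h2 := norm_add_le (Y u x - x) x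
  rw [sub_add_cancel] at h2
  linarith [h.norm1_map_le hc hu hb x, hb x]

/-- A qualitative bound, whose constant depends on the flow through its largest first moment. At the
time where the path is largest, the growth of the velocity is absorbed because of the factor 1/8.
The bound serves as the start of an iteration that removes this dependence. -/
theorem exists_norm_sub_le (hF : LipField K F) (hsT : s ≤ T) (hsmall : (T - s) * K ≤ 1 / 8)
    (h : IsFieldFlow F γ T s m Y) :
    ∃ c, 0 ≤ c ∧ ∀ u ∈ Icc s T, ∀ x, ‖Y u x - x‖ ≤ c * (1 + ‖x‖ + m.norm1) := by
  have hne : (Icc s T).Nonempty := nonempty_Icc.2 hsT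
  obtain ⟨u₀, -, hu₀⟩ := isCompact_Icc.exists_isMaxOn hne
    (P2.continuous_norm1.comp_continuousOn h.cont_law)
  set R := (m.map (Y u₀)).norm1
  have hR : ∀ u ∈ Icc s T, (m.map (Y u)).norm1 ≤ R := fun u hu => hu₀ hu
  have hR0 : 0 ≤ R := P2.norm1_nonneg _
  refine ⟨3 + R, by positivity, fun u hu x => ?_⟩
  obtain ⟨u₁, hu₁, hmax⟩ := isCompact_Icc.exists_isMaxOn hne (h.cont_path x).norm
  have hS : ∀ u ∈ Icc s T, ‖Y u x‖ ≤ ‖Y u₁ x‖ := fun u hu => hmax hu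
  have h1 : ‖Y u₁ x‖ ≤ ‖x‖ + (u₁ - s) * (K * (1 + ‖Y u₁ x‖ + R)) := by
    conv_lhs => rw [h.equation x u₁ hu₁]
    refine (norm_add_le _ _).trans (add_le_add_right (norm_integral_field_le hF hu₁.1
      fun u hu => ?_) _)
    have hu' : u ∈ Icc s T := ⟨hu.1, hu.2.trans hu₁.2⟩
    linarith [hS u hu', hR u hu']
  have h2 : (u₁ - s) * (K * (1 + ‖Y u₁ x‖ + R)) ≤ 1 / 8 * (1 + ‖Y u₁ x‖ + R) := by
    rw [← mul_assoc]
    refine mul_le_mul_of_nonneg_right (le_trans ?_ hsmall) (by positivity)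
    exact mul_le_mul_of_nonneg_right (by linarith [hu₁.2]) hF.nonneg
  have h3 := norm_sub_le (Y u x) x
  nlinarith [hS u hu, norm_nonneg x, m.norm1_nonneg, mul_nonneg hR0 (norm_nonneg x),
    mul_nonneg hR0 m.norm1_nonneg]

/-- A priori bound for flows driven by a field. -/
theorem norm_sub_initial_le (hF : LipField K F) (hsT : s ≤ T) (hsmall : (T - s) * K ≤ 1 / 8)
    (h : IsFieldFlow F γ T s m Y) (u : ℝ) (hu : u ∈ Icc s T) (x : Euc n) :
    ‖Y u x - x‖ ≤ 1 * (1 + ‖x‖ + m.norm1) := by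
  obtain ⟨c, hc, hb⟩ := h.exists_norm_sub_le hF hsT hsmall
  -- A bound `c` improves to `(1 + 3 * c) / 8`; for `c = 1 + q` this is `1 / 2 + 3 * q / 8`, below
  -- `1 + q / 2`.
  have key : ∀ j : ℕ, ∀ u ∈ Icc s T, ∀ x,
      ‖Y u x - x‖ ≤ (1 + (1 / 2) ^ j * c) * (1 + ‖x‖ + m.norm1) := by
    intro j
    induction j with
    | zero =>
      intro u hu x
      refine (hb u hu x).trans (mul_le_mul_of_nonneg_right ?_ (weight_pos x m).le)
      simp
    | succ j ih =>
      intro u hu x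
      have hj : 0 ≤ (1 / 2) ^ j * c := by positivity
      rw [h.equation x u hu, add_sub_cancel_left]
      refine (norm_integral_field_le hF hu.1 fun v hv => h.weight_le (by positivity)
        ⟨hv.1, hv.2.trans hu.2⟩ (ih v ⟨hv.1, hv.2.trans hu.2⟩) x).trans ?_
      rw [← mul_assoc, ← mul_assoc]
      refine mul_le_mul_of_nonneg_right ?_ (weight_pos x m).le
      have h1 : (u - s) * K ≤ 1 / 8 :=
        (mul_le_mul_of_nonneg_right (by linarith [hu.2]) hF.nonneg).trans hsmall
      have h2 := mul_le_mul_of_nonneg_right h1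
        (by positivity : 0 ≤ 1 + 3 * (1 + (1 / 2) ^ j * c))
      have e : (1 / 2 : ℝ) ^ (j + 1) * c = 1 / 2 * ((1 / 2) ^ j * c) := by ring
      rw [e]
      linarith
  have hlim : Tendsto (fun j : ℕ => (1 + (1 / 2) ^ j * c) * (1 + ‖x‖ + m.norm1)) atTop
      (𝓝 (1 * (1 + ‖x‖ + m.norm1))) := by
    have := (((tendsto_pow_atTop_nhds_zero_of_lt_one (r := (1 / 2 : ℝ)) (by norm_num)
      (by norm_num)).mul_const c).const_add 1).mul_const (1 + ‖x‖ + m.norm1)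
    simpa using this
  exact ge_of_tendsto' hlim fun j => key j u hu x

theorem weight_le_four (hF : LipField K F) (hsT : s ≤ T) (hsmall : (T - s) * K ≤ 1 / 8)
    (h : IsFieldFlow F γ T s m Y) {u : ℝ} (hu : u ∈ Icc s T) (x : Euc n) :
    1 + ‖Y u x‖ + (m.map (Y u)).norm1 ≤ 4 * (1 + ‖x‖ + m.norm1) := by
  have := h.weight_le zero_le_one hu (h.norm_sub_initial_le hF hsT hsmall u hu) x
  linarith

theorem norm_sub_initial_le_time (hF : LipField K F) (hsT : s ≤ T)
    (hsmall : (T - s) * K ≤ 1 / 8) (h : IsFieldFlow F γ T s m Y) {u : ℝ} (hu : u ∈ Icc s T)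
    (x : Euc n) : ‖Y u x - x‖ ≤ 4 * K * (u - s) * (1 + ‖x‖ + m.norm1) := by
  rw [h.equation x u hu, add_sub_cancel_left]
  refine (norm_integral_field_le hF hu.1 fun v hv =>
    h.weight_le_four hF hsT hsmall ⟨hv.1, hv.2.trans hu.2⟩ x).trans (le_of_eq ?_)
  ring

theorem continuousOn_field (hF : LipField K F) (hγ : FieldContinuous t T γ) (hs : t ≤ s)
    (h : IsFieldFlow B γ T s m Y) (x : Euc n) :
    ContinuousOn (fun u => F (Y u x) (m.map (Y u)) (γ u (Y u x) (m.map (Y u)))) (Icc s T) := by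
  have h1 : ContinuousOn (fun u => γ u (Y u x) (m.map (Y u))) (Icc s T) :=
    hγ.comp (f := fun u => (u, Y u x, m.map (Y u)))
      (continuousOn_id.prodMk ((h.cont_path x).prodMk h.cont_law))
      fun u hu => ⟨Icc_subset_Icc_left hs hu, mem_univ _⟩
  exact hF.continuous.comp_continuousOn ((h.cont_path x).prodMk (h.cont_law.prodMk h1))

end IsFieldFlow

end FieldFlow

/-! ### The decoupling field of a family of solutions -/

section Family

variable {n : ℕ}

/-- A field on `[t,s]` that is Lipschitz in the state and in the law, and Lipschitz in time with a
weight, is jointly continuous. -/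
theorem continuousOn_of_lipschitz {t s c c' : ℝ} {Φ : ℝ → P2 n → Euc n → Euc n}
    (h₁ : ∀ r ∈ Icc t s, ∀ m m' x x' π, P2.IsCoupling m m' π →
      ‖Φ r m x - Φ r m' x'‖ ≤ c * (‖x - x'‖ + P2.cost π))
    (h₂ : ∀ r ∈ Icc t s, ∀ r' ∈ Icc t s, r ≤ r' → ∀ m x,
      ‖Φ r m x - Φ r' m x‖ ≤ c' * (r' - r) * (1 + ‖x‖ + m.norm1)) :
    ContinuousOn (fun q : ℝ × P2 n × Euc n => Φ q.1 q.2.1 q.2.2) (Icc t s ×ˢ univ) := by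
  have h := P2.continuous_of_coupling_lipschitz
    (Φ := fun (a : Icc t s × Euc n) m => Φ a.1 m a.2) (c := c)
    (fun a μ ν π hπ => by simpa using h₁ a.1 a.1.2 μ ν a.2 a.2 π hπ) fun m => by
      rw [continuous_iff_continuousAt]
      intro a₀
      rw [ContinuousAt, tendsto_iff_norm_sub_tendsto_zero]
      refine squeeze_zero (fun _ => norm_nonneg _) (fun a => ?_)
        (g := fun a : Icc t s × Euc n => c * ‖a.2 - a₀.2‖ +
          c' * |(a.1 : ℝ) - a₀.1| * (1 + ‖a₀.2‖ + m.norm1)) ?_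
      · have e1 := h₁ a.1 a.1.2 m m a.2 a₀.2 _ m.isCoupling_self
        rw [P2.cost_self, add_zero] at e1
        have e2 : ‖Φ a.1 m a₀.2 - Φ a₀.1 m a₀.2‖ ≤
            c' * |(a.1 : ℝ) - a₀.1| * (1 + ‖a₀.2‖ + m.norm1) := by
          rcases le_total (a.1 : ℝ) a₀.1 with hle | hle
          · rw [abs_of_nonpos (sub_nonpos.2 hle), neg_sub]
            exact h₂ _ a.1.2 _ a₀.1.2 hle m a₀.2
          · rw [abs_of_nonneg (sub_nonneg.2 hle), norm_sub_rev]
            exact h₂ _ a₀.1.2 _ a.1.2 hle m a₀.2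
        have e3 := norm_add_le (Φ a.1 m a.2 - Φ a.1 m a₀.2) (Φ a.1 m a₀.2 - Φ a₀.1 m a₀.2)
        rw [sub_add_sub_cancel] at e3
        linarith
      · have : Continuous fun a : Icc t s × Euc n => c * ‖a.2 - a₀.2‖ +
            c' * |(a.1 : ℝ) - a₀.1| * (1 + ‖a₀.2‖ + m.norm1) := by fun_prop
        simpa using this.tendsto a₀
  rw [continuousOn_iff_continuous_domRestrict]
  have hφ : Continuous fun q : (Icc t s ×ˢ univ : Set (ℝ × P2 n × Euc n)) =>
      (((⟨q.1.1, q.2.1⟩, q.1.2.2), q.1.2.1) : (Icc t s × Euc n) × P2 n) := by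
    refine Continuous.prodMk (Continuous.prodMk (Continuous.subtype_mk ?_ _) ?_) ?_
    · exact continuous_fst.comp continuous_subtype_val
    · exact continuous_snd.comp (continuous_snd.comp continuous_subtype_val)
    · exact continuous_fst.comp (continuous_snd.comp continuous_subtype_val)
  exact h.comp hφ

/-- A family of solutions of the forward-backward system, one for each initial time and law. -/
structure IsSolutionFamily (F B : Euc n → P2 n → Euc n → Euc n) (p : Euc n → P2 n → Euc n)
    (t T : ℝ) (X Z : ℝ → P2 n → ℝ → Euc n → Euc n) : Prop where
  regular : ∀ s ∈ Icc t T, ∀ m, IsRegularFlow (X s m)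
  cont : ∀ s ∈ Icc t T, ∀ m, Continuous fun q : ℝ × Euc n => Z s m q.1 q.2
  sol : ∀ s ∈ Icc t T, ∀ m, IsSystemSolution F B p s T m.toMeasure (fun x => x) (X s m) (Z s m)
    fun u => m.map (X s m u)

variable {F B : Euc n → P2 n → Euc n → Euc n} {p : Euc n → P2 n → Euc n} {K Λ t T : ℝ}

theorem mul_le_of_time_le {s c b : ℝ} (hs : s ∈ Icc t T) (hc : 0 ≤ c) (h : (T - t) * c ≤ b) :
    (T - s) * c ≤ b :=
  (mul_le_mul_of_nonneg_right (by linarith [hs.1]) hc).trans h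

theorem exists_isSolutionFamily (D : SystemBounds F B p K Λ)
    (hsmall : (T - t) * (K * (4 + 12 * Λ)) ≤ 1 / 2) :
    ∃ X Z, IsSolutionFamily F B p t T X Z := by
  have hc : 0 ≤ K * (4 + 12 * Λ) := by
    have := D.F_lip.nonneg
    have := D.Λ_pos
    positivity
  have h : ∀ (s : ℝ) (m : P2 n), ∃ X Z : ℝ → Euc n → Euc n, s ∈ Icc t T → IsRegularFlow X ∧
      (Continuous fun q : ℝ × Euc n => Z q.1 q.2) ∧
      IsSystemSolution F B p s T m.toMeasure (fun x => x) X Z fun u => m.map (X u) := by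
    intro s m
    by_cases hs : s ∈ Icc t T
    · obtain ⟨X, Z, h⟩ := exists_isSystemSolution D hs.2 (mul_le_of_time_le hs hc hsmall) m
      exact ⟨X, Z, fun _ => h⟩
    · exact ⟨fun _ x => x, fun _ x => x, fun h => absurd h hs⟩
  choose X Z h using h
  exact ⟨X, Z, fun s hs m => (h s m hs).1, fun s hs m => (h s m hs).2.1,
    fun s hs m => (h s m hs).2.2⟩

namespace IsSolutionFamily

variable {X Z : ℝ → P2 n → ℝ → Euc n → Euc n} (H : IsSolutionFamily F B p t T X Z)
  (D : SystemBounds F B p K Λ) (hsmall : (T - t) * (K * (9 + 24 * Λ)) ≤ 1 / 2)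

-- The length of the interval is fixed once by the largest constant `9 + 24 * Λ`; the smallness
-- conditions with smaller constants follow from it.
include D hsmall in
theorem small_mul {c s : ℝ} (hs : s ∈ Icc t T) (hc : 0 ≤ c) (hle : c ≤ 9 + 24 * Λ) :
    (T - s) * (K * c) ≤ 1 / 2 :=
  mul_le_of_time_le hs (mul_nonneg D.F_lip.nonneg hc) ((mul_le_mul_of_nonneg_left
    (mul_le_mul_of_nonneg_left hle D.F_lip.nonneg) (by linarith [hs.1, hs.2])).trans hsmall)

include D hsmall in
theorem small_eighth {s : ℝ} (hs : s ∈ Icc t T) : (T - s) * K ≤ 1 / 8 := by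
  have := small_mul D hsmall hs (c := 4) (by norm_num) (by linarith [D.Λ_pos])
  linarith

include D hsmall in
theorem small_system {s : ℝ} (hs : s ∈ Icc t T) : (T - s) * (K * (4 + 12 * Λ)) ≤ 1 / 2 :=
  small_mul D hsmall hs (by linarith [D.Λ_pos]) (by linarith [D.Λ_pos])

include H D hsmall

/-- The flow property. -/
theorem flow {r s τ : ℝ} (hr : r ∈ Icc t T) (hs : s ∈ Icc r T) (hτ : τ ∈ Icc s T) (m : P2 n)
    (x : Euc n) : X r m τ x = X s (m.map (X r m s)) τ (X r m s x) ∧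
      Z r m τ x = Z s (m.map (X r m s)) τ (X r m s x) := by
  have hst : s ∈ Icc t T := ⟨hr.1.trans hs.1, hs.2⟩
  -- Two solutions on `[s,T]` over the space of `m`, both with initial value `X r m s`: the
  -- restriction of the old one, and the one started from the law of `X r m s`, composed with `X r m
  -- s`. Stability identifies them.
  have h1 := (H.sol r hr m).restrict hs
  have h2 := (H.sol s hst (m.map (X r m s))).comp ((H.regular r hr m).measurable s)
    ((H.regular r hr m).toMeasure_map m s).symm hs.2
  have h3 := h1.norm_sub_le D h2 hs.2 (small_system D hsmall hst) τ hτ x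
  simp only [sub_self, norm_zero, integral_zero, add_zero, mul_zero] at h3
  exact ⟨sub_eq_zero.1 (norm_le_zero_iff.1 h3.1), sub_eq_zero.1 (norm_le_zero_iff.1 h3.2)⟩

/-- Lipschitz dependence on the initial state and the initial law. -/
theorem norm_sub_le {s τ : ℝ} (hs : s ∈ Icc t T) (hτ : τ ∈ Icc s T) {m m' : P2 n}
    {π : Measure (Euc n × Euc n)} (hπ : P2.IsCoupling m m' π) (x x' : Euc n) :
    ‖X s m τ x - X s m' τ x'‖ ≤ 2 * (1 + Λ) * (‖x - x'‖ + P2.cost π) ∧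
    ‖Z s m τ x - Z s m' τ x'‖ ≤ 2 * (1 + Λ) * (‖x - x'‖ + P2.cost π) := by
  have := hπ.isProbabilityMeasure
  -- Composition with the coordinates puts the solutions for the two laws on one probability space,
  -- the coupling, where stability applies.
  have h1 := (H.sol s hs m).comp measurable_fst hπ.1 hs.2
  have h2 := (H.sol s hs m').comp measurable_snd hπ.2 hs.2
  exact h1.norm_sub_le D h2 hs.2 (small_system D hsmall hs) τ hτ (x, x')

/-- The decoupling property: the flow property, read at the moment of restarting, makes the backward
component a function of current time, state and law. -/
theorem eq_field {r s : ℝ} (hr : r ∈ Icc t T) (hs : s ∈ Icc r T) (m : P2 n) (x : Euc n) :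
    Z r m s x = Z s (m.map (X r m s)) s (X r m s x) :=
  (H.flow D hsmall hr hs (left_mem_Icc.2 hs.2) m x).2

theorem isFieldFlow {r : ℝ} (hr : r ∈ Icc t T) (m : P2 n) :
    IsFieldFlow F (fun s x m => Z s m s x) T r m (X r m) where
  measurable τ _ := (H.regular r hr m).measurable τ
  memLp τ _ := (H.regular r hr m).memLp m τ
  cont_path x := ((H.regular r hr m).cont.comp
    (continuous_id.prodMk continuous_const)).continuousOn
  cont_law := ((H.regular r hr m).continuous_law m).continuousOn
  equation x τ hτ := by
    rw [(H.sol r hr m).step.fwd x τ hτ]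
    congr 1
    refine intervalIntegral.integral_congr fun u hu => ?_
    rw [uIcc_of_le hτ.1] at hu
    rw [← H.eq_field D hsmall hr ⟨hu.1, hu.2.trans hτ.2⟩]

theorem norm_sub_initial_le_time {r u : ℝ} (hr : r ∈ Icc t T) (hu : u ∈ Icc r T) (m : P2 n)
    (x : Euc n) : ‖X r m u x - x‖ ≤ 4 * K * (u - r) * (1 + ‖x‖ + m.norm1) :=
  (H.isFieldFlow D hsmall hr m).norm_sub_initial_le_time D.F_lip hr.2
    (small_eighth D hsmall hr) hu x

theorem norm_integral_bwd_le {r a b : ℝ} (hr : r ∈ Icc t T) (ha : r ≤ a) (hab : a ≤ b) (hb : b ≤ T)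
    (m : P2 n) (x : Euc n) : ‖∫ u in a..b, B (X r m u x) (m.map (X r m u)) (Z r m u x)‖ ≤
      4 * K * (b - a) * (1 + ‖x‖ + m.norm1) := by
  refine (IsFieldFlow.norm_integral_field_le D.B_lip hab fun v hv =>
    (H.isFieldFlow D hsmall hr m).weight_le_four D.F_lip hr.2 (small_eighth D hsmall hr)
      ⟨ha.trans hv.1, hv.2.trans hb⟩ x).trans (le_of_eq ?_)
  ring

/-- Growth of the decoupling field. -/
theorem norm_field_le (hsmall' : (T - t) * (K * (4 + 12 * Λ)) ≤ Λ) {s : ℝ} (hs : s ∈ Icc t T)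
    (m : P2 n) (x : Euc n) : ‖Z s m s x‖ ≤ 2 * Λ * (1 + ‖x‖ + m.norm1) := by
  have hK := D.F_lip.nonneg
  have hΛ := D.Λ_pos
  have hw := weight_pos x m
  have hTs : 0 ≤ T - s := sub_nonneg.2 hs.2
  rw [(H.sol s hs m).step.bwd x s (left_mem_Icc.2 hs.2)]
  have h1 := D.p_growth (X s m T x) (m.map (X s m T))
  have h2 := H.norm_integral_bwd_le D hsmall hs le_rfl hs.2 le_rfl m x
  have h3 := (H.isFieldFlow D hsmall hs m).weight_le (c := 4 * K * (T - s)) (by positivity)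
    (right_mem_Icc.2 hs.2)
    (fun y => H.norm_sub_initial_le_time D hsmall hs (right_mem_Icc.2 hs.2) m y) x
  have h4 := mul_le_mul_of_nonneg_left h3 hΛ.le
  -- The terminal function contributes `Λ * (1 + 12 * K * (T - s))` and the integral `4 * K * (T -
  -- s)`; `hsmall'` bounds the excess over `Λ` by another `Λ`.
  have h5 := mul_le_mul_of_nonneg_right
    (mul_le_of_time_le hs (by positivity) hsmall') hw.le
  refine (norm_add_le _ _).trans ?_
  linarith

/-- Lipschitz dependence on the initial time. -/
theorem norm_sub_le_time {r r' s : ℝ} (hr : r ∈ Icc t T) (hrr' : r ≤ r') (hr's : r' ≤ s)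
    (hsT : s ≤ T) (m : P2 n) (x : Euc n) :
    ‖X r m s x - X r' m s x‖ ≤
      24 * (1 + Λ) * K * (r' - r) * (1 + ‖x‖ + m.norm1) ∧
    ‖Z r m s x - Z r' m s x‖ ≤
      24 * (1 + Λ) * K * (r' - r) * (1 + ‖x‖ + m.norm1) := by
  have hK := D.F_lip.nonneg
  have hΛ := D.Λ_pos
  have hr'r : r' ∈ Icc r T := ⟨hrr', hr's.trans hsT⟩
  have hr' : r' ∈ Icc t T := ⟨hr.1.trans hrr', hr's.trans hsT⟩
  have hs : s ∈ Icc r' T := ⟨hr's, hsT⟩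
  -- Restarting at `r'` turns a change of the initial time into a change of initial state and law,
  -- both of order `r' - r`.
  obtain ⟨e1, e2⟩ := H.flow D hsmall hr hr'r hs m x
  rw [e1, e2]
  have hreg := H.regular r hr m
  have hd : ∀ y, ‖X r m r' y - y‖ ≤ 4 * K * (r' - r) * (1 + ‖y‖ + m.norm1) := fun y =>
    H.norm_sub_initial_le_time D hsmall hr hr'r m y
  have hc := P2.isCoupling_map (hreg.measurable r') measurable_id (hreg.toMeasure_map m r')
    (Measure.map_id (μ := m.toMeasure)).symm
  have hcost := P2.cost_map (P := m.toMeasure) (hreg.measurable r') measurable_id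
  have hmean := ((isWeight_one_add_norm m).const_mul
    (by have := sub_nonneg.2 hrr'; positivity : 0 ≤ 4 * K * (r' - r))).integral_norm_le hd x
  have hle : 2 * (1 + Λ) * (‖X r m r' x - x‖ +
      P2.cost (m.toMeasure.map fun ω => (X r m r' ω, id ω))) ≤
      24 * (1 + Λ) * K * (r' - r) * (1 + ‖x‖ + m.norm1) := by
    rw [hcost]
    have h1 : ‖X r m r' x - x‖ + ∫ ω, ‖X r m r' ω - id ω‖ ∂m.toMeasure ≤
        3 * (4 * K * (r' - r) * (1 + ‖x‖ + m.norm1)) := by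
      simp only [id]
      linarith [hd x]
    have := mul_le_mul_of_nonneg_left h1 (by positivity : 0 ≤ 2 * (1 + Λ))
    linarith
  obtain ⟨h1, h2⟩ := H.norm_sub_le D hsmall hr' hs hc (X r m r' x) x
  exact ⟨h1.trans hle, h2.trans hle⟩

theorem continuousOn_flow {s : ℝ} (hs : s ∈ Icc t T) :
    ContinuousOn (fun q : ℝ × P2 n × Euc n => X q.1 q.2.1 s q.2.2) (Icc t s ×ˢ univ) :=
  continuousOn_of_lipschitz (c := 2 * (1 + Λ)) (c' := 24 * (1 + Λ) * K)
    (fun _ hr _ _ x x' _ hπ => (H.norm_sub_le D hsmall ⟨hr.1, hr.2.trans hs.2⟩ ⟨hr.2, hs.2⟩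
      hπ x x').1)
    fun _ hr _ hr' hrr' m x =>
      (H.norm_sub_le_time D hsmall ⟨hr.1, hr.2.trans hs.2⟩ hrr' hr'.2 hs.2 m x).1

theorem continuousOn_backward {s : ℝ} (hs : s ∈ Icc t T) :
    ContinuousOn (fun q : ℝ × P2 n × Euc n => Z q.1 q.2.1 s q.2.2) (Icc t s ×ˢ univ) :=
  continuousOn_of_lipschitz (c := 2 * (1 + Λ)) (c' := 24 * (1 + Λ) * K)
    (fun _ hr _ _ x x' _ hπ => (H.norm_sub_le D hsmall ⟨hr.1, hr.2.trans hs.2⟩ ⟨hr.2, hs.2⟩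
      hπ x x').2)
    fun _ hr _ hr' hrr' m x =>
      (H.norm_sub_le_time D hsmall ⟨hr.1, hr.2.trans hs.2⟩ hrr' hr'.2 hs.2 m x).2

/-- On the diagonal the time increment splits in two: the evaluation time moves along one solution,
by the backward equation, and then the initial time moves. -/
theorem fieldContinuous : FieldContinuous t T fun s x m => Z s m s x := by
  have h := continuousOn_of_lipschitz (Φ := fun s m x => Z s m s x) (t := t) (s := T)
    (c := 2 * (1 + Λ)) (c' := 4 * K + 24 * (1 + Λ) * K)
    (fun r hr m m' x x' π hπ => (H.norm_sub_le D hsmall hr (left_mem_Icc.2 hr.2) hπ x x').2)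
    fun r hr r' hr' hrr' m x => by
      have h1 := (H.norm_sub_le_time D hsmall hr hrr' le_rfl hr'.2 m x).2
      have h2 : ‖Z r m r x - Z r m r' x‖ ≤ 4 * K * (r' - r) * (1 + ‖x‖ + m.norm1) := by
        have hI : ∀ a ∈ Icc r T, ∀ b ∈ Icc r T, IntervalIntegrable
            (fun u => B (X r m u x) (m.map (X r m u)) (Z r m u x)) volume a b :=
          fun a ha b hb => (((H.sol r hr m).step.contB x).mono
            (uIcc_subset_Icc ha hb)).intervalIntegrable
        have hr0 : r ∈ Icc r T := left_mem_Icc.2 hr.2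
        have hr1 : r' ∈ Icc r T := ⟨hrr', hr'.2⟩
        have hT : T ∈ Icc r T := right_mem_Icc.2 hr.2
        rw [(H.sol r hr m).step.bwd x r hr0, (H.sol r hr m).step.bwd x r' hr1,
          ← intervalIntegral.integral_add_adjacent_intervals (hI r hr0 r' hr1) (hI r' hr1 T hT),
          add_sub_add_left_eq_sub, add_sub_cancel_right]
        exact H.norm_integral_bwd_le D hsmall hr le_rfl hrr' hr'.2 m x
      have h3 := norm_add_le (Z r m r x - Z r m r' x) (Z r m r' x - Z r' m r' x)
      rw [sub_add_sub_cancel] at h3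
      linarith
  exact h.comp (f := fun q : ℝ × Euc n × P2 n => (q.1, q.2.2, q.2.1)) (by fun_prop)
    fun q hq => ⟨hq.1, mem_univ _⟩

/-- Comparison of the flow with the flow of another field. -/
theorem norm_flow_sub_le {γ : ℝ → Euc n → P2 n → Euc n} {δ s : ℝ} (hδ : 0 ≤ δ)
    (hγ : FieldContinuous t T γ)
    (hdist : ∀ u ∈ Icc t T, ∀ x m, ‖γ u x m - Z u m u x‖ ≤ δ * (1 + ‖x‖ + m.norm1))
    (hs : s ∈ Icc t T) {m : P2 n} {Y : ℝ → Euc n → Euc n} (hY : IsFieldFlow F γ T s m Y) :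
    ∀ τ ∈ Icc s T, ∀ x, ‖Y τ x - X s m τ x‖ ≤ 8 * ((T - s) * K) * δ * (1 + ‖x‖ + m.norm1) ∧
      ‖γ τ (Y τ x) (m.map (Y τ)) - Z s m τ x‖ ≤
        (4 * δ + 6 * (1 + Λ) * (8 * ((T - s) * K) * δ)) * (1 + ‖x‖ + m.norm1) := by
  have hK := D.F_lip.nonneg
  have hΛ := D.Λ_pos
  have hTs : 0 ≤ T - s := sub_nonneg.2 hs.2
  have hX := H.isFieldFlow D hsmall hs m
  have hsm := small_eighth D hsmall hs
  -- From flows to fields: the field distance `δ` is evaluated along `Y`, where the weight is at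
  -- most four times the initial one, and the Lipschitz constant `2 * (1 + Λ)` of the decoupling
  -- field acts on state and mean, together at most `3 * c`.
  have hfield : ∀ c, 0 ≤ c → ∀ u ∈ Icc s T,
      (∀ x, ‖Y u x - X s m u x‖ ≤ c * (1 + ‖x‖ + m.norm1)) → ∀ x,
      ‖γ u (Y u x) (m.map (Y u)) - Z s m u x‖ ≤
        (4 * δ + 6 * (1 + Λ) * c) * (1 + ‖x‖ + m.norm1) := by
    intro c hc u hu hb x
    have hut : u ∈ Icc t T := ⟨hs.1.trans hu.1, hu.2⟩
    rw [H.eq_field D hsmall hs hu]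
    have h1 := hdist u hut (Y u x) (m.map (Y u))
    have h2 := mul_le_mul_of_nonneg_left (hY.weight_le_four D.F_lip hs.2 hsm hu x) hδ
    have h3 := (H.norm_sub_le D hsmall hut (left_mem_Icc.2 hu.2)
      (P2.isCoupling_map (hY.measurable u hu) (hX.measurable u hu) (hY.toMeasure_map hu)
        (hX.toMeasure_map hu)) (Y u x) (X s m u x)).2
    rw [P2.cost_map (hY.measurable u hu) (hX.measurable u hu)] at h3
    have h4 := ((isWeight_one_add_norm m).const_mul hc).integral_norm_le hb x
    have h5 : 2 * (1 + Λ) * (‖Y u x - X s m u x‖ +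
        ∫ y, ‖Y u y - X s m u y‖ ∂m.toMeasure) ≤
        2 * (1 + Λ) * (3 * (c * (1 + ‖x‖ + m.norm1))) :=
      mul_le_mul_of_nonneg_left (by linarith [hb x]) (by positivity)
    have h6 := norm_add_le (γ u (Y u x) (m.map (Y u)) - Z u (m.map (Y u)) u (Y u x))
      (Z u (m.map (Y u)) u (Y u x) - Z u (m.map (X s m u)) u (X s m u x))
    rw [sub_add_sub_cancel] at h6
    linarith
  -- With `σ = (T - s) * K`, a bound `c` improves to `c / 2 + 4 * σ * δ`, whose fixed point is `8 *
  -- σ * δ`. The start 2 adds the a priori displacements of both flows.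
  have key : ∀ j : ℕ, ∀ u ∈ Icc s T, ∀ x, ‖Y u x - X s m u x‖ ≤
      (8 * ((T - s) * K) * δ + (1 / 2) ^ j * 2) * (1 + ‖x‖ + m.norm1) := by
    intro j
    induction j with
    | zero =>
      intro u hu x
      have h1 := hY.norm_sub_initial_le D.F_lip hs.2 hsm u hu x
      have h2 := hX.norm_sub_initial_le D.F_lip hs.2 hsm u hu x
      have h3 := _root_.norm_sub_le (Y u x - x) (X s m u x - x)
      rw [sub_sub_sub_cancel_right] at h3
      have h4 : 0 ≤ 8 * ((T - s) * K) * δ * (1 + ‖x‖ + m.norm1) :=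
        mul_nonneg (by positivity) (weight_pos x m).le
      rw [pow_zero]
      linarith
    | succ j ih =>
      intro u hu x
      set c := 8 * ((T - s) * K) * δ + (1 / 2) ^ j * 2 with hc
      have hc0 : 0 ≤ c := by positivity
      rw [hY.equation x u hu, (H.sol s hs m).step.fwd x u hu, add_sub_add_left_eq_sub]
      have hint := norm_integral_sub_le (left_mem_Icc.2 hs.2) hu hu.1
        (hY.continuousOn_field D.F_lip hγ hs.1 x) ((H.sol s hs m).step.contF x)
        (c := K * (3 * (c * (1 + ‖x‖ + m.norm1)) +
          (4 * δ + 6 * (1 + Λ) * c) * (1 + ‖x‖ + m.norm1))) fun v hv =>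
        (D.F_lip.norm_sub_le_of_weight (hY.measurable v hv) (hX.measurable v hv)
          (hY.toMeasure_map hv) (hX.toMeasure_map hv)
          ((isWeight_one_add_norm m).const_mul hc0) (ih v hv) _ _ x).trans
          (mul_le_mul_of_nonneg_left (add_le_add_right (hfield c hc0 v hv (ih v hv) x) _) hK)
      refine hint.trans ?_
      have h1 := mul_le_mul_of_nonneg_right (small_mul D hsmall hs (c := 9 + 6 * Λ)
        (by positivity) (by linarith)) hc0
      have e : (T - s) * (K * (3 * (c * (1 + ‖x‖ + m.norm1)) +
          (4 * δ + 6 * (1 + Λ) * c) * (1 + ‖x‖ + m.norm1))) =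
          ((T - s) * (K * (9 + 6 * Λ)) * c + 4 * ((T - s) * K) * δ) * (1 + ‖x‖ + m.norm1) := by
        ring
      rw [e]
      refine mul_le_mul_of_nonneg_right ?_ (weight_pos x m).le
      rw [pow_succ]
      linarith
  have hX' : ∀ u ∈ Icc s T, ∀ x, ‖Y u x - X s m u x‖ ≤
      8 * ((T - s) * K) * δ * (1 + ‖x‖ + m.norm1) := by
    intro u hu x
    have hlim : Tendsto (fun j : ℕ => (8 * ((T - s) * K) * δ + (1 / 2) ^ j * 2) *
        (1 + ‖x‖ + m.norm1)) atTop (𝓝 (8 * ((T - s) * K) * δ * (1 + ‖x‖ + m.norm1))) := by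
      have := (((tendsto_pow_atTop_nhds_zero_of_lt_one (r := (1 / 2 : ℝ)) (by norm_num)
        (by norm_num)).mul_const 2).const_add (8 * ((T - s) * K) * δ)).mul_const
          (1 + ‖x‖ + m.norm1)
      simpa using this
    exact ge_of_tendsto' hlim fun j => key j u hu x
  exact fun τ hτ x => ⟨hX' τ hτ x, hfield _ (by positivity) τ hτ (hX' τ hτ) x⟩

/-- The flow of the decoupling field is unique. -/
theorem flow_unique {s : ℝ} (hs : s ∈ Icc t T) {m : P2 n} {Y : ℝ → Euc n → Euc n}
    (hY : IsFieldFlow F (fun s x m => Z s m s x) T s m Y) {τ : ℝ} (hτ : τ ∈ Icc s T) (x : Euc n) :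
    Y τ x = X s m τ x := by
  have h := (H.norm_flow_sub_le D hsmall le_rfl (H.fieldContinuous D hsmall)
    (fun u _ x m => by simp) hs hY τ hτ x).1
  rw [mul_zero, zero_mul] at h
  exact sub_eq_zero.1 (norm_le_zero_iff.1 h)

/-- The decoupling field is unique among the continuous fields of linear growth. -/
theorem field_unique {γ : ℝ → Euc n → P2 n → Euc n} (hγ : FieldContinuous t T γ) {c : ℝ}
    (hdist : ∀ u ∈ Icc t T, ∀ x m, ‖γ u x m - Z u m u x‖ ≤ c * (1 + ‖x‖ + m.norm1))
    (hdec : ∀ s ∈ Icc t T, ∀ m : P2 n, ∃ Y : ℝ → Euc n → Euc n, IsFieldFlow F γ T s m Y ∧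
      ∀ x, γ s x m = p (Y T x) (m.map (Y T)) + ∫ τ in s..T,
        B (Y τ x) (m.map (Y τ)) (γ τ (Y τ x) (m.map (Y τ)))) {s : ℝ} (hs : s ∈ Icc t T)
    (x : Euc n) (m : P2 n) : γ s x m = Z s m s x := by
  have hK := D.F_lip.nonneg
  have hΛ := D.Λ_pos
  have hc : 0 ≤ c := nonneg_of_mul_nonneg_left ((norm_nonneg _).trans (hdist s hs x m))
    (weight_pos x m)
  -- A distance `δ` of the fields moves the flows by `8 * σ * δ`. Inserted in the decoupling
  -- equations, this returns at most `σ * (8 + 24 * Λ) * δ`, that is, at most `δ / 2`.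
  have key : ∀ j : ℕ, ∀ u ∈ Icc t T, ∀ x m,
      ‖γ u x m - Z u m u x‖ ≤ (1 / 2) ^ j * c * (1 + ‖x‖ + m.norm1) := by
    intro j
    induction j with
    | zero => simpa using hdist
    | succ j ih =>
      intro s hs x m
      set δ := (1 / 2) ^ j * c
      have hδ : 0 ≤ δ := by positivity
      have hTs : 0 ≤ T - s := sub_nonneg.2 hs.2
      obtain ⟨Y, hY, heq⟩ := hdec s hs m
      have hX := H.isFieldFlow D hsmall hs m
      have hcmp := H.norm_flow_sub_le D hsmall hδ hγ ih hs hY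
      have hs0 : s ∈ Icc s T := left_mem_Icc.2 hs.2
      have hT : T ∈ Icc s T := right_mem_Icc.2 hs.2
      set σ := (T - s) * K
      have hσ : 0 ≤ σ := mul_nonneg hTs hK
      have hW := (isWeight_one_add_norm m).const_mul (by positivity : 0 ≤ 8 * σ * δ)
      rw [heq, (H.sol s hs m).step.bwd x s hs0, add_sub_add_comm]
      refine (norm_add_le _ _).trans ?_
      have h1 := D.p_lip (Y T x) (X s m T x) _ _ _
        (P2.isCoupling_map (hY.measurable T hT) (hX.measurable T hT) (hY.toMeasure_map hT)
          (hX.toMeasure_map hT))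
      rw [P2.cost_map (hY.measurable T hT) (hX.measurable T hT)] at h1
      have h2 := hW.integral_norm_le (fun y => (hcmp T hT y).1) x
      have h3 : Λ * (‖Y T x - X s m T x‖ + ∫ y, ‖Y T y - X s m T y‖ ∂m.toMeasure) ≤
          Λ * (3 * (8 * σ * δ * (1 + ‖x‖ + m.norm1))) :=
        mul_le_mul_of_nonneg_left (by linarith [(hcmp T hT x).1]) hΛ.le
      have h4 := norm_integral_sub_le hs0 hT hs.2
        (hY.continuousOn_field D.B_lip hγ hs.1 x) ((H.sol s hs m).step.contB x)
        (c := K * (3 * (8 * σ * δ * (1 + ‖x‖ + m.norm1)) +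
          (4 * δ + 6 * (1 + Λ) * (8 * σ * δ)) * (1 + ‖x‖ + m.norm1))) fun v hv =>
        (D.B_lip.norm_sub_le_of_weight (hY.measurable v hv) (hX.measurable v hv)
          (hY.toMeasure_map hv) (hX.toMeasure_map hv) hW (fun y => (hcmp v hv y).1) _ _ x).trans
          (mul_le_mul_of_nonneg_left (add_le_add_right (hcmp v hv x).2 _) hK)
      have e : (T - s) * (K * (3 * (8 * σ * δ * (1 + ‖x‖ + m.norm1)) +
          (4 * δ + 6 * (1 + Λ) * (8 * σ * δ)) * (1 + ‖x‖ + m.norm1))) =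
          σ * (σ * (9 + 6 * Λ) * 8 + 4) * δ * (1 + ‖x‖ + m.norm1) := by
        simp only [σ]; ring
      have h5 : σ * (9 + 6 * Λ) ≤ 1 / 2 := by
        have := small_mul D hsmall hs (c := 9 + 6 * Λ) (by positivity) (by linarith)
        rwa [← mul_assoc] at this
      have h6 : σ * (8 + 24 * Λ) ≤ 1 / 2 := by
        have := small_mul D hsmall hs (c := 8 + 24 * Λ) (by positivity) (by linarith)
        rwa [← mul_assoc] at this
      rw [e] at h4
      have h7 : σ * (σ * (9 + 6 * Λ) * 8 + 4) ≤ σ * 8 :=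
        mul_le_mul_of_nonneg_left (by linarith) hσ
      have h8 : Λ * (3 * (8 * σ * δ * (1 + ‖x‖ + m.norm1))) +
          σ * (σ * (9 + 6 * Λ) * 8 + 4) * δ * (1 + ‖x‖ + m.norm1) ≤
          1 / 2 * δ * (1 + ‖x‖ + m.norm1) := by
        have e2 : Λ * (3 * (8 * σ * δ * (1 + ‖x‖ + m.norm1))) =
            σ * (24 * Λ) * δ * (1 + ‖x‖ + m.norm1) := by ring
        rw [e2, ← add_mul, ← add_mul]
        exact mul_le_mul_of_nonneg_right (mul_le_mul_of_nonneg_right (by linarith) hδ)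
          (weight_pos x m).le
      have e3 : (1 / 2 : ℝ) ^ (j + 1) * c = 1 / 2 * δ := by simp only [δ]; ring
      rw [e3]
      linarith
  have hlim : Tendsto (fun j : ℕ => (1 / 2) ^ j * c * (1 + ‖x‖ + m.norm1)) atTop (𝓝 0) := by
    have := ((tendsto_pow_atTop_nhds_zero_of_lt_one (r := (1 / 2 : ℝ)) (by norm_num)
      (by norm_num)).mul_const c).mul_const (1 + ‖x‖ + m.norm1)
    simpa using this
  exact sub_eq_zero.1 (norm_le_zero_iff.1 (ge_of_tendsto' hlim fun j => key j s hs x m))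

end IsSolutionFamily

end Family

/-! ### Regularity in time -/

section TimeRegularity

variable {n : ℕ} {F B : Euc n → P2 n → Euc n → Euc n} {p : Euc n → P2 n → Euc n} {K Λ t T : ℝ}
  {X Z : ℝ → P2 n → ℝ → Euc n → Euc n}

namespace IsSolutionFamily

/-- The integrand is continuous for all real times, so its primitive is a differentiable extension
of the path beyond `[r,T]`; the end points then need no separate treatment. -/
theorem exists_hasDerivAt_fwd (H : IsSolutionFamily F B p t T X Z)
    (D : SystemBounds F B p K Λ) {r : ℝ} (hr : r ∈ Icc t T) (m : P2 n) (x : Euc n) :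
    ∃ g : ℝ → Euc n,
      (∀ u, HasDerivAt g (F (X r m u x) (m.map (X r m u)) (Z r m u x)) u) ∧
      (Continuous fun u => F (X r m u x) (m.map (X r m u)) (Z r m u x)) ∧
      ∀ u ∈ Icc r T, X r m u x = g u := by
  have hc : Continuous fun u => F (X r m u x) (m.map (X r m u)) (Z r m u x) :=
    ((H.regular r hr m).continuous_field D.F_lip (H.cont r hr m) m).comp
      (continuous_id.prodMk continuous_const)
  exact ⟨_, fun u => (hc.integral_hasStrictDerivAt r u).hasDerivAt.const_add x, hc,
    (H.sol r hr m).step.fwd x⟩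

theorem exists_hasDerivAt_bwd (H : IsSolutionFamily F B p t T X Z)
    (D : SystemBounds F B p K Λ) {r : ℝ} (hr : r ∈ Icc t T) (m : P2 n) (x : Euc n) :
    ∃ g : ℝ → Euc n,
      (∀ u, HasDerivAt g (-B (X r m u x) (m.map (X r m u)) (Z r m u x)) u) ∧
      (Continuous fun u => -B (X r m u x) (m.map (X r m u)) (Z r m u x)) ∧
      ∀ u ∈ Icc r T, Z r m u x = g u := by
  have hc : Continuous fun u => B (X r m u x) (m.map (X r m u)) (Z r m u x) :=
    ((H.regular r hr m).continuous_field D.B_lip (H.cont r hr m) m).comp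
      (continuous_id.prodMk continuous_const)
  refine ⟨_, fun u => (hc.integral_hasStrictDerivAt T u).hasDerivAt.neg.const_add
    (p (X r m T x) (m.map (X r m T))), hc.neg, fun u hu => ?_⟩
  rw [(H.sol r hr m).step.bwd x u hu, intervalIntegral.integral_symm]
  rfl

end IsSolutionFamily

theorem contDiff_one_of_hasDerivAt {g h : ℝ → Euc n} (hg : ∀ u, HasDerivAt g (h u) u)
    (hh : Continuous h) : ContDiff ℝ 1 g := by
  rw [contDiff_one_iff_deriv]
  refine ⟨fun u => (hg u).differentiableAt, ?_⟩
  rwa [show deriv g = h from funext fun u => (hg u).deriv]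

end TimeRegularity

/-! ### Verification of the standing hypotheses -/

section Verification

variable {n k : ℕ}

/-- On the cone `‖z‖` is at most `2 * Lbar` times the weight, so the curvature of `f` costs at most
`2 * Lbar * lamg / (40 * Lbar) = lamg / 20`. This leaves `19 / 20 * lamg`. -/
theorem controlBounds {f : Euc n → P2 n → Euc k → Euc n} {g : Euc n → P2 n → Euc k → ℝ}
    {Lbar lamf Lam1 Lam2 Lam3 lbf Lipf lamg lg Lamg lbg : ℝ} (hL : 0 < Lbar)
    (hf : DriftAssumption f lamf Lam1 Lam2 Lam3 lbf Lipf) (hg : CostAssumption g lamg lg Lamg lbg)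
    (hsmall : ∀ x μ a, ‖dA (dA f) x μ a‖ * (1 + ‖x‖ + μ.norm1) ≤ 1 / (40 * Lbar) * lamg) :
    ControlBounds f g (2 * lbf + 4 * max Lam1 (max Lam2 Lam3) + Lamg + lbg) (19 / 20 * lamg)
      (2 * Lbar) := by
  have hcoef := coefficientBounds hf hg
  obtain ⟨fm, fmx, fma, hf⟩ := hf
  obtain ⟨gm, gmx, gma, hg⟩ := hg
  have hlamg := hg.pos_lamg
  refine ⟨hcoef, by positivity, by positivity, hf.diff_a, hg.diff_a, hf.diff_aa, hg.diff_aa,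
    fun x μ z a η hz => ?_⟩
  have h1 := hg.convex_a x μ a η
  have h2 := (abs_le.1 (abs_real_inner_le_norm z (dA (dA f) x μ a η η))).1
  have h3 : ‖z‖ * ‖dA (dA f) x μ a η η‖ ≤ 1 / 20 * lamg * ‖η‖ ^ 2 := by
    have h4 : ‖dA (dA f) x μ a η η‖ ≤ ‖dA (dA f) x μ a‖ * ‖η‖ * ‖η‖ :=
      ContinuousLinearMap.le_opNorm₂ _ _ _
    calc _ ≤ (2 * Lbar * (1 + ‖x‖ + μ.norm1)) * (‖dA (dA f) x μ a‖ * ‖η‖ * ‖η‖) :=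
          mul_le_mul hz h4 (norm_nonneg _) (by have := weight_pos x μ; positivity)
      _ = 2 * Lbar * ‖η‖ ^ 2 * (‖dA (dA f) x μ a‖ * (1 + ‖x‖ + μ.norm1)) := by ring
      _ ≤ 2 * Lbar * ‖η‖ ^ 2 * (1 / (40 * Lbar) * lamg) :=
          mul_le_mul_of_nonneg_left (hsmall x μ a) (by positivity)
      _ = _ := by field_simp; ring
  linarith

theorem terminal_lipschitz {p : Euc n → P2 n → Euc n} {Lp Lbar : ℝ}
    (hp : TerminalAssumption p Lp Lbar) (hle : Lp ≤ Lbar) (x x' : Euc n) (μ μ' : P2 n)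
    (π : Measure (Euc n × Euc n)) (hπ : P2.IsCoupling μ μ' π) :
    ‖p x μ - p x' μ'‖ ≤ Lbar * (‖x - x'‖ + P2.cost π) := by
  obtain ⟨pm, hp⟩ := hp
  have h1 : ‖p x μ - p x' μ‖ ≤ Lp * ‖x - x'‖ :=
    convex_univ.norm_image_sub_le_of_norm_fderiv_le (fun y _ => hp.diff_x y μ)
      (fun y _ => hp.bound_x y μ) (mem_univ _) (mem_univ _)
  have h2 : ‖p x' μ - p x' μ'‖ ≤ Lp * P2.cost π :=
    (hp.diff_m x').norm_sub_le (hp.bound_m x') hπ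
  have h3 := norm_add_le (p x μ - p x' μ) (p x' μ - p x' μ')
  rw [sub_add_sub_cancel] at h3
  have h4 := mul_le_mul_of_nonneg_right hle
    (add_nonneg (norm_nonneg (x - x')) (P2.cost_nonneg π))
  linarith

/-- A Lipschitz and growth constant for the truncated system. -/
noncomputable def systemConst (Lbar Lf Lamf lbf Lg Lamg lbg Lalpha : ℝ) : ℝ :=
  (Lf + Lg + (2 * lbf + 4 * Lamf + Lamg + lbg) * Lalpha) + (2 * lbf + 4 * Lamf + Lamg + lbg) *
    (1 + (2 + 2 * Lbar) * (2 * lbf + 4 * Lamf + Lamg + lbg) * (Lalpha / Lamf)) *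
    (2 + 2 * Lbar) * (2 + 2 * Lbar)

/-- The convexity constant `lamg` may not enter the time step. It is eliminated through `hLa`, which
bounds the inverse of `19 / 20 * lamg` by `Lalpha / Lamf`. The remaining bound `Lalpha` on the
control at the origin gives the growth there. -/
theorem systemBounds {f : Euc n → P2 n → Euc k → Euc n} {g : Euc n → P2 n → Euc k → ℝ}
    {p : Euc n → P2 n → Euc n}
    {Lbar Lf Lamf lbf Lg Lamg lbg Lalpha lamf Lam1 Lam2 Lam3 Lipf lamg lg Lp : ℝ}
    (hf : DriftAssumption f lamf Lam1 Lam2 Lam3 lbf Lipf) (hg : CostAssumption g lamg lg Lamg lbg)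
    (hp : TerminalAssumption p Lp Lbar) (hle : Lp ≤ Lbar)
    (hC : ControlBounds f g (2 * lbf + 4 * Lamf + Lamg + lbg) (19 / 20 * lamg) (2 * Lbar))
    (hLamf : Lamf = max Lam1 (max Lam2 Lam3)) (hLf : ‖f 0 (P2.dirac 0) 0‖ ≤ Lf)
    (hLg : ‖dX g 0 (P2.dirac 0) 0‖ ≤ Lg) (hLa : 20 * Lamf / (19 * lamg) ≤ Lalpha)
    (hLa' : ‖optControl f g 0 (P2.dirac 0) 0‖ ≤ Lalpha) :
    SystemBounds (truncField (2 * Lbar) (fwdRHS f g)) (truncField (2 * Lbar) (bwdRHS f g)) p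
      (systemConst Lbar Lf Lamf lbf Lg Lamg lbg Lalpha) Lbar := by
  have hplip := terminal_lipschitz hp hle
  obtain ⟨pm, hp⟩ := hp
  obtain ⟨fm, fmx, fma, hf⟩ := hf
  obtain ⟨gm, gmx, gma, hg⟩ := hg
  have hL := hp.pos_Lbar
  have hlamg := hg.pos_lamg
  have hc := hC.nonneg
  have hLamf0 : 0 < Lamf := hLamf ▸ hf.pos_Lam1.trans_le (le_max_left _ _)
  have hκ : 0 < 2 * Lbar := by positivity
  have hLf0 := (norm_nonneg _).trans hLf
  have hLg0 := (norm_nonneg _).trans hLg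
  have hLa0 := (norm_nonneg _).trans hLa'
  unfold systemConst
  set c := 2 * lbf + 4 * Lamf + Lamg + lbg
  have hinv : (2 + 2 * Lbar) * c / (19 / 20 * lamg) ≤ (2 + 2 * Lbar) * c * (Lalpha / Lamf) := by
    rw [div_eq_mul_inv]
    refine mul_le_mul_of_nonneg_left ?_ (by positivity)
    rw [le_div_iff₀ hLamf0]
    refine le_trans (le_of_eq ?_) hLa
    field_simp
  have hK₁ : c * (1 + (2 + 2 * Lbar) * c / (19 / 20 * lamg)) * (2 + 2 * Lbar) ≤
      c * (1 + (2 + 2 * Lbar) * c * (Lalpha / Lamf)) * (2 + 2 * Lbar) := by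
    gcongr
  have h00 := (P2.dirac (0 : Euc n)).isCoupling_self
  have h0cost := (P2.dirac (0 : Euc n)).cost_self
  have hca : c * ‖optControl f g 0 (P2.dirac 0) 0‖ ≤ c * Lalpha :=
    mul_le_mul_of_nonneg_left hLa' hc
  have hδ : ∀ (x x' z z' : Euc n) (π : Measure (Euc n × Euc n)), 0 ≤ ‖x - x'‖ + P2.cost π + ‖z - z'‖ := fun x x' z z' π => by
    have := P2.cost_nonneg π
    positivity
  refine ⟨?_, ?_, hL, hplip, hp.growth⟩
  · refine lipField_truncField hκ (by positivity) (by positivity)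
      (fun x x' μ μ' z z' π hπ hz hz' => (hC.norm_fwdRHS_sub_le hπ hz hz').trans
        (mul_le_mul_of_nonneg_right hK₁ (hδ x x' z z' π))) ?_
    have h1 := hC.f_lip 0 0 _ _ (optControl f g 0 (P2.dirac 0) 0) 0 _ h00
    rw [h0cost, sub_self, norm_zero, sub_zero, zero_add, zero_add] at h1
    have h2 := norm_add_le (f 0 (P2.dirac 0) (optControl f g 0 (P2.dirac 0) 0) -
      f 0 (P2.dirac 0) 0) (f 0 (P2.dirac 0) 0)
    rw [sub_add_cancel] at h2
    unfold fwdRHS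
    linarith
  · refine lipField_truncField hκ (by positivity) (by positivity)
      (fun x x' μ μ' z z' π hπ hz hz' => (hC.norm_bwdRHS_sub_le hπ hz hz').trans
        (mul_le_mul_of_nonneg_right hK₁ (hδ x x' z z' π))) ?_
    have h1 := hC.gX_lip 0 0 _ _ (optControl f g 0 (P2.dirac 0) 0) 0 _ h00
    rw [h0cost, sub_self, norm_zero, sub_zero, zero_add, zero_add] at h1
    have h2 := norm_add_le (dX g 0 (P2.dirac 0) (optControl f g 0 (P2.dirac 0) 0) -
      dX g 0 (P2.dirac 0) 0) (dX g 0 (P2.dirac 0) 0)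
    rw [sub_add_cancel] at h2
    have e : ‖bwdRHS f g 0 (P2.dirac 0) 0‖ =
        ‖dX g 0 (P2.dirac 0) (optControl f g 0 (P2.dirac 0) 0)‖ := by
      rw [bwdRHS, map_zero, zero_add, gradient, LinearIsometryEquiv.norm_map]
      rfl
    rw [e]
    linarith

/-- The time step is chosen before any coefficients are given, when the signs of the constants are
still unknown. The first inequality drives the contractions, the second keeps the field below growth
`2 * Λ`. -/
theorem exists_small_time (K Λ : ℝ) : ∃ ε : ℝ, 0 < ε ∧ (0 ≤ K → 0 < Λ → ∀ δ ≤ ε,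
    δ * (K * (9 + 24 * Λ)) ≤ 1 / 2 ∧ δ * (K * (4 + 12 * Λ)) ≤ Λ) := by
  by_cases h : 0 ≤ K ∧ 0 < Λ
  · obtain ⟨hK, hΛ⟩ := h
    refine ⟨min (1 / 2) Λ / (K * (9 + 24 * Λ) + 1), by positivity, fun _ _ δ hδ => ?_⟩
    have h0 : 0 ≤ K * (9 + 24 * Λ) := by positivity
    rw [le_div_iff₀ (by positivity)] at hδ
    have h1 : δ * (K * (9 + 24 * Λ)) ≤ min (1 / 2) Λ := by
      rcases le_total 0 δ with h | h
      · linarith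
      · exact (mul_nonpos_of_nonpos_of_nonneg h h0).trans (by positivity)
    refine ⟨h1.trans (min_le_left _ _), ?_⟩
    rcases le_total 0 δ with h | h
    · refine le_trans ?_ (h1.trans (min_le_right _ _))
      gcongr <;> norm_num
    · exact (mul_nonpos_of_nonpos_of_nonneg h (by positivity)).trans hΛ.le
  · exact ⟨1, one_pos, fun hK hΛ => absurd ⟨hK, hΛ⟩ h⟩

theorem growthNorm_le_iff {t T c : ℝ} (hc : 0 ≤ c) {γ : ℝ → Euc n → P2 n → Euc n} :
    growthNorm t T γ ≤ ENNReal.ofReal c ↔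
      ∀ s ∈ Icc t T, ∀ x μ, ‖γ s x μ‖ ≤ c * (1 + ‖x‖ + μ.norm1) := by
  simp only [growthNorm, iSup_le_iff, ENNReal.ofReal_le_ofReal_iff hc]
  refine forall₄_congr fun s _ x μ => ?_
  rw [div_le_iff₀ (weight_pos x μ)]

theorem mem_cone_iff {Lbar : ℝ} {x : Euc n} {μ : P2 n} {z : Euc n} :
    (x, μ, z) ∈ cone (4 * Lbar) ↔ ‖z‖ ≤ 2 * Lbar * (1 + ‖x‖ + μ.norm1) := by
  rw [cone, mem_ofPred_eq, show 1 / 2 * (4 * Lbar) = 2 * Lbar by ring]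

/-- Along a field of growth `κ` the truncation is inactive, so results on the truncated system carry
over in both directions. -/
theorem isForwardFlow_iff {f : Euc n → P2 n → Euc k → Euc n} {g : Euc n → P2 n → Euc k → ℝ}
    {κ T s : ℝ} (hκ : 0 < κ) {γ : ℝ → Euc n → P2 n → Euc n}
    (hγ : ∀ u ∈ Icc s T, ∀ x μ, ‖γ u x μ‖ ≤ κ * (1 + ‖x‖ + μ.norm1)) {m : P2 n}
    {Y : ℝ → Euc n → Euc n} :
    IsForwardFlow f g γ T s m Y ↔ IsFieldFlow (truncField κ (fwdRHS f g)) γ T s m Y := by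
  have e : ∀ x, ∀ τ ∈ Icc s T,
      ∫ u in s..τ, truncField κ (fwdRHS f g) (Y u x) (m.map (Y u)) (γ u (Y u x) (m.map (Y u))) =
      ∫ u in s..τ, fwdRHS f g (Y u x) (m.map (Y u)) (γ u (Y u x) (m.map (Y u))) := by
    intro x τ hτ
    refine intervalIntegral.integral_congr fun u hu => ?_
    rw [uIcc_of_le hτ.1] at hu
    exact truncField_eq hκ (hγ u ⟨hu.1, hu.2.trans hτ.2⟩ _ _)
  exact ⟨fun h => ⟨h.measurable, h.memLp, h.cont_path, h.cont_law,
      fun x τ hτ => by rw [e x τ hτ]; exact h.equation x τ hτ⟩,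
    fun h => ⟨h.measurable, h.memLp, h.cont_path, h.cont_law,
      fun x τ hτ => by rw [← e x τ hτ]; exact h.equation x τ hτ⟩⟩

end Verification

/-! ### Assembly of the theorem -/

theorem mainTheorem6 {n k : ℕ}
    (Lbar Lf Lamf lbf Lg Lamg lbg Lalpha : ℝ) :
    ∃ ε₁ : ℝ, 0 < ε₁ ∧
      ∀ (f : Euc n → P2 n → Euc k → Euc n) (g : Euc n → P2 n → Euc k → ℝ)
        (p : Euc n → P2 n → Euc n)
        (lamf Lam1 Lam2 Lam3 Lipf lamg lg Lp : ℝ),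
        DriftAssumption f lamf Lam1 Lam2 Lam3 lbf Lipf →
        CostAssumption g lamg lg Lamg lbg →
        TerminalAssumption p Lp Lbar →
        Lp ≤ Lbar →
        (∀ x μ a, ‖dA (dA f) x μ a‖ * (1 + ‖x‖ + μ.norm1) ≤ 1 / (40 * Lbar) * lamg) →
        Lamf = max Lam1 (max Lam2 Lam3) →
        Lf = max Lamf ‖f 0 (P2.dirac 0) 0‖ →
        Lg = max (max ‖dX g 0 (P2.dirac 0) 0‖ ‖dA g 0 (P2.dirac 0) 0‖) (max Lamg lbg) →
        Lalpha = max (max (20 * Lamf / (19 * lamg))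
            (20 * (lbg + 1 / 2 * (4 * Lbar) * lbf) / (19 * lamg)))
          ‖optControl f g 0 (P2.dirac 0) 0‖ →
        -- the optimal control is well defined on the cone
        (∀ x μ z, (x, μ, z) ∈ cone (4 * Lbar) →
          (∀ b, b ≠ optControl f g x μ z →
            lagrangian f g x μ z (optControl f g x μ z) < lagrangian f g x μ z b) ∧
          FirstOrderCondition f g x μ z (optControl f g x μ z)) ∧
        ∀ T t T' : ℝ, 0 ≤ t → t ≤ T' → T' ≤ T → T' - t ≤ ε₁ →
          ∃ γ : ℝ → Euc n → P2 n → Euc n,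
            -- existence of the decoupling field
            FieldContinuous t T' γ ∧ IsDecouplingField f g p t T' γ ∧
            growthNorm t T' γ ≤ ENNReal.ofReal (2 * Lbar) ∧
            -- its uniqueness
            (∀ γ' : ℝ → Euc n → P2 n → Euc n,
              FieldContinuous t T' γ' → IsDecouplingField f g p t T' γ' →
              growthNorm t T' γ' ≤ ENNReal.ofReal (2 * Lbar) →
              ∀ s ∈ Set.Icc t T', ∀ x m, γ' s x m = γ s x m) ∧
            ∃ X Z : ℝ → P2 n → ℝ → Euc n → Euc n,
              -- `X r m` is the unique solution of the forward equation started at `(r, m)`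
              (∀ r ∈ Set.Icc t T', ∀ m,
                IsForwardFlow f g γ T' r m (X r m) ∧
                ∀ Y, IsForwardFlow f g γ T' r m Y →
                  ∀ s ∈ Set.Icc r T', ∀ x, Y s x = X r m s x) ∧
              (∀ r m s x, Z r m s x = γ s (X r m s x) (m.map (X r m s))) ∧
              -- the pair solves the forward-backward system
              (∀ r ∈ Set.Icc t T', ∀ m, IsFBODESolution f g p r T' m (X r m) (Z r m)) ∧
              -- continuity in the initial time, the initial law and the initial state
              (∀ s ∈ Set.Icc t T',
                ContinuousOn (fun q : ℝ × P2 n × Euc n => X q.1 q.2.1 s q.2.2)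
                  (Set.Icc t s ×ˢ Set.univ) ∧
                ContinuousOn (fun q : ℝ × P2 n × Euc n => Z q.1 q.2.1 s q.2.2)
                  (Set.Icc t s ×ˢ Set.univ)) ∧
              -- continuous differentiability in time
              (∀ r ∈ Set.Icc t T', ∀ m x,
                ContDiffOn ℝ 1 (fun s => X r m s x) (Set.Icc r T') ∧
                ContDiffOn ℝ 1 (fun s => Z r m s x) (Set.Icc r T')) ∧
              -- the growth estimate and the cone condition
              (∀ r ∈ Set.Icc t T', ∀ m, ∀ s ∈ Set.Icc r T', ∀ x,
                ‖Z r m s x‖ ≤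
                  2 * Lbar * (1 + ‖X r m s x‖ + ∫ y, ‖X r m s y‖ ∂m.toMeasure) ∧
                (X r m s x, m.map (X r m s), Z r m s x) ∈ cone (4 * Lbar)) ∧
              -- the flow property
              (∀ r ∈ Set.Icc t T', ∀ m, ∀ s ∈ Set.Icc r T', ∀ τ ∈ Set.Icc s T', ∀ x,
                X r m τ x = X s (m.map (X r m s)) τ (X r m s x)) := by
  obtain ⟨ε₁, hε₁, hsmallε⟩ :=
    exists_small_time (systemConst Lbar Lf Lamf lbf Lg Lamg lbg Lalpha) Lbar
  refine ⟨ε₁, hε₁, fun f g p lamf Lam1 Lam2 Lam3 Lipf lamg lg Lp hf hg hp hle hsmall hLamf hLf hLg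
    hLalpha => ?_⟩
  have hL : 0 < Lbar := hp.choose_spec.pos_Lbar
  have hκ : 0 < 2 * Lbar := by positivity
  have hC := controlBounds hL hf hg hsmall
  rw [← hLamf] at hC
  refine ⟨fun x μ z hz => ⟨fun b hb => hC.optControl_lt (mem_cone_iff.1 hz) hb,
    hC.firstOrderCondition (mem_cone_iff.1 hz)⟩, fun T t T' _ htT' _ hε => ?_⟩
  have D := systemBounds hf hg hp hle hC hLamf (hLf ▸ le_max_right _ _)
    (hLg ▸ (le_max_left _ _).trans (le_max_left _ _))
    (hLalpha ▸ (le_max_left _ _).trans (le_max_left _ _)) (hLalpha ▸ le_max_right _ _)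
  obtain ⟨hs1, hs2⟩ := hsmallε D.F_lip.nonneg hL (T' - t) hε
  have hs3 : (T' - t) * (systemConst Lbar Lf Lamf lbf Lg Lamg lbg Lalpha * (4 + 12 * Lbar)) ≤
      1 / 2 :=
    IsSolutionFamily.small_system D hs1 (left_mem_Icc.2 htT')
  obtain ⟨X, Z, H⟩ := exists_isSolutionFamily (t := t) D hs3
  have hgrowth : ∀ s ∈ Icc t T', ∀ x m, ‖Z s m s x‖ ≤ 2 * Lbar * (1 + ‖x‖ + m.norm1) :=
    fun s hs x m => H.norm_field_le D hs1 hs2 hs m x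
  have hcone : ∀ r ∈ Icc t T', ∀ m, ∀ s ∈ Icc r T', ∀ x,
      ‖Z r m s x‖ ≤ 2 * Lbar * (1 + ‖X r m s x‖ + (m.map (X r m s)).norm1) := by
    intro r hr m s hs x
    rw [H.eq_field D hs1 hr hs]
    exact hgrowth s ⟨hr.1.trans hs.1, hs.2⟩ _ _
  have hbwd : ∀ {γ : ℝ → Euc n → P2 n → Euc n} {s : ℝ} (_ : s ∈ Icc t T')
      (_ : ∀ u ∈ Icc t T', ∀ x m, ‖γ u x m‖ ≤ 2 * Lbar * (1 + ‖x‖ + m.norm1))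
      (m : P2 n) (Y : ℝ → Euc n → Euc n) (x : Euc n),
      ∫ τ in s..T', bwdRHS f g (Y τ x) (m.map (Y τ)) (γ τ (Y τ x) (m.map (Y τ))) =
      ∫ τ in s..T', truncField (2 * Lbar) (bwdRHS f g) (Y τ x) (m.map (Y τ))
        (γ τ (Y τ x) (m.map (Y τ))) := by
    intro γ s hs hγ m Y x
    refine intervalIntegral.integral_congr fun u hu => ?_
    rw [uIcc_of_le hs.2] at hu
    exact (truncField_eq hκ (hγ u ⟨hs.1.trans hu.1, hu.2⟩ _ _)).symm
  -- The backward component is taken to be the field along the flow, so that its relation to `γ` is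
  -- definitional even outside the time interval; inside, `eq_field` identifies it with the
  -- component of the solution.
  refine ⟨fun s x m => Z s m s x, H.fieldContinuous D hs1, fun s hs m =>
    ⟨X s m, (isForwardFlow_iff hκ fun u hu => hgrowth u ⟨hs.1.trans hu.1, hu.2⟩).2
      (H.isFieldFlow D hs1 hs m), fun x => ?_⟩, (growthNorm_le_iff hκ.le).2 hgrowth,
    fun γ' hγ' hdec hgr s hs x m => ?_, X, fun r m s x => Z s (m.map (X r m s)) s (X r m s x),
    fun r hr m => ⟨(isForwardFlow_iff hκ fun u hu => hgrowth u ⟨hr.1.trans hu.1, hu.2⟩).2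
      (H.isFieldFlow D hs1 hr m), fun Y hY s hs x => H.flow_unique D hs1 hr
        ((isForwardFlow_iff hκ fun u hu => hgrowth u ⟨hr.1.trans hu.1, hu.2⟩).1 hY) hs x⟩,
    fun _ _ _ _ => rfl, fun r hr m => ?_, fun s hs => ⟨H.continuousOn_flow D hs1 hs,
      (H.continuousOn_backward D hs1 hs).congr fun q hq =>
        (H.eq_field D hs1 ⟨hq.1.1, hq.1.2.trans hs.2⟩ ⟨hq.1.2, hs.2⟩ q.2.1 q.2.2).symm⟩,
    fun r hr m x => ?_, fun r hr m s hs x => ?_,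
    fun r hr m s hs τ hτ x => (H.flow D hs1 hr hs hτ m x).1⟩
  · rw [hbwd hs hgrowth]
    beta_reduce
    rw [(H.sol s hs m).step.bwd x s (left_mem_Icc.2 hs.2)]
    congr 1
    refine intervalIntegral.integral_congr fun u hu => ?_
    rw [uIcc_of_le hs.2] at hu
    rw [← H.eq_field D hs1 hs hu]
  · have hγ'b := (growthNorm_le_iff hκ.le).1 hgr
    -- Both fields have growth at most `2 * Lbar`, so their difference has growth at most `4 *
    -- Lbar`.
    refine H.field_unique D hs1 hγ' (c := 4 * Lbar) (fun u hu x m => ?_) (fun s hs m => ?_) hs x m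
    · linarith [norm_sub_le (γ' u x m) (Z u m u x), hγ'b u hu x m, hgrowth u hu x m]
    · obtain ⟨Y, hY, heq⟩ := hdec s hs m
      refine ⟨Y, (isForwardFlow_iff hκ fun u hu => hγ'b u ⟨hs.1.trans hu.1, hu.2⟩).1 hY,
        fun x => ?_⟩
      rw [heq, hbwd hs hγ'b]
  · refine ⟨fun s _ => (H.regular r hr m).measurable s, fun s _ => (H.regular r hr m).memLp m s,
      fun x s hs => ?_, fun x => ?_, fun x s hs => ?_, fun x => ?_⟩
    · obtain ⟨u, hu, -, he⟩ := H.exists_hasDerivAt_fwd D hr m x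
      have h1 := (hu s).hasDerivWithinAt.congr (s := Icc r T') he (he s hs)
      rw [truncField_eq hκ (hcone r hr m s hs x)] at h1
      beta_reduce
      rwa [← H.eq_field D hs1 hr hs]
    · exact congrFun ((H.sol r hr m).initial hr.2) x
    · obtain ⟨u, hu, -, he⟩ := H.exists_hasDerivAt_bwd D hr m x
      have hz : ∀ v ∈ Icc r T', Z v (m.map (X r m v)) v (X r m v x) = u v := fun v hv => by
        rw [← H.eq_field D hs1 hr hv, he v hv]
      have h1 := (hu s).hasDerivWithinAt.congr (s := Icc r T') hz (hz s hs)
      rw [truncField_eq hκ (hcone r hr m s hs x)] at h1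
      beta_reduce
      rwa [← H.eq_field D hs1 hr hs]
    · have hT : T' ∈ Icc r T' := right_mem_Icc.2 hr.2
      beta_reduce
      rw [← H.eq_field D hs1 hr hT, (H.sol r hr m).step.bwd x T' hT,
        intervalIntegral.integral_same, add_zero]
  · constructor
    · obtain ⟨u, hu, hc, he⟩ := H.exists_hasDerivAt_fwd D hr m x
      exact (contDiff_one_of_hasDerivAt hu hc).contDiffOn.congr he
    · obtain ⟨u, hu, hc, he⟩ := H.exists_hasDerivAt_bwd D hr m x
      exact (contDiff_one_of_hasDerivAt hu hc).contDiffOn.congr fun v hv => by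
        beta_reduce
        rw [← H.eq_field D hs1 hr hv, he v hv]
  · have h1 := hcone r hr m s hs x
    rw [H.eq_field D hs1 hr hs] at h1
    refine ⟨?_, mem_cone_iff.2 h1⟩
    rwa [P2.norm1_eq_of_map ((H.regular r hr m).measurable s)
      ((H.regular r hr m).toMeasure_map m s)] at h1
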